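/- **Setting.** Write $\widehat f(p)=(2\pi)^{-3/2}\int_{\mathbb R^3}f(x)e^{-ip\cdot x}\,dx$ for the Fourier transform on $\mathbb R^3$. Let $\boldsymbol\alpha=(\boldsymbol\alpha_1,\boldsymbol\alpha_2,\boldsymbol\alpha_3)$ and $\beta$ be the $4\times4$ Dirac matrices, $D_0=-i\boldsymbol\alpha\cdot\nabla+\beta$, let $\alpha>0$ be the coupling constant, $\Lambda\ge 1$ the cut-off, and $\mathfrak H_\Lambda=\{\psi\in L^2(\mathbb R^3,\mathbb C^4):\ \operatorname{supp}\widehat\psi\subset B(0,\Lambda)\}$. All operators act on $\mathfrak H_\Lambda$ (operators on $L^2$ are compressed to it); $Q(x,y)$ is the integral kernel of $Q$ and $\widehat Q(p,q)$ that of its conjugate by the unitary Fourier transform. Let $\mathcal D^0=\boldsymbol\alpha\cdot\frac{-i\nabla}{|\nabla|}g_1(-i\nabla)+\beta g_0(-i\nabla)$, with $g_0,g_1\ge0$ radial and measurable, be a solution on $\mathfrak H_\Lambda$ of $$\mathcal D^0=D_0+\frac{\alpha}{2}\,\frac{\operatorname{sgn}(\mathcal D^0)(x,y)}{|x-y|}.$$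 Let $\mathcal C$ be the space of tempered distributions $\rho$ on $\mathbb R^3$ whose Fourier transform is a function with $\int|\widehat\rho(k)|^2|k|^{-2}\,dk<\infty$. For $\rho\in\mathcal C$ let $v_\rho=\rho*\frac1{|\cdot|}$ (a multiplication operator). Let $\mathbf Q_1$ be the space of Hilbert–Schmidt operators $Q$ on $\mathfrak H_\Lambda$ with $\iint(\sqrt{1+|p|^2}+\sqrt{1+|q|^2})|\widehat Q(p,q)|^2\,dp\,dq<\infty$. For $Q\in\mathbf Q_1$ let $R_Q$ be the operator with kernel $Q(x,y)/|x-y|$, and let $\rho\{Q\}(x)=\mathrm{Tr}_{\mathbb C^4}Q(x,x)$ be the density of $Q$. With $S_\eta=(\mathcal D^0+i\eta)^{-1}$ put $$Q_{1,0}(Q)=-\frac1{2\pi}\int_{\mathbb R}S_\eta R_QS_\eta\,d\eta,\qquad Q_{0,1}(\rho)=\frac1{2\pi}\int_{\mathbb R}S_\eta v_\rho S_\eta\,d\eta,\qquad Q_{0,2}(\rho)=-\frac1{2\pi}\int_{\mathbb R}S_\eta v_\rho S_\eta v_\rho S_\eta\,d\eta,$$ $$Q_{1,1}(Q,\rho)=\frac1{2\pi}\int_{\mathbb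 R}\big(S_\eta R_QS_\eta v_\rho S_\eta+S_\eta v_\rho S_\eta R_QS_\eta\big)\,d\eta,$$ and let $F_{1,0}:Q\mapsto Q_{1,0}(Q)$ and $\mathbf T=(\mathrm{Id}-\alpha F_{1,0})^{-1}$ on $\mathbf Q_1$. **Theorem.** There are constants $\alpha_0>0$ and $K>0$ such that, whenever $0<\alpha\le\alpha_0$, $\Lambda\ge1$ and $\alpha\sqrt{\log\Lambda}\le K$, the following holds for every such $\mathcal D^0$. The map $F_{1,0}$ sends $\mathbf Q_1$ to itself and $\mathrm{Id}-\alpha F_{1,0}$ is a bijection of $\mathbf Q_1$, so that $\mathbf T$ is well defined; and for all $\rho_0,\rho_1\in\mathcal C$ the operators $Q_{0,2}(\rho_0)$, $Q_{0,1}(\rho_1)$ and $Q_{1,1}(\mathbf T Q_{0,1}(\rho_1),\rho_0)$ belong to $\mathbf Q_1$ and $$\rho\big\{\mathbf T(Q_{0,2}(\rho_0))\big\}=\rho\big\{\mathbf T\big(Q_{1,1}(\mathbf TQ_{0,1}(\rho_1),\rho_0)\big)\big\}=0$$ identically on $\mathbb R^3$. -/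

import Mathlib

noncomputable section

namespace BDF

open MeasureTheory SchwartzMap
open scoped Matrix.Norms.Frobenius

/-- Position and momentum space `ℝ³` with its Euclidean norm. -/
abbrev R3 : Type := EuclideanSpace ℝ (Fin 3)

/-- Endomorphisms of `ℂ⁴`, with the Frobenius norm (used only through its topology and for
Hilbert-Schmidt norms). -/
abbrev M4 : Type := Matrix (Fin 4) (Fin 4) ℂ

/-! ### Dirac matrices -/

/-- The Dirac matrices `α₁, α₂, α₃`, with off-diagonal blocks the Pauli matrices. -/
def alphaMat : Fin 3 → M4 := ![
  !![0, 0, 0, 1; 0, 0, 1, 0; 0, 1, 0, 0; 1, 0, 0, 0],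
  !![0, 0, 0, -Complex.I; 0, 0, Complex.I, 0; 0, -Complex.I, 0, 0; Complex.I, 0, 0, 0],
  !![0, 0, 1, 0; 0, 0, 0, -1; 1, 0, 0, 0; 0, -1, 0, 0]]

/-- The Dirac matrix `β = diag(1, 1, -1, -1)`. -/
def betaMat : M4 := !![1, 0, 0, 0; 0, 1, 0, 0; 0, 0, -1, 0; 0, 0, 0, -1]

/-- `𝛂 · p`. -/
def alphaDot (p : R3) : M4 := ∑ j, ((p j : ℝ) : ℂ) • alphaMat j

/-! ### The dressed Dirac operator `𝒟⁰`, a Fourier multiplier -/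

/-- The symbol `(g₁(|p|)/|p|) 𝛂 · p + g₀(|p|) β`. -/
def dirac (g₀ g₁ : ℝ → ℝ) (p : R3) : M4 :=
  ((g₁ ‖p‖ / ‖p‖ : ℝ) : ℂ) • alphaDot p + ((g₀ ‖p‖ : ℝ) : ℂ) • betaMat

/-- `|𝒟⁰|` has symbol `√(g₀² + g₁²)`. -/
def absDirac (g₀ g₁ : ℝ → ℝ) (p : R3) : ℝ := Real.sqrt (g₀ ‖p‖ ^ 2 + g₁ ‖p‖ ^ 2)

/-- The symbol of `sgn 𝒟⁰`. -/
def sgnDirac (g₀ g₁ : ℝ → ℝ) (p : R3) : M4 :=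
  (((absDirac g₀ g₁ p)⁻¹ : ℝ) : ℂ) • dirac g₀ g₁ p

/-- `𝒟⁰ = 𝛂 · 𝐠₁(-i∇) + β g₀(-i∇)`, with radial nonnegative profiles `g₀, g₁`, solves
`𝒟⁰ = D₀ + (α/2) sgn(𝒟⁰)(x,y)/|x-y|` on the space of functions with Fourier transform supported
in `B(0,Λ)`. In Fourier variables, dividing the convolution kernel of `sgn 𝒟⁰` by `|x-y|`
is convolution of its symbol with `1/(2π²|l|²)`. -/
structure IsDressedDirac (α Λ : ℝ) (g₀ g₁ : ℝ → ℝ) : Prop where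
  measurable₀ : Measurable g₀
  measurable₁ : Measurable g₁
  nonneg₀ : ∀ r, 0 ≤ r → r < Λ → 0 ≤ g₀ r
  nonneg₁ : ∀ r, 0 ≤ r → r < Λ → 0 ≤ g₁ r
  self_consistent : ∀ p ∈ Metric.ball (0 : R3) Λ,
    dirac g₀ g₁ p = alphaDot p + betaMat +
      (α / 2) • (1 / (2 * Real.pi ^ 2)) •
        ∫ q in Metric.ball (0 : R3) Λ, (1 / ‖p - q‖ ^ 2) • sgnDirac g₀ g₁ q

/-- The symbol of the resolvent `(𝒟⁰ + iη)⁻¹`. -/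
def res (g₀ g₁ : ℝ → ℝ) (η : ℝ) (p : R3) : M4 :=
  (dirac g₀ g₁ p + (Complex.I * (η : ℂ)) • (1 : M4))⁻¹

/-! ### Operators on `ℌ_Λ = {ψ ∈ L²(ℝ³, ℂ⁴), supp ψ̂ ⊂ B(0,Λ)}`

An operator is given by the integral kernel `Q̂(p,q)`, `p, q ∈ B(0,Λ)`, of its conjugate under the
unitary Fourier transform; values outside `B(0,Λ) × B(0,Λ)` are never used. -/

/-- Momentum kernels `Q̂(p,q)`. -/
abbrev Ker : Type := R3 → R3 → M4

/-- Lebesgue measure on `B(0,Λ)`. -/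
def ballVol (Λ : ℝ) : Measure R3 := volume.restrict (Metric.ball 0 Λ)

/-- Lebesgue measure on `B(0,Λ) × B(0,Λ)`. -/
def ballVol2 (Λ : ℝ) : Measure (R3 × R3) := (ballVol Λ).prod (ballVol Λ)

/-- Two kernels define the same operator on `ℌ_Λ`. -/
def Ker.Eqv (Λ : ℝ) (Q Q' : Ker) : Prop :=
  ∀ᵐ z ∂(ballVol2 Λ), Q z.1 z.2 = Q' z.1 z.2

/-- Hilbert-Schmidt operators, `𝔖₂(ℌ_Λ)`. -/
def MemS2 (Λ : ℝ) (Q : Ker) : Prop :=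
  MemLp (fun z : R3 × R3 => Q z.1 z.2) 2 (ballVol2 Λ)

/-- The space `𝐐₁`: Hilbert-Schmidt operators on `ℌ_Λ` with
`∬ (√(1+|p|²) + √(1+|q|²)) |Q̂(p,q)|² dp dq < ∞`. -/
def MemQ1 (Λ : ℝ) (Q : Ker) : Prop :=
  MemS2 Λ Q ∧ Integrable (fun z : R3 × R3 =>
    (Real.sqrt (1 + ‖z.1‖ ^ 2) + Real.sqrt (1 + ‖z.2‖ ^ 2)) * ‖Q z.1 z.2‖ ^ 2) (ballVol2 Λ)

/-- The position kernel `Q(x,y) = (2π)⁻³ ∬ e^{i(p·x - q·y)} Q̂(p,q) dp dq`. The integral is over a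
bounded set, so it converges absolutely for every Hilbert-Schmidt operator on `ℌ_Λ`. -/
def posKernel (Λ : ℝ) (Q : Ker) (x y : R3) : M4 :=
  (1 / (2 * Real.pi) ^ 3) • ∫ z : R3 × R3,
    Complex.exp (Complex.I * ((inner ℝ z.1 x - inner ℝ z.2 y : ℝ) : ℂ)) • Q z.1 z.2 ∂(ballVol2 Λ)

/-- The density `ρ_Q(x) = Tr_{ℂ⁴} Q(x,x)`. Because of the cut-off, Hilbert-Schmidt operators
on `ℌ_Λ` are locally trace class and have a continuous kernel. -/
def density (Λ : ℝ) (Q : Ker) (x : R3) : ℂ := (posKernel Λ Q x x).trace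

/-- The operator `R_Q`, `R_Q(x,y) = Q(x,y)/|x-y|`, as an operator on `ℌ_Λ`:
`R̂_Q(p,q) = (1/2π²) ∫ Q̂(p-l,q-l)/|l|² dl`. -/
def RKer (Λ : ℝ) (Q : Ker) : Ker := fun p q =>
  (1 / (2 * Real.pi ^ 2)) •
    ∫ l in {l : R3 | p - l ∈ Metric.ball (0 : R3) Λ ∧ q - l ∈ Metric.ball (0 : R3) Λ},
      (1 / ‖l‖ ^ 2) • Q (p - l) (q - l)

/-! ### Densities of finite Coulomb energy -/

/-- `f = ρ̂`, with the convention `φ̂(p) = (2π)^{-3/2} ∫ e^{-ip·x} φ(x) dx`, extended to tempered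
distributions by `⟨ρ̂, φ⟩ = ⟨ρ, φ̂⟩`. -/
def IsFourierOf (ρ : 𝓢'(R3, ℂ)) (f : R3 → ℂ) : Prop :=
  ∀ φ ψ : 𝓢(R3, ℂ),
    (∀ p, ψ p = (((2 * Real.pi) ^ (-(3 / 2) : ℝ) : ℝ) : ℂ) *
      ∫ x, Complex.exp (-(Complex.I * ((inner ℝ p x : ℝ) : ℂ))) * φ x) →
    ρ ψ = ∫ k, f k * φ k

/-- The space `𝒞`: tempered distributions whose Fourier transform is a function `f` with
`∫ |f(k)|²/|k|² dk < ∞`. -/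
def IsCoulomb (ρ : 𝓢'(R3, ℂ)) : Prop :=
  ∃ f : R3 → ℂ, Measurable f ∧ Integrable (fun k => ‖f k‖ ^ 2 / ‖k‖ ^ 2) ∧ IsFourierOf ρ f

open Classical in
/-- The Fourier transform `ρ̂` of `ρ ∈ 𝒞`, unique almost everywhere. -/
def rhoHat (ρ : 𝓢'(R3, ℂ)) : R3 → ℂ :=
  if h : IsCoulomb ρ then h.choose else 0

/-- Multiplication by `v_ρ = ρ * 1/|·|`, as an operator on `ℌ_Λ`: its momentum kernel is
`(2π)^{-3/2} v̂_ρ(p-q)` with `v̂_ρ(k) = 4π ρ̂(k)/|k|²`. -/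
def VKer (ρ : 𝓢'(R3, ℂ)) : Ker := fun p q =>
  ((((2 * Real.pi) ^ (-(3 / 2) : ℝ) * (4 * Real.pi / ‖p - q‖ ^ 2) : ℝ) : ℂ) * rhoHat ρ (p - q)) •
    (1 : M4)

/-! ### The Cauchy expansion

`χ_{(-∞,0)}(𝒟⁰ + αB) - χ_{(-∞,0)}(𝒟⁰) = ∑_{j ≥ 1} αʲ Q_j` with
`Q_j = ((-1)^{j+1}/2π) ∫ (𝒟⁰+iη)⁻¹ (B (𝒟⁰+iη)⁻¹)ʲ dη` and `B = v_ρ - R_Q`; the operator `Q_{k,l}`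
is the part of `Q_{k+l}` of degree `k` in `R_Q` and `l` in `ρ`. -/

/-- `(1/2π) ∫ (𝒟⁰+iη)⁻¹ A (𝒟⁰+iη)⁻¹ dη`. -/
def cauchy1 (g₀ g₁ : ℝ → ℝ) (A : Ker) : Ker := fun p q =>
  (1 / (2 * Real.pi)) • ∫ η : ℝ, res g₀ g₁ η p * A p q * res g₀ g₁ η q

/-- `-(1/2π) ∫ (𝒟⁰+iη)⁻¹ A (𝒟⁰+iη)⁻¹ B (𝒟⁰+iη)⁻¹ dη`. -/
def cauchy2 (Λ : ℝ) (g₀ g₁ : ℝ → ℝ) (A B : Ker) : Ker := fun p q =>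
  -(1 / (2 * Real.pi)) • ∫ η : ℝ, ∫ p₁ in Metric.ball (0 : R3) Λ,
    res g₀ g₁ η p * A p p₁ * res g₀ g₁ η p₁ * B p₁ q * res g₀ g₁ η q

/-- `Q_{1,0}(Q)`, the linear map `F_{1,0}`. -/
def Q10 (Λ : ℝ) (g₀ g₁ : ℝ → ℝ) (Q : Ker) : Ker := cauchy1 g₀ g₁ (-RKer Λ Q)

/-- `Q_{0,1}(ρ)`. -/
def Q01 (g₀ g₁ : ℝ → ℝ) (ρ : 𝓢'(R3, ℂ)) : Ker := cauchy1 g₀ g₁ (VKer ρ)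

/-- `Q_{0,2}(ρ)`. -/
def Q02 (Λ : ℝ) (g₀ g₁ : ℝ → ℝ) (ρ : 𝓢'(R3, ℂ)) : Ker := cauchy2 Λ g₀ g₁ (VKer ρ) (VKer ρ)

/-- `Q_{1,1}(Q,ρ)`. -/
def Q11 (Λ : ℝ) (g₀ g₁ : ℝ → ℝ) (Q : Ker) (ρ : 𝓢'(R3, ℂ)) : Ker :=
  cauchy2 Λ g₀ g₁ (-RKer Λ Q) (VKer ρ) + cauchy2 Λ g₀ g₁ (VKer ρ) (-RKer Λ Q)

/-! ### The operator `𝐓 = (Id - α F_{1,0})⁻¹` on `𝐐₁` -/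

/-- `X ∈ 𝐐₁` and `(Id - α F_{1,0}) X = Q`. -/
def IsTImage (α Λ : ℝ) (g₀ g₁ : ℝ → ℝ) (Q X : Ker) : Prop :=
  MemQ1 Λ X ∧ Ker.Eqv Λ (X - α • Q10 Λ g₀ g₁ X) Q

/-- `F_{1,0}` maps `𝐐₁` to itself and `Id - α F_{1,0}` is a bijection of `𝐐₁`. -/
def TWellDefined (α Λ : ℝ) (g₀ g₁ : ℝ → ℝ) : Prop :=
  (∀ Q, MemQ1 Λ Q → MemQ1 Λ (Q10 Λ g₀ g₁ Q)) ∧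
  ∀ Q, MemQ1 Λ Q → ∃ X, IsTImage α Λ g₀ g₁ Q X ∧
    ∀ Y, IsTImage α Λ g₀ g₁ Q Y → Ker.Eqv Λ Y X

open Classical in
/-- `𝐓(Q)`, a representative of the inverse image of `Q` under `Id - α F_{1,0}` (meaningful when
`TWellDefined` holds and `Q ∈ 𝐐₁`). -/
def T (α Λ : ℝ) (g₀ g₁ : ℝ → ℝ) (Q : Ker) : Ker :=
  if h : ∃ X, IsTImage α Λ g₀ g₁ Q X then h.choose else 0

end BDF

end

noncomputable section

namespace BDF

open MeasureTheory Set Filter Topology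
open scoped ENNReal NNReal Matrix.Norms.Frobenius

/-! ### Integrals of inverse squares -/

/-! The vanishing of the densities is a form of Furry's theorem. With U = βα₂, the map M ↦ U Mᵀ U⁻¹
is a linear anti-automorphism of the matrices that preserves the trace, fixes each α_j and flips β.
Combined with (p,q) ↦ (-q,-p) it acts on kernels as `Ker.conj`. It fixes v_ρ, commutes with Q ↦ R_Q,
and sends the resolvent at (η,p) to minus the resolvent at (-η,-p). Each resolvent thus costs a
sign: Q_{1,0} and Q_{0,1}, with two resolvents, are equivariant (`Ker.conj_cauchy1`), while the
second order terms, with three, are odd (`Ker.conj_cauchy2`). Uniqueness of the inverse makes 𝐓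
commute with the symmetry. The density is invariant under it (`density_conj`), so the density of an
odd operator equals its own negative. No complex conjugation occurs, hence ρ need not be real.

The remaining work is analytic. For 𝐓, a Schur test with weight 1/|p| (`lintegral_diagConv_sq_le`)
bounds R_Q in L² weighted by 1/|p| + 1/|q| through Q in L² weighted by |p| + |q|. The η-integral
gains 1/√(E(p)E(q)), where E(p) ≥ √(1+|p|²) by self-consistency (`one_add_sq_le_energy`). So F_{1,0}
is bounded on 𝐐₁ uniformly in Λ (`wNorm_Q10_le`), and the contraction principle inverts Id -
αF_{1,0} for small α.

For the memberships, the cut-off makes 𝐐₁ coincide with the Hilbert-Schmidt class. The integrals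
over η of S² and S³ vanish for a single resolvent S, so Q_{0,1} and Q_{0,2} are controlled by
v̂(p-q)(𝒟⁰(p) - 𝒟⁰(q)). Finite Coulomb energy says that |k| v̂(k) is in L², so it suffices that
translating the symbol by k changes it by O(|k|) in L² (`exists_lintegral_dirac_sub_le`). That
symbol is affine plus |·|⁻² convolved with a bounded function of compact support, and this
convolution gains one derivative (`exists_shiftEnergy_le`). The gain is proved in position variables
from |·|⁻² * |·|⁻² = C∫₀^∞ e^{sΔ} ds: a Gaussian average of the translation energies leaves only 0 <
s ≤ σ, and subadditivity in the shift returns to single translations. -/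

theorem integrable_inv_sq_add_sq {a : ℝ} (ha : 0 < a) :
    Integrable (fun t : ℝ => (a ^ 2 + t ^ 2)⁻¹) := by
  have h := (integrable_inv_one_add_sq.comp_div ha.ne').const_mul ((a ^ 2)⁻¹)
  refine h.congr (Filter.Eventually.of_forall fun t => ?_)
  simp only
  field_simp

theorem integral_inv_sq_add_sq {a : ℝ} (ha : 0 < a) :
    ∫ t : ℝ, (a ^ 2 + t ^ 2)⁻¹ = Real.pi / a := by
  have h : (fun t : ℝ => (a ^ 2 + t ^ 2)⁻¹) = fun t => (a ^ 2)⁻¹ * (1 + (t / a) ^ 2)⁻¹ := by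
    ext t
    field_simp
  rw [h, integral_const_mul, Measure.integral_comp_div (fun t => (1 + t ^ 2)⁻¹),
    integral_univ_inv_one_add_sq, abs_of_pos ha, smul_eq_mul]
  field_simp

theorem lintegral_inv_sq_add_sq {a : ℝ} (ha : 0 < a) :
    ∫⁻ t : ℝ, ENNReal.ofReal ((a ^ 2 + t ^ 2)⁻¹) = ENNReal.ofReal (Real.pi / a) := by
  rw [← integral_inv_sq_add_sq ha, ofReal_integral_eq_lintegral_ofReal
    (integrable_inv_sq_add_sq ha) (Filter.Eventually.of_forall fun t => by positivity)]

/-- Cauchy-Schwarz in a form free of square roots. All the Schur tests below use it. -/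
theorem sq_lintegral_le {X : Type*} [MeasurableSpace X] {μ : Measure X} {a b c : X → ℝ≥0∞}
    (ha : AEMeasurable a μ) (hb : AEMeasurable b μ) (h : ∀ᵐ x ∂μ, c x ^ 2 ≤ a x * b x) :
    (∫⁻ x, c x ∂μ) ^ 2 ≤ (∫⁻ x, a x ∂μ) * ∫⁻ x, b x ∂μ := by
  have key : ∫⁻ x, c x ∂μ ≤ (∫⁻ x, a x ∂μ) ^ (1 / 2 : ℝ) * (∫⁻ x, b x ∂μ) ^ (1 / 2 : ℝ) := by
    refine le_trans (lintegral_mono_ae ?_) (ENNReal.lintegral_mul_norm_pow_le ha hb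
      (by norm_num) (by norm_num) (by norm_num))
    filter_upwards [h] with x hx
    have := ENNReal.rpow_le_rpow hx (by norm_num : (0 : ℝ) ≤ 1 / 2)
    rwa [ENNReal.mul_rpow_of_nonneg _ _ (by norm_num), ← ENNReal.rpow_natCast,
      ← ENNReal.rpow_mul, Nat.cast_ofNat, mul_one_div_cancel two_ne_zero, ENNReal.rpow_one] at this
  have h2 := pow_le_pow_left' key 2
  refine h2.trans_eq ?_
  rw [mul_pow, ← ENNReal.rpow_natCast, ← ENNReal.rpow_natCast, ← ENNReal.rpow_mul,
    ← ENNReal.rpow_mul]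
  norm_num

/-! ### The kernel `1/|x|²` -/

/-- The function `1/|x|²` on `ℝ³` with values in `[0, ∞]` (and value `0` at the origin). -/
def invSq (x : R3) : ℝ≥0∞ := ENNReal.ofReal (1 / ‖x‖ ^ 2)

theorem measurable_invSq : Measurable invSq := by
  unfold invSq
  fun_prop

theorem invSq_neg (x : R3) : invSq (-x) = invSq x := by
  simp [invSq]


theorem integrableOn_ball_one_div_norm_sq (r : ℝ) :
    IntegrableOn (fun x : R3 => 1 / ‖x‖ ^ 2) (Metric.ball 0 r) := by
  rw [integrableOn_fun_norm_addHaar volume (f := fun y : ℝ => 1 / y ^ 2)]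
  have h : IntegrableOn (fun _ : ℝ => (1 : ℝ)) (Ioo 0 r) := by simp
  refine h.congr_fun (fun y hy => ?_) measurableSet_Ioo
  have : y ≠ 0 := hy.1.ne'
  simp [this]

theorem lintegral_ball_invSq_lt_top (r : ℝ) : ∫⁻ x in Metric.ball 0 r, invSq x < ∞ := by
  have h := (integrableOn_ball_one_div_norm_sq r).lintegral_lt_top
  exact h

/-- A majorant of `|v|⁻² |u-v|⁻²` in the region `|v| ≤ |u-v|`, with `ρ = |u|/2`. -/
theorem lintegral_invSq_mul_inv_le {ρ : ℝ} (hρ : 0 < ρ) :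
    ∫⁻ v : R3, invSq v * ENNReal.ofReal (2 * (ρ ^ 2 + ‖v‖ ^ 2)⁻¹) ≤
      ENNReal.ofReal (3 * volume.real (Metric.ball (0 : R3) 1) * (2 * (Real.pi / ρ))) := by
  have hi : IntegrableOn (fun y : ℝ => y ^ (Module.finrank ℝ R3 - 1) •
      (1 / y ^ 2 * (2 * (ρ ^ 2 + y ^ 2)⁻¹))) (Ioi 0) := by
    refine (((integrable_inv_sq_add_sq hρ).const_mul 2).integrableOn (s := Ioi 0)).congr_fun
      (fun y hy => ?_) measurableSet_Ioi
    have : y ≠ 0 := (mem_Ioi.1 hy).ne'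
    simp [this]
  have hI := (integrable_fun_norm_addHaar (volume : Measure R3)
    (f := fun y : ℝ => 1 / y ^ 2 * (2 * (ρ ^ 2 + y ^ 2)⁻¹))).2 hi
  have heq : ∀ v : R3, invSq v * ENNReal.ofReal (2 * (ρ ^ 2 + ‖v‖ ^ 2)⁻¹) =
      ENNReal.ofReal (1 / ‖v‖ ^ 2 * (2 * (ρ ^ 2 + ‖v‖ ^ 2)⁻¹)) := fun v => by
    rw [invSq, ← ENNReal.ofReal_mul (by positivity)]
  simp_rw [heq]
  rw [← ofReal_integral_eq_lintegral_ofReal hI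
    (Filter.Eventually.of_forall fun v => by positivity),
    integral_fun_norm_addHaar volume (fun y : ℝ => 1 / y ^ 2 * (2 * (ρ ^ 2 + y ^ 2)⁻¹))]
  apply ENNReal.ofReal_le_ofReal
  have h1 : ∫ y in Ioi (0 : ℝ), y ^ (Module.finrank ℝ R3 - 1) •
      (1 / y ^ 2 * (2 * (ρ ^ 2 + y ^ 2)⁻¹)) = ∫ y in Ioi (0 : ℝ), 2 * (ρ ^ 2 + y ^ 2)⁻¹ := by
    refine setIntegral_congr_fun measurableSet_Ioi (fun y hy => ?_)
    have : y ≠ 0 := (mem_Ioi.1 hy).ne'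
    simp [this]
  have h2 : ∫ y in Ioi (0 : ℝ), 2 * (ρ ^ 2 + y ^ 2)⁻¹ ≤ 2 * (Real.pi / ρ) := by
    rw [← integral_inv_sq_add_sq hρ, ← integral_const_mul]
    exact setIntegral_le_integral ((integrable_inv_sq_add_sq hρ).const_mul 2)
      (Filter.Eventually.of_forall fun v => by positivity)
  rw [h1, finrank_euclideanSpace_fin, nsmul_eq_mul, smul_eq_mul, mul_assoc]
  gcongr
  simp

/-- Since b dominates both a and ρ, 2b² ≥ ρ² + a². The factor at the far point becomes a radial
function of the near one. -/
theorem inv_sq_mul_inv_sq_le {a b ρ : ℝ} (ha : 0 ≤ a) (hab : a ≤ b) (hb : ρ ≤ b) (hρ : 0 < ρ) :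
    1 / a ^ 2 * (1 / b ^ 2) ≤ 1 / a ^ 2 * (2 * (ρ ^ 2 + a ^ 2)⁻¹) := by
  have h1 : 0 < ρ ^ 2 + a ^ 2 := by positivity
  have h2 : 0 < b := hρ.trans_le hb
  have h3 : ρ ^ 2 + a ^ 2 ≤ 2 * b ^ 2 := by nlinarith
  have : 1 / b ^ 2 ≤ 2 * (ρ ^ 2 + a ^ 2)⁻¹ := by
    rw [← div_eq_mul_inv, div_le_div_iff₀ (by positivity) h1]
    linarith
  gcongr

/-- The constant in `∫ |u-v|⁻² |v|⁻² dv ≤ C/|u|`. -/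
def rieszConst : ℝ := 24 * Real.pi * volume.real (Metric.ball (0 : R3) 1)

theorem rieszConst_nonneg : 0 ≤ rieszConst := by
  unfold rieszConst
  positivity

/-- Of |v| and |u-v| the larger is at least |u|/2. Bounding it there leaves a radial integral in the
smaller, and the two regions are exchanged by v ↦ u - v. -/
theorem lintegral_invSq_mul_invSq_le {u : R3} (hu : u ≠ 0) :
    ∫⁻ v, invSq v * invSq (u - v) ≤ ENNReal.ofReal (rieszConst * (1 / ‖u‖)) := by
  have hu' : 0 < ‖u‖ := norm_pos_iff.2 hu
  set ρ : ℝ := ‖u‖ / 2 with hρd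
  have hρ : 0 < ρ := by positivity
  set f : R3 → ℝ≥0∞ := fun v => invSq v * ENNReal.ofReal (2 * (ρ ^ 2 + ‖v‖ ^ 2)⁻¹) with hf
  have hfm : Measurable f := by
    have := measurable_invSq
    fun_prop
  have hle : ∀ v, invSq v * invSq (u - v) ≤ f v + f (u - v) := by
    intro v
    have htri : ‖u‖ ≤ ‖v‖ + ‖u - v‖ := by
      simpa using norm_add_le v (u - v)
    have key : ∀ a b : R3, ‖u‖ ≤ ‖a‖ + ‖b‖ → ‖a‖ ≤ ‖b‖ → invSq a * invSq b ≤ f a := by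
      intro a b h hab
      simp only [hf, invSq]
      rw [← ENNReal.ofReal_mul (by positivity), ← ENNReal.ofReal_mul (by positivity)]
      exact ENNReal.ofReal_le_ofReal (inv_sq_mul_inv_sq_le (norm_nonneg _) hab
        (by linarith) hρ)
    rcases le_total ‖v‖ ‖u - v‖ with h | h
    · exact (key _ _ htri h).trans le_self_add
    · rw [mul_comm]
      exact (key _ _ (by linarith) h).trans le_add_self
  refine (lintegral_mono hle).trans ?_
  rw [lintegral_add_left hfm, lintegral_sub_left_eq_self f u]
  refine (add_le_add (lintegral_invSq_mul_inv_le hρ) (lintegral_invSq_mul_inv_le hρ)).trans ?_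
  rw [← ENNReal.ofReal_add (by positivity) (by positivity)]
  apply ENNReal.ofReal_le_ofReal
  rw [hρd, rieszConst]
  apply le_of_eq
  field_simp
  ring

/-! ### A weighted bound for simultaneous convolution with `1/|l|²` -/

/-- `∫ F(p-l, q-l) / |l|² dl`. -/
def diagConv (F : R3 × R3 → ℝ≥0∞) (z : R3 × R3) : ℝ≥0∞ :=
  ∫⁻ l, invSq l * F (z.1 - l, z.2 - l)

theorem lintegral_prod_sub_diag {F : R3 × R3 → ℝ≥0∞} (l : R3) :
    ∫⁻ z : R3 × R3, F (z.1 - l, z.2 - l) = ∫⁻ z, F z := by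
  have : (volume : Measure (R3 × R3)).IsAddRightInvariant := by
    rw [Measure.volume_eq_prod]
    infer_instance
  exact lintegral_sub_right_eq_self F ((l, l) : R3 × R3)

theorem ae_ne_zero_R3 : ∀ᵐ p : R3, p ≠ 0 := by
  simp [ae_iff, measure_singleton]

theorem ae_map_ne_zero {φ : R3 × R3 → R3} (h : Measure.QuasiMeasurePreserving φ volume volume) :
    ∀ᵐ z : R3 × R3, φ z ≠ 0 :=
  h.ae ae_ne_zero_R3

/-- Schur test with weight |φ-l|²; φ will be either of the two coordinates. Cauchy-Schwarz splits
off ∫ |l|⁻²|φ-l|⁻² dl ≤ C/|φ|. After a diagonal translation the remaining l-integral has the same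
form, which gives the second factor C. -/
theorem lintegral_diagConv_sq_le {φ : R3 × R3 → R3}
    (hφ : Measure.QuasiMeasurePreserving φ volume volume)
    (hsub : ∀ z l, φ (z.1 - l, z.2 - l) = φ z - l)
    {F : R3 × R3 → ℝ≥0∞} (hF : Measurable F) :
    ∫⁻ z, ENNReal.ofReal (1 / ‖φ z‖) * diagConv F z ^ 2 ≤
      ENNReal.ofReal (rieszConst ^ 2) * ∫⁻ z, ENNReal.ofReal ‖φ z‖ * F z ^ 2 := by
  have hφm : Measurable φ := hφ.measurable
  have hK := measurable_invSq
  have hpt : ∀ᵐ z : R3 × R3, ENNReal.ofReal (1 / ‖φ z‖) * diagConv F z ^ 2 ≤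
      ENNReal.ofReal rieszConst * ∫⁻ l, invSq (φ z) *
        (invSq l * (ENNReal.ofReal (‖φ z - l‖ ^ 2) * F (z.1 - l, z.2 - l) ^ 2)) := by
    filter_upwards [ae_map_ne_zero hφ] with z hz
    have h1 : diagConv F z ^ 2 ≤ (∫⁻ l, invSq l * invSq (φ z - l)) *
        ∫⁻ l, invSq l * (ENNReal.ofReal (‖φ z - l‖ ^ 2) * F (z.1 - l, z.2 - l) ^ 2) := by
      refine sq_lintegral_le (by fun_prop) (by fun_prop) ?_
      have hne : ∀ᵐ l : R3, l ≠ φ z := by simp [ae_iff, measure_singleton]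
      filter_upwards [hne] with l hl
      have h0 : ‖φ z - l‖ ^ 2 ≠ 0 := by
        simpa [sub_eq_zero] using hl.symm
      have : invSq (φ z - l) * ENNReal.ofReal (‖φ z - l‖ ^ 2) = 1 := by
        rw [invSq, ← ENNReal.ofReal_mul (by positivity), one_div_mul_cancel h0, ENNReal.ofReal_one]
      calc (invSq l * F (z.1 - l, z.2 - l)) ^ 2
          = invSq l ^ 2 * F (z.1 - l, z.2 - l) ^ 2 *
            (invSq (φ z - l) * ENNReal.ofReal (‖φ z - l‖ ^ 2)) := by rw [this]; ring
        _ ≤ _ := le_of_eq (by ring)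
    calc ENNReal.ofReal (1 / ‖φ z‖) * diagConv F z ^ 2
        ≤ ENNReal.ofReal (1 / ‖φ z‖) * (ENNReal.ofReal (rieszConst * (1 / ‖φ z‖)) *
          ∫⁻ l, invSq l * (ENNReal.ofReal (‖φ z - l‖ ^ 2) * F (z.1 - l, z.2 - l) ^ 2)) := by
          gcongr
          exact h1.trans (by gcongr; exact lintegral_invSq_mul_invSq_le hz)
      _ = _ := by
          rw [lintegral_const_mul _ (by fun_prop), invSq,
            ENNReal.ofReal_mul rieszConst_nonneg, show (1 / ‖φ z‖ ^ 2) = 1 / ‖φ z‖ * (1 / ‖φ z‖) by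
              rw [div_mul_div_comm, one_mul, sq], ENNReal.ofReal_mul (by positivity)]
          ring
  refine (lintegral_mono_ae hpt).trans ?_
  rw [lintegral_const_mul _ (Measurable.lintegral_prod_right (by fun_prop)),
    lintegral_lintegral_swap (by fun_prop)]
  -- Translating z along the diagonal frees F from l, so that l occurs only in two inverse squares.
  have hin : ∀ l : R3, ∫⁻ z : R3 × R3, invSq (φ z) *
        (invSq l * (ENNReal.ofReal (‖φ z - l‖ ^ 2) * F (z.1 - l, z.2 - l) ^ 2)) =
      ∫⁻ z : R3 × R3, invSq (φ z + l) *
        (invSq l * (ENNReal.ofReal (‖φ z‖ ^ 2) * F z ^ 2)) := by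
    intro l
    rw [← lintegral_prod_sub_diag (F := fun z => invSq (φ z + l) *
        (invSq l * (ENNReal.ofReal (‖φ z‖ ^ 2) * F z ^ 2))) l]
    simp only [hsub, sub_add_cancel]
  simp_rw [hin]
  rw [lintegral_lintegral_swap (by fun_prop)]
  have hpt2 : ∀ᵐ z : R3 × R3, ∫⁻ l, invSq (φ z + l) *
        (invSq l * (ENNReal.ofReal (‖φ z‖ ^ 2) * F z ^ 2)) ≤
      ENNReal.ofReal rieszConst * (ENNReal.ofReal ‖φ z‖ * F z ^ 2) := by
    filter_upwards [ae_map_ne_zero hφ] with z hz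
    have hz' : 0 < ‖φ z‖ := norm_pos_iff.2 hz
    have h2 : ∫⁻ l, invSq (φ z + l) * invSq l ≤ ENNReal.ofReal (rieszConst * (1 / ‖φ z‖)) := by
      have := lintegral_invSq_mul_invSq_le (u := -φ z) (by simpa using hz)
      rw [norm_neg] at this
      refine le_trans (le_of_eq (lintegral_congr fun l => ?_)) this
      rw [mul_comm, ← invSq_neg (φ z + l)]
      congr 2
      abel
    calc _ = (∫⁻ l, invSq (φ z + l) * invSq l) * (ENNReal.ofReal (‖φ z‖ ^ 2) * F z ^ 2) := by
          rw [← lintegral_mul_const _ (by fun_prop)]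
          simp only [mul_assoc]
      _ ≤ ENNReal.ofReal (rieszConst * (1 / ‖φ z‖)) *
          (ENNReal.ofReal (‖φ z‖ ^ 2) * F z ^ 2) := by gcongr
      _ = _ := by
          rw [← mul_assoc, ← mul_assoc, ← ENNReal.ofReal_mul, ← ENNReal.ofReal_mul]
          · congr 2
            field_simp
          · exact rieszConst_nonneg
          · have := rieszConst_nonneg
            positivity
  calc _ ≤ ENNReal.ofReal rieszConst * ∫⁻ z : R3 × R3,
        ENNReal.ofReal rieszConst * (ENNReal.ofReal ‖φ z‖ * F z ^ 2) := by
        exact mul_le_mul' le_rfl (lintegral_mono_ae hpt2)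
    _ = _ := by
        rw [lintegral_const_mul _ (by fun_prop), ← mul_assoc, ← ENNReal.ofReal_mul
          rieszConst_nonneg, sq]

theorem measurable_diagConv {F : R3 × R3 → ℝ≥0∞} (hF : Measurable F) :
    Measurable (diagConv F) := by
  have hK := measurable_invSq
  unfold diagConv
  exact Measurable.lintegral_prod_right
    (f := fun z : R3 × R3 => fun l : R3 => invSq l * F (z.1 - l, z.2 - l)) (by fun_prop)

/-! ### The heat kernel on `ℝ³` -/

/-- The heat kernel `(4πτ)^{-3/2} e^{-|x|²/4τ}`. -/
def heat (τ : ℝ) (x : R3) : ℝ := (4 * Real.pi * τ) ^ (-(3 / 2) : ℝ) * Real.exp (-‖x‖ ^ 2 / (4 * τ))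

/-- The heat kernel with values in `[0, ∞]`. -/
def eheat (τ : ℝ) (x : R3) : ℝ≥0∞ := ENNReal.ofReal (heat τ x)

theorem measurable_eheat : Measurable (Function.uncurry eheat) := by
  unfold eheat heat Function.uncurry
  fun_prop

theorem measurable_eheat_right (τ : ℝ) : Measurable (eheat τ) := by
  unfold eheat heat
  fun_prop

theorem eheat_neg (τ : ℝ) (x : R3) : eheat τ (-x) = eheat τ x := by
  simp [eheat, heat]

theorem lintegral_gaussian {b : ℝ} (hb : 0 < b) (c : R3) :
    ∫⁻ x : R3, ENNReal.ofReal (Real.exp (-b * ‖x - c‖ ^ 2)) =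
      ENNReal.ofReal ((Real.pi / b) ^ (3 / 2 : ℝ)) := by
  rw [lintegral_sub_right_eq_self (fun x : R3 => ENNReal.ofReal (Real.exp (-b * ‖x‖ ^ 2))) c]
  have h := GaussianFourier.integral_rexp_neg_mul_sq_norm (V := R3) hb
  rw [finrank_euclideanSpace_fin] at h
  -- A non-integrable function would have Bochner integral 0, but the known value is positive.
  have hi : Integrable (fun v : R3 => Real.exp (-b * ‖v‖ ^ 2)) := by
    by_contra hc
    rw [integral_undef hc] at h
    have : 0 < (Real.pi / b) ^ (((3 : ℕ) : ℝ) / 2) := by positivity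
    linarith
  rw [← ofReal_integral_eq_lintegral_ofReal hi (Eventually.of_forall fun v => by positivity), h]
  norm_num

theorem lintegral_eheat {τ : ℝ} (hτ : 0 < τ) : ∫⁻ x, eheat τ x = 1 := by
  have h : ∀ x : R3, eheat τ x = ENNReal.ofReal ((4 * Real.pi * τ) ^ (-(3 / 2) : ℝ)) *
      ENNReal.ofReal (Real.exp (-(1 / (4 * τ)) * ‖x - 0‖ ^ 2)) := fun x => by
    rw [← ENNReal.ofReal_mul (by positivity), eheat, heat, sub_zero]
    congr 3
    ring
  simp_rw [h]
  rw [lintegral_const_mul _ (by fun_prop), lintegral_gaussian (by positivity),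
    ← ENNReal.ofReal_mul (by positivity), show Real.pi / (1 / (4 * τ)) = 4 * Real.pi * τ by
      field_simp, ← Real.rpow_add (by positivity)]
  simp

/-- Completing the square in y, whose centre is the weighted mean τx/(τ+σ). The semigroup law of the
heat kernel follows by integrating the last factor. -/
theorem heat_mul_heat {τ σ : ℝ} (hτ : 0 < τ) (hσ : 0 < σ) (x y : R3) :
    heat τ y * heat σ (x - y) = ((4 * Real.pi * τ) ^ (-(3 / 2) : ℝ) *
      (4 * Real.pi * σ) ^ (-(3 / 2) : ℝ) * Real.exp (-‖x‖ ^ 2 / (4 * (τ + σ)))) *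
      Real.exp (-((τ + σ) / (4 * τ * σ)) * ‖y - (τ / (τ + σ)) • x‖ ^ 2) := by
  have h : Real.exp (-‖y‖ ^ 2 / (4 * τ)) * Real.exp (-‖x - y‖ ^ 2 / (4 * σ)) =
      Real.exp (-‖x‖ ^ 2 / (4 * (τ + σ))) *
      Real.exp (-((τ + σ) / (4 * τ * σ)) * ‖y - (τ / (τ + σ)) • x‖ ^ 2) := by
    rw [← Real.exp_add, ← Real.exp_add]
    congr 1
    rw [norm_sub_sq_real, norm_sub_sq_real, real_inner_smul_right, norm_smul, mul_pow,
      real_inner_comm y x, Real.norm_eq_abs, sq_abs]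
    field_simp
    ring
  unfold heat
  linear_combination (4 * Real.pi * τ) ^ (-(3 / 2) : ℝ) * (4 * Real.pi * σ) ^ (-(3 / 2) : ℝ) * h

theorem lintegral_eheat_mul_eheat {τ σ : ℝ} (hτ : 0 < τ) (hσ : 0 < σ) (x : R3) :
    ∫⁻ y, eheat τ y * eheat σ (x - y) = eheat (τ + σ) x := by
  have h : ∀ y : R3, eheat τ y * eheat σ (x - y) = ENNReal.ofReal ((4 * Real.pi * τ) ^
      (-(3 / 2) : ℝ) * (4 * Real.pi * σ) ^ (-(3 / 2) : ℝ) *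
        Real.exp (-‖x‖ ^ 2 / (4 * (τ + σ)))) *
      ENNReal.ofReal (Real.exp (-((τ + σ) / (4 * τ * σ)) * ‖y - (τ / (τ + σ)) • x‖ ^ 2)) :=
    fun y => by
    rw [eheat, eheat, ← ENNReal.ofReal_mul (by unfold heat; positivity), heat_mul_heat hτ hσ,
      ENNReal.ofReal_mul (by positivity)]
  simp_rw [h]
  rw [lintegral_const_mul _ (by fun_prop), lintegral_gaussian (by positivity),
    ← ENNReal.ofReal_mul (by positivity), eheat, heat]
  congr 1
  have h1 : (4 * Real.pi * τ) ^ (-(3 / 2) : ℝ) * (4 * Real.pi * σ) ^ (-(3 / 2) : ℝ) *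
      (Real.pi / ((τ + σ) / (4 * τ * σ))) ^ (3 / 2 : ℝ) =
      (4 * Real.pi * (τ + σ)) ^ (-(3 / 2) : ℝ) := by
    rw [Real.rpow_neg (by positivity), Real.rpow_neg (by positivity), Real.rpow_neg (by positivity),
      ← Real.inv_rpow (by positivity), ← Real.inv_rpow (by positivity),
      ← Real.inv_rpow (by positivity), ← Real.mul_rpow (by positivity) (by positivity),
      ← Real.mul_rpow (by positivity) (by positivity)]
    congr 1
    field_simp
  linear_combination Real.exp (-‖x‖ ^ 2 / (4 * (τ + σ))) * h1

/-! ### Subordination of `1/|x|²` to the heat kernel -/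

theorem lintegral_inv_sq_mul_exp {r : ℝ} (hr : 0 < r) :
    ∫⁻ τ in Ioi (0 : ℝ), ENNReal.ofReal (1 / τ ^ 2 * Real.exp (-r / τ)) = ENNReal.ofReal (1 / r) := by
  -- The primitive must be reset at 0: division by zero would give it the value 1/r there instead of
  -- its right limit 0.
  set g : ℝ → ℝ := Function.update (fun τ => 1 / r * Real.exp (-r / τ)) 0 0 with hg
  have hgd : ∀ τ ∈ Ioi (0 : ℝ), HasDerivAt g (1 / τ ^ 2 * Real.exp (-r / τ)) τ := by
    intro τ hτ
    have hτ0 : τ ≠ 0 := (mem_Ioi.1 hτ).ne'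
    have h1 : HasDerivAt (fun τ : ℝ => 1 / r * Real.exp (-r / τ))
        (1 / τ ^ 2 * Real.exp (-r / τ)) τ := by
      have := (((hasDerivAt_inv hτ0).const_mul (-r)).exp).const_mul (1 / r)
      simp only [← div_eq_mul_inv] at this
      refine this.congr_deriv ?_
      field_simp
    refine h1.congr_of_eventuallyEq ?_
    filter_upwards [eventually_ne_nhds hτ0] with t ht
    simp [hg, ht]
  have hpos : ∀ τ ∈ Ioi (0 : ℝ), 0 ≤ 1 / τ ^ 2 * Real.exp (-r / τ) := fun τ _ => by positivity
  have hcont : ContinuousWithinAt g (Ici 0) 0 := by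
    rw [hg, continuousWithinAt_update_same]
    have : Ici (0 : ℝ) \ {0} = Ioi 0 := by ext; simp [lt_iff_le_and_ne, eq_comm]
    rw [this]
    have h2 : Tendsto (fun τ : ℝ => -r / τ) (𝓝[>] 0) atBot := by
      simp only [div_eq_mul_inv]
      exact tendsto_inv_nhdsGT_zero.const_mul_atTop_of_neg (by linarith)
    simpa using (Real.tendsto_exp_atBot.comp h2).const_mul (1 / r)
  have hlim : Tendsto g atTop (𝓝 (1 / r)) := by
    have h2 : Tendsto (fun τ : ℝ => -r / τ) atTop (𝓝 0) := tendsto_const_nhds.div_atTop tendsto_id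
    have h3 := ((Real.continuous_exp.tendsto 0).comp h2).const_mul (1 / r)
    rw [Real.exp_zero, mul_one] at h3
    refine h3.congr' ?_
    filter_upwards [eventually_gt_atTop 0] with t ht
    simp [hg, ht.ne']
  have hint := integrableOn_Ioi_deriv_of_nonneg hcont hgd hpos hlim
  rw [← ofReal_integral_eq_lintegral_ofReal hint (ae_restrict_of_forall_mem measurableSet_Ioi hpos),
    integral_Ioi_of_hasDerivAt_of_nonneg hcont hgd hpos hlim]
  simp [hg]

/-- The function `τ^{-1/2}` on `(0, ∞)`, extended by zero. -/
def invSqrtPos (τ : ℝ) : ℝ≥0∞ := (Ioi (0 : ℝ)).indicator (fun τ => ENNReal.ofReal (τ ^ (-(1 / 2) : ℝ))) τ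

theorem measurable_invSqrtPos : Measurable invSqrtPos :=
  Measurable.indicator (by fun_prop) measurableSet_Ioi

/-- The constant in the subordination formula for `1/|x|²`. -/
def subordConst : ℝ := (4 * Real.pi) ^ (3 / 2 : ℝ) / 4

theorem subordConst_pos : 0 < subordConst := by
  unfold subordConst
  positivity

/-- The powers τ^{-1/2} and τ^{-3/2} combine to τ⁻², and the integral is then explicit. The origin
is excluded because `invSq` is 0 there while the integral diverges. -/
theorem invSq_eq_lintegral_eheat {x : R3} (hx : x ≠ 0) :
    invSq x = ENNReal.ofReal subordConst * ∫⁻ τ, invSqrtPos τ * eheat τ x := by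
  have hx' : 0 < ‖x‖ := norm_pos_iff.2 hx
  have h1 : ∀ τ : ℝ, invSqrtPos τ * eheat τ x = (Ioi (0 : ℝ)).indicator (fun τ =>
      ENNReal.ofReal ((4 * Real.pi) ^ (-(3 / 2) : ℝ)) *
        ENNReal.ofReal (1 / τ ^ 2 * Real.exp (-(‖x‖ ^ 2 / 4) / τ))) τ := by
    intro τ
    rw [invSqrtPos]
    by_cases hτ : τ ∈ Ioi (0 : ℝ)
    · have hτ' : 0 < τ := hτ
      rw [indicator_of_mem hτ, indicator_of_mem hτ, eheat, heat,
        ← ENNReal.ofReal_mul (by positivity), ← ENNReal.ofReal_mul (by positivity)]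
      congr 1
      rw [Real.mul_rpow (by positivity) hτ'.le]
      have h2 : τ ^ (-(1 / 2) : ℝ) * τ ^ (-(3 / 2) : ℝ) = 1 / τ ^ 2 := by
        rw [← Real.rpow_add hτ', show (-(1 / 2) + -(3 / 2) : ℝ) = -(2 : ℕ) by norm_num,
          Real.rpow_neg hτ'.le, Real.rpow_natCast, one_div]
      have h3 : -‖x‖ ^ 2 / (4 * τ) = -(‖x‖ ^ 2 / 4) / τ := by field_simp
      rw [h3, ← h2]
      ring
    · rw [indicator_of_notMem hτ, indicator_of_notMem hτ, zero_mul]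
  simp_rw [h1]
  rw [lintegral_indicator measurableSet_Ioi, lintegral_const_mul _ (by fun_prop),
    lintegral_inv_sq_mul_exp (by positivity), invSq, ← ENNReal.ofReal_mul (by positivity),
    ← ENNReal.ofReal_mul subordConst_pos.le]
  congr 1
  rw [subordConst, Real.rpow_neg (by positivity)]
  field_simp

theorem lintegral_comp_mul_left_pos {s : ℝ} (hs : 0 < s) {f : ℝ → ℝ≥0∞} (hf : Measurable f) :
    ∫⁻ t, f t = ENNReal.ofReal s * ∫⁻ t, f (s * t) := by
  conv_lhs => rw [← Real.smul_map_volume_mul_left hs.ne']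
  rw [lintegral_smul_measure, lintegral_map hf (by fun_prop), abs_of_pos hs, smul_eq_mul]

/-- The integral `∫₀¹ (θ(1-θ))^{-1/2} dθ`. -/
def betaHalf : ℝ≥0∞ := ∫⁻ θ, invSqrtPos θ * invSqrtPos (1 - θ)

theorem invSqrtPos_mul {s : ℝ} (hs : 0 < s) (t : ℝ) :
    invSqrtPos (s * t) = ENNReal.ofReal (s ^ (-(1 / 2) : ℝ)) * invSqrtPos t := by
  unfold invSqrtPos
  by_cases ht : t ∈ Ioi (0 : ℝ)
  · have ht' : 0 < t := ht
    have : s * t ∈ Ioi (0 : ℝ) := mul_pos hs ht'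
    rw [indicator_of_mem ht, indicator_of_mem this, ← ENNReal.ofReal_mul (by positivity),
      Real.mul_rpow hs.le ht'.le]
  · have : s * t ∉ Ioi (0 : ℝ) := by
      simp only [mem_Ioi, not_lt] at ht ⊢
      exact mul_nonpos_of_nonneg_of_nonpos hs.le ht
    rw [indicator_of_notMem ht, indicator_of_notMem this, mul_zero]

/-- Under scaling the Jacobian s cancels the two factors s^{-1/2}, so the value does not depend on
s: two half-integrations make one integration. -/
theorem lintegral_invSqrtPos_mul {s : ℝ} (hs : 0 < s) :
    ∫⁻ τ, invSqrtPos τ * invSqrtPos (s - τ) = betaHalf := by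
  have hm := measurable_invSqrtPos
  rw [lintegral_comp_mul_left_pos hs (by fun_prop)]
  have h : ∀ t, invSqrtPos (s * t) * invSqrtPos (s - s * t) =
      ENNReal.ofReal (s ^ (-1 : ℝ)) * (invSqrtPos t * invSqrtPos (1 - t)) := fun t => by
    rw [show s - s * t = s * (1 - t) by ring, invSqrtPos_mul hs, invSqrtPos_mul hs,
      show (-1 : ℝ) = -(1 / 2) + -(1 / 2) by norm_num, Real.rpow_add hs,
      ENNReal.ofReal_mul (by positivity)]
    ring
  simp_rw [h]
  rw [lintegral_const_mul _ (by fun_prop), ← mul_assoc, ← ENNReal.ofReal_mul hs.le,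
    Real.rpow_neg_one, mul_inv_cancel₀ hs.ne', ENNReal.ofReal_one, one_mul, betaHalf]

theorem lintegral_invSqrtPos_of_nonpos {s : ℝ} (hs : s ≤ 0) :
    ∫⁻ τ, invSqrtPos τ * invSqrtPos (s - τ) = 0 := by
  rw [lintegral_eq_zero_iff (by have := measurable_invSqrtPos; fun_prop)]
  refine Eventually.of_forall fun τ => ?_
  by_cases h : 0 < τ
  · have : s - τ ∉ Ioi (0 : ℝ) := by simp only [mem_Ioi]; linarith
    simp [invSqrtPos, this]
  · simp [invSqrtPos, h]

theorem lintegral_invSqrtPos_conv {φ : ℝ → ℝ≥0∞} (hφ : Measurable φ) :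
    ∫⁻ τ, ∫⁻ τ', invSqrtPos τ * invSqrtPos τ' * φ (τ + τ') = betaHalf * ∫⁻ s in Ioi 0, φ s := by
  have hm := measurable_invSqrtPos
  have h1 : ∀ τ, ∫⁻ τ', invSqrtPos τ * invSqrtPos τ' * φ (τ + τ') =
      ∫⁻ s, invSqrtPos τ * invSqrtPos (s - τ) * φ s := fun τ => by
    rw [← lintegral_sub_right_eq_self (fun τ' => invSqrtPos τ * invSqrtPos τ' * φ (τ + τ')) τ]
    simp
  simp_rw [h1]
  rw [lintegral_lintegral_swap (by fun_prop), ← lintegral_const_mul _ hφ,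
    ← lintegral_indicator measurableSet_Ioi]
  refine lintegral_congr fun s => ?_
  rw [lintegral_mul_const _ (by fun_prop)]
  by_cases hs : s ∈ Ioi (0 : ℝ)
  · rw [indicator_of_mem hs, lintegral_invSqrtPos_mul hs]
  · rw [indicator_of_notMem hs, lintegral_invSqrtPos_of_nonpos (not_lt.1 hs), zero_mul]

/-- The convolution `|·|⁻² * |·|⁻²`, a multiple of `1/|x|`. -/
def invSqConv (x : R3) : ℝ≥0∞ := ∫⁻ y, invSq y * invSq (x - y)

theorem measurable_invSqConv : Measurable invSqConv := by
  have := measurable_invSq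
  unfold invSqConv
  exact Measurable.lintegral_prod_right
    (f := fun x : R3 => fun y : R3 => invSq y * invSq (x - y)) (by fun_prop)

theorem lintegral_eheat_mul_subord {τ τ' : ℝ} (x : R3) :
    ∫⁻ y, (invSqrtPos τ * eheat τ y) * (invSqrtPos τ' * eheat τ' (x - y)) =
      invSqrtPos τ * invSqrtPos τ' * eheat (τ + τ') x := by
  have h1 := measurable_eheat_right τ
  have h2 := measurable_eheat_right τ'
  have h : ∀ y, (invSqrtPos τ * eheat τ y) * (invSqrtPos τ' * eheat τ' (x - y)) =
    (invSqrtPos τ * invSqrtPos τ') * (eheat τ y * eheat τ' (x - y)) := fun y => by ring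
  simp_rw [h]
  rw [lintegral_const_mul _ (by fun_prop)]
  by_cases hτ : 0 < τ
  · by_cases hτ' : 0 < τ'
    · rw [lintegral_eheat_mul_eheat hτ hτ']
    · simp [invSqrtPos, hτ']
  · simp [invSqrtPos, hτ]

/-- Subordinate both factors to the heat kernel, apply the semigroup law in y, and let the two
densities τ^{-1/2} convolve to a constant. In operator terms, the square of (-Δ)^{-1/2} is (-Δ)⁻¹ =
∫₀^∞ e^{sΔ} ds. -/
theorem invSqConv_eq (x : R3) : invSqConv x =
    ENNReal.ofReal subordConst ^ 2 * betaHalf * ∫⁻ s in Ioi 0, eheat s x := by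
  have hm := measurable_invSqrtPos
  have hh : ∀ x : R3, Measurable fun τ => eheat τ x := fun x =>
    measurable_eheat.comp (by fun_prop : Measurable fun τ : ℝ => (τ, x))
  have hh2 := measurable_eheat
  have hae : ∀ᵐ y : R3, invSq y * invSq (x - y) = ENNReal.ofReal subordConst ^ 2 *
      ∫⁻ τ, ∫⁻ τ', (invSqrtPos τ * eheat τ y) * (invSqrtPos τ' * eheat τ' (x - y)) := by
    have hne : ∀ᵐ y : R3, y ≠ x := by simp [ae_iff, measure_singleton]
    filter_upwards [ae_ne_zero_R3, hne] with y hy hy'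
    rw [invSq_eq_lintegral_eheat hy, invSq_eq_lintegral_eheat (sub_ne_zero.2 hy'.symm)]
    have hhx := hh (x - y)
    have hhy := hh y
    rw [lintegral_lintegral_mul (by fun_prop) (by fun_prop)]
    ring
  have hu : Measurable fun w : R3 × ℝ × ℝ => (invSqrtPos w.2.1 * eheat w.2.1 w.1) *
      (invSqrtPos w.2.2 * eheat w.2.2 (x - w.1)) := by
    have a1 : Measurable fun w : R3 × ℝ × ℝ => eheat w.2.1 w.1 :=
      measurable_eheat.comp (by fun_prop : Measurable fun w : R3 × ℝ × ℝ => (w.2.1, w.1))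
    have a2 : Measurable fun w : R3 × ℝ × ℝ => eheat w.2.2 (x - w.1) :=
      measurable_eheat.comp (by fun_prop : Measurable fun w : R3 × ℝ × ℝ => (w.2.2, x - w.1))
    fun_prop
  have hsw : ∫⁻ y : R3, ∫⁻ τ, ∫⁻ τ', (invSqrtPos τ * eheat τ y) * (invSqrtPos τ' * eheat τ' (x - y))
      = ∫⁻ τ, ∫⁻ τ', ∫⁻ y : R3, (invSqrtPos τ * eheat τ y) * (invSqrtPos τ' * eheat τ' (x - y)) := by
    have e1 : ∀ y : R3, ∫⁻ τ, ∫⁻ τ', (invSqrtPos τ * eheat τ y) *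
        (invSqrtPos τ' * eheat τ' (x - y)) = ∫⁻ t : ℝ × ℝ, (invSqrtPos t.1 * eheat t.1 y) *
        (invSqrtPos t.2 * eheat t.2 (x - y)) := fun y => by
      rw [Measure.volume_eq_prod, lintegral_prod]
      exact (hu.comp (by fun_prop : Measurable fun t : ℝ × ℝ => (y, t))).aemeasurable
    simp_rw [e1]
    rw [lintegral_lintegral_swap hu.aemeasurable, Measure.volume_eq_prod ℝ, lintegral_prod]
    exact (Measurable.lintegral_prod_left (f := fun (y : R3) (t : ℝ × ℝ) =>
      (invSqrtPos t.1 * eheat t.1 y) * (invSqrtPos t.2 * eheat t.2 (x - y))) hu).aemeasurable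
  rw [invSqConv, lintegral_congr_ae hae, lintegral_const_mul, hsw]
  · simp_rw [lintegral_eheat_mul_subord]
    rw [lintegral_invSqrtPos_conv (hh x), mul_assoc]
  · have : Measurable fun w : R3 × ℝ => ∫⁻ τ', (invSqrtPos w.2 * eheat w.2 w.1) *
        (invSqrtPos τ' * eheat τ' (x - w.1)) :=
      Measurable.lintegral_prod_right (f := fun (w : R3 × ℝ) (τ' : ℝ) =>
        (invSqrtPos w.2 * eheat w.2 w.1) * (invSqrtPos τ' * eheat τ' (x - w.1)))
        (hu.comp (by fun_prop : Measurable fun z : (R3 × ℝ) × ℝ => (z.1.1, z.1.2, z.2)))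
    exact Measurable.lintegral_prod_right (f := fun (y : R3) (τ : ℝ) =>
      ∫⁻ τ', (invSqrtPos τ * eheat τ y) * (invSqrtPos τ' * eheat τ' (x - y))) this

/-- The beta integral need not be evaluated: were it infinite, `invSqConv` would be infinite away
from 0, against the bound C/|x|. -/
theorem betaHalf_ne_top : betaHalf ≠ ∞ := by
  intro h
  obtain ⟨x, hx⟩ := exists_ne (0 : R3)
  have h1 : invSqConv x ≠ ∞ :=
    ((lintegral_invSq_mul_invSq_le hx).trans_lt ENNReal.ofReal_lt_top).ne
  rw [invSqConv_eq, h, ENNReal.mul_top (by simpa using subordConst_pos), ENNReal.top_mul] at h1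
  · exact h1 rfl
  · have hm : Measurable fun τ => eheat τ x :=
      measurable_eheat.comp (by fun_prop : Measurable fun τ : ℝ => (τ, x))
    refine (setLIntegral_pos_iff hm).2 ?_ |>.ne'
    have : Function.support (fun τ => eheat τ x) ∩ Ioi 0 = Ioi 0 := by
      refine inter_eq_right.2 fun τ hτ => ?_
      have hτ' : 0 < τ := hτ
      simp only [Function.mem_support, eheat, heat, ne_eq, ENNReal.ofReal_eq_zero, not_le]
      positivity
    rw [this, Real.volume_Ioi]
    simp

/-- The constant in `|·|⁻² * |·|⁻² = C ∫₀^∞ e^{sΔ} ds`. -/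
def convConst : ℝ≥0∞ := ENNReal.ofReal subordConst ^ 2 * betaHalf

theorem convConst_ne_top : convConst ≠ ∞ :=
  ENNReal.mul_ne_top (ENNReal.pow_ne_top ENNReal.ofReal_ne_top) betaHalf_ne_top

theorem lintegral_Ioi_add (φ : ℝ → ℝ≥0∞) (σ : ℝ) :
    ∫⁻ s in Ioi 0, φ (s + σ) = ∫⁻ s in Ioi σ, φ s := by
  rw [← lintegral_indicator measurableSet_Ioi, ← lintegral_indicator measurableSet_Ioi,
    ← lintegral_add_right_eq_self ((Ioi σ).indicator φ) σ]
  refine lintegral_congr fun s => ?_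
  simp [indicator]

/-- Heat flow for time σ moves the range of times from (0,∞) to (σ,∞). -/
theorem lintegral_eheat_mul_invSqConv {σ : ℝ} (hσ : 0 < σ) (x : R3) :
    ∫⁻ k, eheat σ k * invSqConv (x + k) = convConst * ∫⁻ s in Ioi σ, eheat s x := by
  have hm : Measurable fun τ => eheat τ x :=
    measurable_eheat.comp (by fun_prop : Measurable fun τ : ℝ => (τ, x))
  have hu : Measurable fun w : R3 × ℝ => eheat σ w.1 * eheat w.2 (x + w.1) := by
    have a1 : Measurable fun w : R3 × ℝ => eheat w.2 (x + w.1) :=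
      measurable_eheat.comp (by fun_prop : Measurable fun w : R3 × ℝ => (w.2, x + w.1))
    have a2 := measurable_eheat_right σ
    fun_prop
  have h1 : ∀ k, eheat σ k * invSqConv (x + k) =
      convConst * ∫⁻ s in Ioi 0, eheat σ k * eheat s (x + k) := fun k => by
    rw [invSqConv_eq, lintegral_const_mul, convConst]
    · ring
    · exact measurable_eheat.comp (by fun_prop : Measurable fun s : ℝ => (s, x + k))
  simp_rw [h1]
  rw [lintegral_const_mul _ (Measurable.lintegral_prod_right
      (f := fun (k : R3) (s : ℝ) => eheat σ k * eheat s (x + k)) hu),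
    lintegral_lintegral_swap hu.aemeasurable, ← lintegral_Ioi_add (fun s => eheat s x)]
  congr 1
  refine setLIntegral_congr_fun measurableSet_Ioi fun s hs => ?_
  rw [add_comm s, ← lintegral_eheat_mul_eheat hσ hs,
    ← lintegral_neg_eq_self (fun y => eheat σ y * eheat s (x - y))]
  simp [eheat_neg]

/-- What smoothing removes is the contribution of times in (0,σ], a kernel of total mass
proportional to σ. The additive form avoids truncated subtraction in [0,∞]. -/
theorem invSqConv_eq_add {σ : ℝ} (hσ : 0 < σ) (x : R3) :
    invSqConv x = (∫⁻ k, eheat σ k * invSqConv (x + k)) +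
      convConst * ∫⁻ s in Ioc 0 σ, eheat s x := by
  rw [lintegral_eheat_mul_invSqConv hσ, ← mul_add, add_comm, invSqConv_eq, convConst,
    ← Ioc_union_Ioi_eq_Ioi hσ.le, lintegral_union measurableSet_Ioi (Ioc_disjoint_Ioi le_rfl)]

theorem lintegral_lintegral_Ioc_eheat {σ : ℝ} :
    ∫⁻ x : R3, ∫⁻ s in Ioc 0 σ, eheat s x = ENNReal.ofReal σ := by
  rw [lintegral_lintegral_swap (f := fun (x : R3) (s : ℝ) => eheat s x)
    (measurable_eheat.comp measurable_swap).aemeasurable]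
  rw [setLIntegral_congr_fun measurableSet_Ioc (fun s hs => lintegral_eheat hs.1)]
  simp

/-! ### Riesz potentials -/

/-- The convolution `|·|⁻² * f`. -/
def rieszPot (f : R3 → ℝ) (p : R3) : ℝ := ∫ a, 1 / ‖p - a‖ ^ 2 * f a

theorem stronglyMeasurable_rieszPot {f : R3 → ℝ} (hf : Measurable f) :
    StronglyMeasurable (rieszPot f) := by
  unfold rieszPot
  refine StronglyMeasurable.integral_prod_right
    (f := fun (p : R3) (a : R3) => 1 / ‖p - a‖ ^ 2 * f a) ?_
  refine Measurable.stronglyMeasurable ?_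
  unfold Function.uncurry
  fun_prop

/-- 1/|x| is at most 1 away from the unit ball and at most |x|⁻² inside, so an f in L¹ ∩ L^∞ can be
integrated against it. -/
theorem invSqConv_le (x : R3) (hx : x ≠ 0) :
    invSqConv x ≤ ENNReal.ofReal rieszConst *
      (1 + (Metric.ball (0 : R3) 1).indicator invSq x) := by
  refine (lintegral_invSq_mul_invSq_le hx).trans ?_
  rw [ENNReal.ofReal_mul rieszConst_nonneg]
  gcongr
  have hx' : 0 < ‖x‖ := norm_pos_iff.2 hx
  by_cases h : ‖x‖ < 1
  · rw [indicator_of_mem (by simpa using h), invSq]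
    refine le_trans (ENNReal.ofReal_le_ofReal ?_) le_add_self
    rw [div_le_div_iff₀ hx' (by positivity)]
    nlinarith
  · refine le_trans ?_ le_self_add
    rw [← ENNReal.ofReal_one]
    refine ENNReal.ofReal_le_ofReal ?_
    rw [div_le_one hx']
    exact not_lt.1 h

theorem exists_lintegral_invSqConv_le {f : R3 → ℝ} (hf : Integrable f) {M : ℝ≥0}
    (hM : ∀ a, ‖f a‖ₑ ≤ M) :
    ∃ C : ℝ≥0∞, C ≠ ∞ ∧ ∀ x, ∫⁻ b, ‖f b‖ₑ * invSqConv (b - x) ≤ C := by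
  have hK := measurable_invSq
  have hB : MeasurableSet (Metric.ball (0 : R3) 1) := measurableSet_ball
  refine ⟨ENNReal.ofReal rieszConst * ((∫⁻ b, ‖f b‖ₑ) +
    M * ∫⁻ x in Metric.ball 0 1, invSq x), ?_, fun x => ?_⟩
  · refine ENNReal.mul_ne_top ENNReal.ofReal_ne_top (ENNReal.add_ne_top.2 ⟨hf.2.ne, ?_⟩)
    exact ENNReal.mul_ne_top ENNReal.coe_ne_top (lintegral_ball_invSq_lt_top 1).ne
  · have hle : ∀ᵐ b : R3, ‖f b‖ₑ * invSqConv (b - x) ≤ ENNReal.ofReal rieszConst *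
        (‖f b‖ₑ + M * (Metric.ball (0 : R3) 1).indicator invSq (b - x)) := by
      have hne : ∀ᵐ b : R3, b ≠ x := by simp [ae_iff, measure_singleton]
      filter_upwards [hne] with b hb
      calc ‖f b‖ₑ * invSqConv (b - x) ≤ ‖f b‖ₑ * (ENNReal.ofReal rieszConst *
            (1 + (Metric.ball (0 : R3) 1).indicator invSq (b - x))) := by
            gcongr
            exact invSqConv_le _ (sub_ne_zero.2 hb)
        _ = ENNReal.ofReal rieszConst * (‖f b‖ₑ +
            ‖f b‖ₑ * (Metric.ball (0 : R3) 1).indicator invSq (b - x)) := by ring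
        _ ≤ _ := by
            gcongr
            exact hM b
    refine (lintegral_mono_ae hle).trans (le_of_eq ?_)
    have hmi : Measurable fun b => (Metric.ball (0 : R3) 1).indicator invSq (b - x) :=
      (hK.indicator hB).comp (by fun_prop)
    rw [lintegral_const_mul' _ _ ENNReal.ofReal_ne_top, lintegral_add_right _ (by fun_prop),
      lintegral_const_mul _ hmi,
      lintegral_sub_right_eq_self (fun b => (Metric.ball (0 : R3) 1).indicator invSq b) x,
      lintegral_indicator hB]

theorem lintegral_invSq_shift (a b k : R3) :
    ∫⁻ p, invSq (p - a) * invSq (p - k - b) = invSqConv (b - a + k) := by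
  rw [← lintegral_add_right_eq_self _ a, invSqConv]
  refine lintegral_congr fun y => ?_
  rw [← invSq_neg (y + a - k - b)]
  congr 2 <;> abel

/-! ### Pairings of a Riesz potential with its translates, averaged over a law of shifts -/

section Bilinear

variable {f : R3 → ℝ} (ν : Measure R3)

theorem enorm_one_div_norm_sq (x : R3) : ‖1 / ‖x‖ ^ 2‖ₑ = invSq x := by
  rw [invSq, ← ofReal_norm, Real.norm_of_nonneg (by positivity)]

/-- Absolute convergence in all four variables, which justifies every later use of Fubini. The shift
k is drawn from ν: a Dirac mass gives a fixed translation, a Gaussian gives the averaged one. -/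
theorem integrable_rieszPot_kernel [IsProbabilityMeasure ν] (hf : Measurable f)
    (hfi : Integrable f) {M : ℝ≥0} (hM : ∀ a, ‖f a‖ₑ ≤ M) :
    Integrable (fun w : (R3 × R3) × (R3 × R3) =>
      (1 / ‖w.2.2 - w.1.1‖ ^ 2 * f w.1.1) * (1 / ‖w.2.2 - w.2.1 - w.1.2‖ ^ 2 * f w.1.2))
      ((volume.prod volume).prod (ν.prod volume)) := by
  have hK := measurable_invSq
  have hJ := measurable_invSqConv
  refine ⟨Measurable.aestronglyMeasurable (by fun_prop), ?_⟩
  obtain ⟨C, hC, hCle⟩ := exists_lintegral_invSqConv_le hfi hM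
  rw [HasFiniteIntegral]
  simp_rw [enorm_mul, enorm_one_div_norm_sq]
  rw [lintegral_prod _ (by fun_prop), lintegral_prod]
  · have h1 : ∀ a b : R3, ∫⁻ w : R3 × R3, invSq (w.2 - a) * ‖f a‖ₑ *
        (invSq (w.2 - w.1 - b) * ‖f b‖ₑ) ∂(ν.prod volume) =
        ‖f a‖ₑ * ∫⁻ k, ‖f b‖ₑ * invSqConv (b - a + k) ∂ν := by
      intro a b
      rw [lintegral_prod _ (by fun_prop), ← lintegral_const_mul _ (by fun_prop)]
      refine lintegral_congr fun k => ?_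
      rw [← lintegral_invSq_shift, ← lintegral_const_mul _ (by fun_prop),
        ← lintegral_const_mul _ (by fun_prop)]
      exact lintegral_congr fun p => by ring
    simp_rw [h1]
    have h2 : ∀ a : R3, ∫⁻ b, ‖f a‖ₑ * ∫⁻ k, ‖f b‖ₑ * invSqConv (b - a + k) ∂ν ≤ ‖f a‖ₑ * C := by
      intro a
      rw [lintegral_const_mul _ (Measurable.lintegral_prod_right
        (f := fun (b : R3) (k : R3) => ‖f b‖ₑ * invSqConv (b - a + k)) (by fun_prop))]
      rw [lintegral_lintegral_swap (by fun_prop)]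
      gcongr
      calc ∫⁻ k, (∫⁻ b, ‖f b‖ₑ * invSqConv (b - a + k)) ∂ν ≤ ∫⁻ _, C ∂ν := by
            refine lintegral_mono fun k => ?_
            have := hCle (a - k)
            refine le_trans (le_of_eq (lintegral_congr fun b => ?_)) this
            congr 2
            abel
        _ = C := by simp
    refine (lintegral_mono h2).trans_lt ?_
    rw [lintegral_mul_const _ (by fun_prop)]
    exact ENNReal.mul_lt_top hfi.2 hC.lt_top
  · exact (Measurable.lintegral_prod_right (f := fun (x : R3 × R3) (w : R3 × R3) =>
      invSq (w.2 - x.1) * ‖f x.1‖ₑ * (invSq (w.2 - w.1 - x.2) * ‖f x.2‖ₑ))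
      (by fun_prop)).aemeasurable

theorem rieszPot_mul_rieszPot (p k : R3) :
    ∫ x : R3 × R3, (1 / ‖p - x.1‖ ^ 2 * f x.1) * (1 / ‖p - k - x.2‖ ^ 2 * f x.2)
      ∂(volume.prod volume) = rieszPot f p * rieszPot f (p - k) :=
  integral_prod_mul (fun a => 1 / ‖p - a‖ ^ 2 * f a) (fun b => 1 / ‖p - k - b‖ ^ 2 * f b)

theorem integrable_rieszPot_mul [IsProbabilityMeasure ν] (hf : Measurable f)
    (hfi : Integrable f) {M : ℝ≥0} (hM : ∀ a, ‖f a‖ₑ ≤ M) :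
    Integrable (fun w : R3 × R3 => rieszPot f w.2 * rieszPot f (w.2 - w.1)) (ν.prod volume) := by
  have h := (integrable_rieszPot_kernel ν hf hfi hM).integral_prod_right
  simpa only [rieszPot_mul_rieszPot] using h

theorem integral_rieszPot_kernel [SFinite ν] (f : R3 → ℝ) (x : R3 × R3) :
    ∫ y : R3 × R3, (1 / ‖y.2 - x.1‖ ^ 2 * f x.1) * (1 / ‖y.2 - y.1 - x.2‖ ^ 2 * f x.2)
      ∂(ν.prod volume) = f x.1 * f x.2 * (∫⁻ k, invSqConv (x.2 - x.1 + k) ∂ν).toReal := by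
  have hK := measurable_invSq
  have h1 : ∀ y : R3 × R3, (1 / ‖y.2 - x.1‖ ^ 2 * f x.1) * (1 / ‖y.2 - y.1 - x.2‖ ^ 2 * f x.2) =
      (f x.1 * f x.2) * (1 / ‖y.2 - x.1‖ ^ 2 * (1 / ‖y.2 - y.1 - x.2‖ ^ 2)) := fun y => by ring
  simp_rw [h1]
  rw [integral_const_mul]
  congr 1
  rw [integral_eq_lintegral_of_nonneg_ae (Eventually.of_forall fun y => by positivity)
    (Measurable.aestronglyMeasurable (by fun_prop))]
  congr 1
  have h2 : ∀ y : R3 × R3, ENNReal.ofReal (1 / ‖y.2 - x.1‖ ^ 2 * (1 / ‖y.2 - y.1 - x.2‖ ^ 2)) =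
      invSq (y.2 - x.1) * invSq (y.2 - y.1 - x.2) := fun y => by
    rw [ENNReal.ofReal_mul (by positivity), invSq, invSq]
  simp_rw [h2]
  rw [lintegral_prod _ (by fun_prop)]
  exact lintegral_congr fun k => lintegral_invSq_shift _ _ _

theorem integrable_mul_invSqConv [IsProbabilityMeasure ν] (hf : Measurable f)
    (hfi : Integrable f) {M : ℝ≥0} (hM : ∀ a, ‖f a‖ₑ ≤ M) :
    Integrable (fun x : R3 × R3 => f x.1 * f x.2 *
      (∫⁻ k, invSqConv (x.2 - x.1 + k) ∂ν).toReal) (volume.prod volume) := by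
  have h := (integrable_rieszPot_kernel ν hf hfi hM).integral_prod_left
  simpa only [integral_rieszPot_kernel] using h

theorem integral_rieszPot_mul [IsProbabilityMeasure ν] (hf : Measurable f)
    (hfi : Integrable f) {M : ℝ≥0} (hM : ∀ a, ‖f a‖ₑ ≤ M) :
    ∫ w : R3 × R3, rieszPot f w.2 * rieszPot f (w.2 - w.1) ∂(ν.prod volume) =
      ∫ x : R3 × R3, f x.1 * f x.2 * (∫⁻ k, invSqConv (x.2 - x.1 + k) ∂ν).toReal
        ∂(volume.prod volume) := by
  simp_rw [← rieszPot_mul_rieszPot]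
  rw [← integral_integral_swap (integrable_rieszPot_kernel ν hf hfi hM)]
  simp_rw [integral_rieszPot_kernel]

end Bilinear

/-! ### Translation energy of a Riesz potential -/

section Difference

variable {f : R3 → ℝ} {M : ℝ≥0}

theorem integrable_rieszPot_mul_shift (hf : Measurable f) (hfi : Integrable f)
    (hM : ∀ a, ‖f a‖ₑ ≤ M) (k : R3) :
    Integrable (fun p : R3 => rieszPot f p * rieszPot f (p - k)) := by
  have h := integrable_rieszPot_mul (Measure.dirac k) hf hfi hM
  rw [Measure.dirac_prod] at h
  exact (integrable_map_measure h.1 (by fun_prop)).1 h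

theorem integral_rieszPot_sq (hf : Measurable f) (hfi : Integrable f)
    (hM : ∀ a, ‖f a‖ₑ ≤ M) :
    ∫ p, rieszPot f p * rieszPot f p =
      ∫ x : R3 × R3, f x.1 * f x.2 * (invSqConv (x.2 - x.1)).toReal ∂(volume.prod volume) := by
  have h1 := integrable_rieszPot_mul (Measure.dirac (0 : R3)) hf hfi hM
  have h := integral_rieszPot_mul (Measure.dirac (0 : R3)) hf hfi hM
  rw [Measure.dirac_prod] at h h1
  rw [integral_map (by fun_prop) h1.1] at h
  have hJ := measurable_invSqConv
  have h2 : ∀ x : R3 × R3, ∫⁻ k, invSqConv (x.2 - x.1 + k) ∂(Measure.dirac (0 : R3)) =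
      invSqConv (x.2 - x.1) := fun x => by
    rw [lintegral_dirac, add_zero]
  simp_rw [h2, sub_zero] at h
  exact h

/-- The squared `L²` distance between the potential `|·|⁻² * f` and its translate by `k`. -/
def shiftEnergy (f : R3 → ℝ) (k : R3) : ℝ≥0∞ :=
  ∫⁻ p, ENNReal.ofReal ((rieszPot f p - rieszPot f (p - k)) ^ 2)

theorem integrable_rieszPot_sub_sq (hf : Measurable f) (hfi : Integrable f)
    (hM : ∀ a, ‖f a‖ₑ ≤ M) (k : R3) :
    Integrable (fun p => (rieszPot f p - rieszPot f (p - k)) ^ 2) ∧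
      ∫ p, (rieszPot f p - rieszPot f (p - k)) ^ 2 = 2 * (∫ p, rieszPot f p * rieszPot f p) -
        2 * ∫ p, rieszPot f p * rieszPot f (p - k) := by
  have i0 : Integrable (fun p => rieszPot f p * rieszPot f p) := by
    simpa using integrable_rieszPot_mul_shift hf hfi hM 0
  have i1 := i0.comp_sub_right k
  have i2 := (integrable_rieszPot_mul_shift hf hfi hM k).const_mul 2
  have i3 : Integrable (fun p => rieszPot f p * rieszPot f p +
    rieszPot f (p - k) * rieszPot f (p - k)) := i0.add i1
  have heq : ∀ p, (rieszPot f p - rieszPot f (p - k)) ^ 2 = rieszPot f p * rieszPot f p +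
      rieszPot f (p - k) * rieszPot f (p - k) - 2 * (rieszPot f p * rieszPot f (p - k)) :=
    fun p => by ring
  simp_rw [heq]
  refine ⟨i3.sub i2, ?_⟩
  rw [integral_sub i3 i2, integral_add i0 i1, integral_const_mul,
    integral_sub_right_eq_self (fun p => rieszPot f p * rieszPot f p) k]
  ring

theorem shiftEnergy_eq (hf : Measurable f) (hfi : Integrable f) (hM : ∀ a, ‖f a‖ₑ ≤ M) (k : R3) :
    shiftEnergy f k = ENNReal.ofReal (2 * (∫ p, rieszPot f p * rieszPot f p) -
      2 * ∫ p, rieszPot f p * rieszPot f (p - k)) := by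
  obtain ⟨h1, h2⟩ := integrable_rieszPot_sub_sq hf hfi hM k
  rw [shiftEnergy, ← h2, ofReal_integral_eq_lintegral_ofReal h1]
  exact Eventually.of_forall fun p => by positivity

/-- The difference of the two kernels is convConst ∫₀^σ e^{sΔ} ds, which is nonnegative with mass
convConst · σ. One factor f is bounded by M and the other is integrated. -/
theorem integral_rieszPot_sub_le (hf : Measurable f)
    (hM : ∀ a, ‖f a‖ₑ ≤ M) {σ : ℝ} (hσ : 0 < σ) :
    ENNReal.ofReal (∫ x : R3 × R3, f x.1 * f x.2 * ((invSqConv (x.2 - x.1)).toReal -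
      (∫⁻ k, eheat σ k * invSqConv (x.2 - x.1 + k)).toReal) ∂(volume.prod volume)) ≤
      convConst * M * (∫⁻ a, ‖f a‖ₑ) * ENNReal.ofReal σ := by
  have hJ := measurable_invSqConv
  have hhm : Measurable fun x : R3 => ∫⁻ s in Ioc 0 σ, eheat s x :=
    Measurable.lintegral_prod_right (f := fun (x : R3) (s : ℝ) => eheat s x)
      (measurable_eheat.comp measurable_swap)
  refine (Real.ofReal_le_enorm _).trans ((enorm_integral_le_lintegral_enorm _).trans ?_)
  have hne : ∀ᵐ x : R3 × R3 ∂(volume.prod volume), x.2 - x.1 ≠ 0 := by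
    rw [Measure.ae_prod_iff_ae_ae]
    · refine Eventually.of_forall fun a => ?_
      simp [ae_iff, sub_eq_zero, measure_singleton]
    · exact (measurableSet_eq_fun (by fun_prop) (by fun_prop)).compl
  have hle : ∀ᵐ x : R3 × R3 ∂(volume.prod volume),
      ‖f x.1 * f x.2 * ((invSqConv (x.2 - x.1)).toReal -
        (∫⁻ k, eheat σ k * invSqConv (x.2 - x.1 + k)).toReal)‖ₑ ≤
      ‖f x.1‖ₑ * (M * (convConst * ∫⁻ s in Ioc 0 σ, eheat s (x.2 - x.1))) := by
    filter_upwards [hne] with x hx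
    have hfin : invSqConv (x.2 - x.1) ≠ ∞ :=
      ((lintegral_invSq_mul_invSq_le hx).trans_lt ENNReal.ofReal_lt_top).ne
    have hadd := invSqConv_eq_add hσ (x.2 - x.1)
    have h12 := ENNReal.add_ne_top.1 (hadd ▸ hfin)
    have hdiff : (invSqConv (x.2 - x.1)).toReal -
        (∫⁻ k, eheat σ k * invSqConv (x.2 - x.1 + k)).toReal =
        (convConst * ∫⁻ s in Ioc 0 σ, eheat s (x.2 - x.1)).toReal := by
      conv_lhs => rw [hadd]
      rw [ENNReal.toReal_add h12.1 h12.2]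
      ring
    rw [hdiff, enorm_mul, enorm_mul, mul_assoc, Real.enorm_eq_ofReal ENNReal.toReal_nonneg,
      ENNReal.ofReal_toReal h12.2]
    gcongr
    exact hM _
  refine (lintegral_mono_ae hle).trans (le_of_eq ?_)
  have key : ∀ W : R3 → ℝ≥0∞, Measurable W →
      ∫⁻ x : R3 × R3, ‖f x.1‖ₑ * (M * (convConst * W (x.2 - x.1))) ∂(volume.prod volume) =
        convConst * M * (∫⁻ a, ‖f a‖ₑ) * ∫⁻ x, W x := by
    intro W hW
    rw [lintegral_prod _ (by fun_prop)]
    have h1 : ∀ a : R3, ∫⁻ b, ‖f a‖ₑ * (M * (convConst * W (b - a))) =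
        ‖f a‖ₑ * (M * (convConst * ∫⁻ x, W x)) := fun a => by
      rw [lintegral_const_mul _ (by fun_prop), lintegral_const_mul _ (by fun_prop),
        lintegral_const_mul _ (by fun_prop), lintegral_sub_right_eq_self W a]
    simp_rw [h1]
    rw [lintegral_mul_const _ (by fun_prop)]
    ring
  rw [key _ hhm, lintegral_lintegral_Ioc_eheat]

/-- Expanding the square gives 2⟨u,u⟩ - 2⟨u,u(·-k)⟩. Averaging over a Gaussian k heat-smooths the
kernel of the second pairing, so only the short-time part survives. -/
theorem lintegral_eheat_mul_shiftEnergy_le (hf : Measurable f) (hfi : Integrable f)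
    (hM : ∀ a, ‖f a‖ₑ ≤ M) {σ : ℝ} (hσ : 0 < σ) :
    ∫⁻ k, eheat σ k * shiftEnergy f k ≤
      2 * (convConst * M * (∫⁻ a, ‖f a‖ₑ) * ENNReal.ofReal σ) := by
  have hJ := measurable_invSqConv
  have hH := measurable_eheat_right σ
  set ν : Measure R3 := volume.withDensity (eheat σ) with hν
  have hνp : IsProbabilityMeasure ν := ⟨by
    rw [hν, withDensity_apply _ MeasurableSet.univ, setLIntegral_univ, lintegral_eheat hσ]⟩
  set u := rieszPot f with hu
  have hum : StronglyMeasurable u := stronglyMeasurable_rieszPot hf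
  have hi := integrable_rieszPot_mul ν hf hfi hM
  have hR : Integrable (fun k => ∫ p, u p * u (p - k)) ν := hi.integral_prod_left
  have hRi : ∫ k, (∫ p, u p * u (p - k)) ∂ν = ∫ x : R3 × R3, f x.1 * f x.2 *
      (∫⁻ k, eheat σ k * invSqConv (x.2 - x.1 + k)).toReal ∂(volume.prod volume) := by
    rw [← integral_prod (fun w : R3 × R3 => u w.2 * u (w.2 - w.1)) hi,
      integral_rieszPot_mul ν hf hfi hM]
    refine integral_congr_ae (Eventually.of_forall fun x => ?_)
    simp only
    rw [hν, lintegral_withDensity_eq_lintegral_mul _ hH (by fun_prop)]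
    rfl
  have hnonneg : ∀ k, 0 ≤ 2 * (∫ p, u p * u p) - 2 * ∫ p, u p * u (p - k) := by
    intro k
    rw [hu, ← (integrable_rieszPot_sub_sq hf hfi hM k).2]
    exact integral_nonneg fun p => by positivity
  have hconv : ∫⁻ k, eheat σ k * shiftEnergy f k = ∫⁻ k, shiftEnergy f k ∂ν := by
    rw [hν, lintegral_withDensity_eq_lintegral_mul_non_measurable _ hH]
    · rfl
    · exact Eventually.of_forall fun k => ENNReal.ofReal_lt_top
  rw [hconv]
  simp_rw [shiftEnergy_eq hf hfi hM]
  have hsub : Integrable (fun k => 2 * (∫ p, u p * u p) - 2 * ∫ p, u p * u (p - k)) ν :=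
    (integrable_const _).sub (hR.const_mul 2)
  rw [← hu, ← ofReal_integral_eq_lintegral_ofReal hsub (Eventually.of_forall hnonneg),
    integral_sub (integrable_const _) (hR.const_mul 2),
    integral_const_mul (μ := ν) 2 (fun k => ∫ p, u p * u (p - k)), hRi, integral_const,
    probReal_univ, one_smul, ← mul_sub, integral_rieszPot_sq hf hfi hM, ENNReal.ofReal_mul (by norm_num),
    ENNReal.ofReal_ofNat]
  gcongr
  refine le_trans (le_of_eq ?_) (integral_rieszPot_sub_le hf hM hσ)
  congr 1
  rw [← integral_sub]
  · simp_rw [mul_sub]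
  · simpa [lintegral_dirac] using integrable_mul_invSqConv (Measure.dirac (0 : R3)) hf hfi hM
  · have h := integrable_mul_invSqConv ν hf hfi hM
    refine h.congr (Eventually.of_forall fun x => ?_)
    simp only
    rw [hν, lintegral_withDensity_eq_lintegral_mul _ hH (by fun_prop)]
    rfl

/-! ### From Gaussian averages to single translations -/

theorem measurable_shiftEnergy (hf : Measurable f) : Measurable (shiftEnergy f) := by
  have hu : Measurable (rieszPot f) := (stronglyMeasurable_rieszPot hf).measurable
  exact Measurable.lintegral_prod_right (f := fun (k : R3) (p : R3) =>
    ENNReal.ofReal ((rieszPot f p - rieszPot f (p - k)) ^ 2)) (by fun_prop)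

/-- Insert the intermediate translate by k and use (x+y)² ≤ 2x² + 2y² with translation invariance.
-/
theorem shiftEnergy_add_le (hf : Measurable f) (k l : R3) :
    shiftEnergy f (k + l) ≤ 2 * shiftEnergy f k + 2 * shiftEnergy f l := by
  have hu : Measurable (rieszPot f) := (stronglyMeasurable_rieszPot hf).measurable
  have h1 : shiftEnergy f l =
      ∫⁻ p, ENNReal.ofReal ((rieszPot f (p - k) - rieszPot f (p - k - l)) ^ 2) := by
    rw [shiftEnergy, ← lintegral_sub_right_eq_self _ k]
  rw [h1, shiftEnergy, shiftEnergy, ← lintegral_const_mul _ (by fun_prop),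
    ← lintegral_const_mul _ (by fun_prop), ← lintegral_add_left (by fun_prop)]
  refine lintegral_mono fun p => ?_
  simp only
  have h2 : ∀ t : ℝ, 2 * ENNReal.ofReal t = ENNReal.ofReal (2 * t) := fun t => by
    rw [ENNReal.ofReal_mul (by norm_num), ENNReal.ofReal_ofNat]
  rw [h2, h2, ← ENNReal.ofReal_add (by positivity) (by positivity),
    sub_sub]
  refine ENNReal.ofReal_le_ofReal ?_
  nlinarith [sq_nonneg ((rieszPot f p - rieszPot f (p - k)) -
    (rieszPot f (p - k) - rieszPot f (p - (k + l))))]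

/-- At time |k|² a displacement by k is comparable to the width, so doubling the time absorbs it:
|x|² ≤ 2|k|² + 2|k-x|² costs e^{1/4}, and the normalisation costs 2^{3/2}. -/
theorem eheat_sub_le {k : R3} (hk : k ≠ 0) (x : R3) :
    eheat (‖k‖ ^ 2) (k - x) ≤
      ENNReal.ofReal (Real.exp (1 / 4) * 2 ^ (3 / 2 : ℝ)) * eheat (2 * ‖k‖ ^ 2) x := by
  have hk' : 0 < ‖k‖ := norm_pos_iff.2 hk
  rw [eheat, eheat, ← ENNReal.ofReal_mul (by positivity)]
  refine ENNReal.ofReal_le_ofReal ?_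
  rw [heat, heat]
  have h1 : (4 * Real.pi * (2 * ‖k‖ ^ 2)) ^ (-(3 / 2) : ℝ) =
      (2 : ℝ) ^ (-(3 / 2) : ℝ) * (4 * Real.pi * ‖k‖ ^ 2) ^ (-(3 / 2) : ℝ) := by
    rw [← Real.mul_rpow (by positivity) (by positivity)]
    congr 1
    ring
  have h2 : (2 : ℝ) ^ (3 / 2 : ℝ) * (2 : ℝ) ^ (-(3 / 2) : ℝ) = 1 := by
    rw [← Real.rpow_add (by norm_num)]
    simp
  have h3 : Real.exp (-‖k - x‖ ^ 2 / (4 * ‖k‖ ^ 2)) ≤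
      Real.exp (1 / 4) * Real.exp (-‖x‖ ^ 2 / (4 * (2 * ‖k‖ ^ 2))) := by
    rw [← Real.exp_add]
    refine Real.exp_le_exp.2 ?_
    have h4 : ‖x‖ ≤ ‖k‖ + ‖k - x‖ := by
      have := norm_sub_le k (k - x)
      simpa using this
    have h5 : ‖x‖ ^ 2 ≤ 2 * ‖k‖ ^ 2 + 2 * ‖k - x‖ ^ 2 := by
      nlinarith [norm_nonneg x, norm_nonneg (k - x), sq_nonneg (‖k‖ - ‖k - x‖)]
    rw [div_add_div _ _ (by norm_num) (by positivity),
      div_le_div_iff₀ (by positivity) (by positivity)]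
    nlinarith [mul_le_mul_of_nonneg_left h5 (sq_nonneg ‖k‖), sq_nonneg ‖k‖]
  rw [h1]
  calc _ ≤ (4 * Real.pi * ‖k‖ ^ 2) ^ (-(3 / 2) : ℝ) *
        (Real.exp (1 / 4) * Real.exp (-‖x‖ ^ 2 / (4 * (2 * ‖k‖ ^ 2)))) := by gcongr
    _ = ((2 : ℝ) ^ (3 / 2 : ℝ) * (2 : ℝ) ^ (-(3 / 2) : ℝ)) * ((4 * Real.pi * ‖k‖ ^ 2) ^
        (-(3 / 2) : ℝ) * (Real.exp (1 / 4) * Real.exp (-‖x‖ ^ 2 / (4 * (2 * ‖k‖ ^ 2))))) := by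
        rw [h2, one_mul]
    _ = _ := by ring

/-- Convolution with `|·|⁻²` gains one derivative in `L²`. -/
theorem exists_shiftEnergy_le (hf : Measurable f) (hfi : Integrable f)
    (hM : ∀ a, ‖f a‖ₑ ≤ M) :
    ∃ C : ℝ≥0∞, C ≠ ∞ ∧ ∀ k, shiftEnergy f k ≤ C * ENNReal.ofReal (‖k‖ ^ 2) := by
  set A : ℝ≥0∞ := convConst * M * ∫⁻ a, ‖f a‖ₑ with hA
  have hAt : A ≠ ∞ := ENNReal.mul_ne_top (ENNReal.mul_ne_top convConst_ne_top ENNReal.coe_ne_top)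
    hfi.2.ne
  set c : ℝ≥0∞ := ENNReal.ofReal (Real.exp (1 / 4) * 2 ^ (3 / 2 : ℝ)) with hc
  have hE := measurable_shiftEnergy hf
  refine ⟨4 * A + 8 * c * A, ?_, fun k => ?_⟩
  · exact ENNReal.add_ne_top.2 ⟨ENNReal.mul_ne_top (by simp) hAt,
      ENNReal.mul_ne_top (ENNReal.mul_ne_top (by simp) ENNReal.ofReal_ne_top) hAt⟩
  · by_cases hk : k = 0
    · simp [hk, shiftEnergy]
    have hσ : 0 < ‖k‖ ^ 2 := by
      have := norm_pos_iff.2 hk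
      positivity
    have hH := measurable_eheat_right (‖k‖ ^ 2)
    have hH2 := measurable_eheat_right (2 * ‖k‖ ^ 2)
    -- Write k = l + (k-l) and average over a Gaussian l at time |k|². Both parts are then Gaussian
    -- averages, the second after the recentring of `eheat_sub_le`.
    have h1 : shiftEnergy f k = ∫⁻ l, eheat (‖k‖ ^ 2) l * shiftEnergy f k := by
      rw [lintegral_mul_const _ hH, lintegral_eheat hσ, one_mul]
    have h2 : ∫⁻ l, eheat (‖k‖ ^ 2) l * shiftEnergy f (k - l) ≤
        c * ∫⁻ l, eheat (2 * ‖k‖ ^ 2) l * shiftEnergy f l := by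
      rw [← lintegral_sub_left_eq_self _ k, ← lintegral_const_mul _ (by fun_prop)]
      refine lintegral_mono fun l => ?_
      simp only [sub_sub_cancel]
      rw [← mul_assoc]
      gcongr
      exact eheat_sub_le hk l
    calc shiftEnergy f k ≤ ∫⁻ l, (2 * (eheat (‖k‖ ^ 2) l * shiftEnergy f l) +
          2 * (eheat (‖k‖ ^ 2) l * shiftEnergy f (k - l))) := by
          rw [h1]
          refine lintegral_mono fun l => ?_
          have := shiftEnergy_add_le hf l (k - l)
          rw [add_sub_cancel] at this
          calc eheat (‖k‖ ^ 2) l * shiftEnergy f k ≤ eheat (‖k‖ ^ 2) l *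
                (2 * shiftEnergy f l + 2 * shiftEnergy f (k - l)) := by gcongr
            _ = _ := by ring
      _ ≤ 2 * (2 * (A * ENNReal.ofReal (‖k‖ ^ 2))) +
          2 * (c * (2 * (A * ENNReal.ofReal (2 * ‖k‖ ^ 2)))) := by
          rw [lintegral_add_left (by fun_prop), lintegral_const_mul _ (by fun_prop),
            lintegral_const_mul _ (by fun_prop)]
          gcongr
          · exact lintegral_eheat_mul_shiftEnergy_le hf hfi hM hσ
          · refine h2.trans ?_
            gcongr
            exact lintegral_eheat_mul_shiftEnergy_le hf hfi hM (by positivity)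
      _ = _ := by
          rw [ENNReal.ofReal_mul (by norm_num), ENNReal.ofReal_ofNat]
          ring

end Difference

/-- The uniform structure of the Frobenius norm. It agrees definitionally with the product uniform
structure, but only the former is recognized by instance search as that of a normed space. -/
instance frobeniusUniformSpace : UniformSpace M4 :=
  PseudoMetricSpace.toUniformSpace

/-- The topology of the Frobenius norm. -/
instance frobeniusTopologicalSpace : TopologicalSpace M4 :=
  UniformSpace.toTopologicalSpace

/-! ### Clifford algebra of the Dirac matrices -/

/-- The matrix `𝛂 · v + t β`. -/
def cliff (v : R3) (t : ℝ) : M4 := alphaDot v + (t : ℂ) • betaMat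

theorem cliff_eq (v : R3) (t : ℝ) : cliff v t =
    !![(t : ℂ), 0, v 2, v 0 - v 1 * Complex.I; 0, t, v 0 + v 1 * Complex.I, -v 2;
      v 2, v 0 - v 1 * Complex.I, -t, 0; v 0 + v 1 * Complex.I, -v 2, 0, -t] := by
  ext i j
  fin_cases i <;> fin_cases j <;>
    simp [cliff, alphaDot, betaMat, alphaMat, Fin.sum_univ_three, sub_eq_add_neg]

theorem cliff_sub (v w : R3) (s t : ℝ) : cliff v s - cliff w t = cliff (v - w) (s - t) := by
  simp only [cliff, alphaDot, PiLp.sub_apply, Complex.ofReal_sub, sub_smul,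
    Finset.sum_sub_distrib]
  abel

theorem norm_sq_R3 (v : R3) : ‖v‖ ^ 2 = v 0 ^ 2 + v 1 ^ 2 + v 2 ^ 2 := by
  rw [EuclideanSpace.real_norm_sq_eq, Fin.sum_univ_three]

theorem cliff_mul_self (v : R3) (t : ℝ) :
    cliff v t * cliff v t = ((‖v‖ ^ 2 + t ^ 2 : ℝ) : ℂ) • (1 : M4) := by
  have hI := Complex.I_sq
  rw [norm_sq_R3, cliff_eq]
  ext i j
  fin_cases i <;> fin_cases j <;>
    simp [Matrix.mul_apply, Fin.sum_univ_four] <;> ring_nf <;> simp [hI]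

theorem frobenius_norm_sq (A : M4) : ‖A‖ ^ 2 = ∑ i, ∑ j, ‖A i j‖ ^ 2 := by
  rw [Matrix.frobenius_norm_def, ← Real.sqrt_eq_rpow, Real.sq_sqrt (by positivity)]
  simp

/-- The factor 4 is the squared Frobenius norm of the identity; it is the source of the numerical
constants in the resolvent bounds. -/
theorem norm_sq_cliff_sub (v : R3) (t η : ℝ) :
    ‖cliff v t - (Complex.I * (η : ℂ)) • (1 : M4)‖ ^ 2 = 4 * (‖v‖ ^ 2 + t ^ 2 + η ^ 2) := by
  rw [frobenius_norm_sq, norm_sq_R3, cliff_eq]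
  simp only [Fin.sum_univ_four, ← Complex.normSq_eq_norm_sq]
  simp [Complex.normSq_apply]
  ring

theorem norm_sq_cliff (v : R3) (t : ℝ) : ‖cliff v t‖ ^ 2 = 4 * (‖v‖ ^ 2 + t ^ 2) := by
  simpa using norm_sq_cliff_sub v t 0

theorem cliff_add_mul_sub (v : R3) (t η : ℝ) :
    (cliff v t + (Complex.I * (η : ℂ)) • (1 : M4)) *
      (cliff v t - (Complex.I * (η : ℂ)) • (1 : M4)) =
      ((‖v‖ ^ 2 + t ^ 2 + η ^ 2 : ℝ) : ℂ) • (1 : M4) := by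
  rw [add_mul, mul_sub, mul_sub, cliff_mul_self, smul_mul_assoc, one_mul, mul_smul_comm, mul_one,
    smul_mul_assoc, one_mul, smul_smul]
  have : Complex.I * (η : ℂ) * (Complex.I * (η : ℂ)) = -((η ^ 2 : ℝ) : ℂ) := by
    push_cast
    linear_combination (η : ℂ) ^ 2 * Complex.I_sq
  rw [this]
  push_cast
  module

/-! ### Resolvents of Clifford matrices -/

/-- The resolvent `(A + iη)⁻¹`. -/
def matRes (A : M4) (η : ℝ) : M4 := (A + (Complex.I * (η : ℂ)) • (1 : M4))⁻¹

/-- Matrices `𝛂 · v + t β` with `|v|² + t² ≥ 1`. -/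
def IsGapped (A : M4) : Prop := ∃ v t, A = cliff v t ∧ 1 ≤ ‖v‖ ^ 2 + t ^ 2

theorem matRes_cliff {v : R3} {t : ℝ} (h : 0 < ‖v‖ ^ 2 + t ^ 2) (η : ℝ) :
    matRes (cliff v t) η = (((‖v‖ ^ 2 + t ^ 2 + η ^ 2)⁻¹ : ℝ) : ℂ) •
      (cliff v t - (Complex.I * (η : ℂ)) • (1 : M4)) := by
  have hne : ((‖v‖ ^ 2 + t ^ 2 + η ^ 2 : ℝ) : ℂ) ≠ 0 := by
    exact_mod_cast (by positivity : ‖v‖ ^ 2 + t ^ 2 + η ^ 2 ≠ 0)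
  refine Matrix.inv_eq_right_inv ?_
  rw [mul_smul_comm, cliff_add_mul_sub, smul_smul, Complex.ofReal_inv, inv_mul_cancel₀ hne,
    one_smul]

theorem isUnit_cliff_add {v : R3} {t : ℝ} (h : 0 < ‖v‖ ^ 2 + t ^ 2) (η : ℝ) :
    IsUnit (cliff v t + (Complex.I * (η : ℂ)) • (1 : M4)) := by
  have hne : ((‖v‖ ^ 2 + t ^ 2 + η ^ 2 : ℝ) : ℂ) ≠ 0 := by
    exact_mod_cast (by positivity : ‖v‖ ^ 2 + t ^ 2 + η ^ 2 ≠ 0)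
  refine IsUnit.of_mul_eq_one ((((‖v‖ ^ 2 + t ^ 2 + η ^ 2)⁻¹ : ℝ) : ℂ) •
      (cliff v t - (Complex.I * (η : ℂ)) • (1 : M4))) ?_
  rw [mul_smul_comm, cliff_add_mul_sub, smul_smul, Complex.ofReal_inv, inv_mul_cancel₀ hne,
    one_smul]

theorem norm_sq_matRes_cliff {v : R3} {t : ℝ} (h : 0 < ‖v‖ ^ 2 + t ^ 2) (η : ℝ) :
    ‖matRes (cliff v t) η‖ ^ 2 = 4 * (‖v‖ ^ 2 + t ^ 2 + η ^ 2)⁻¹ := by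
  rw [matRes_cliff h, norm_smul, mul_pow, norm_sq_cliff_sub, Complex.norm_real, Real.norm_eq_abs,
    sq_abs]
  field_simp

theorem IsGapped.norm_sq_matRes_le {A : M4} (hA : IsGapped A) (η : ℝ) :
    ‖matRes A η‖ ^ 2 ≤ 4 * (1 ^ 2 + η ^ 2)⁻¹ := by
  obtain ⟨v, t, rfl, h⟩ := hA
  rw [norm_sq_matRes_cliff (by linarith)]
  gcongr
  simpa using h

theorem IsGapped.norm_matRes_le_two {A : M4} (hA : IsGapped A) (η : ℝ) : ‖matRes A η‖ ≤ 2 := by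
  have h := hA.norm_sq_matRes_le η
  have : (1 ^ 2 + η ^ 2)⁻¹ ≤ 1 := inv_le_one_of_one_le₀ (by nlinarith [sq_nonneg η])
  nlinarith [norm_nonneg (matRes A η)]

theorem IsGapped.norm_matRes_mul_le {A B : M4} (hA : IsGapped A) (hB : IsGapped B) (η : ℝ) :
    ‖matRes A η‖ * ‖matRes B η‖ ≤ 4 * (1 ^ 2 + η ^ 2)⁻¹ := by
  have h1 := hA.norm_sq_matRes_le η
  have h2 := hB.norm_sq_matRes_le η
  nlinarith [sq_nonneg (‖matRes A η‖ - ‖matRes B η‖)]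

theorem IsGapped.isUnit {A : M4} (hA : IsGapped A) (η : ℝ) :
    IsUnit (A + (Complex.I * (η : ℂ)) • (1 : M4)) := by
  obtain ⟨v, t, rfl, h⟩ := hA
  exact isUnit_cliff_add (by linarith) η

theorem IsGapped.matRes_sub {A B : M4} (hA : IsGapped A) (hB : IsGapped B) (η : ℝ) :
    matRes A η - matRes B η = matRes A η * (B - A) * matRes B η := by
  have h1 : matRes A η * (A + (Complex.I * (η : ℂ)) • (1 : M4)) = 1 :=
    Matrix.nonsing_inv_mul _ ((Matrix.isUnit_iff_isUnit_det _).1 (hA.isUnit η))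
  have h2 : (B + (Complex.I * (η : ℂ)) • (1 : M4)) * matRes B η = 1 :=
    Matrix.mul_nonsing_inv _ ((Matrix.isUnit_iff_isUnit_det _).1 (hB.isUnit η))
  have h3 : B - A = (B + (Complex.I * (η : ℂ)) • (1 : M4)) -
      (A + (Complex.I * (η : ℂ)) • (1 : M4)) := by abel
  rw [h3, mul_sub, sub_mul, h1, mul_assoc, h2, mul_one, one_mul]

theorem IsGapped.hasDerivAt_matRes {A : M4} (hA : IsGapped A) (η : ℝ) :
    HasDerivAt (matRes A) (-(Complex.I • (matRes A η * matRes A η))) η := by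
  obtain ⟨u, hu⟩ := hA.isUnit η
  have h1 : HasDerivAt (fun η : ℝ => A + (Complex.I * (η : ℂ)) • (1 : M4))
      (Complex.I • (1 : M4)) η := by
    have h2 : HasDerivAt (fun η : ℝ => Complex.I * (η : ℂ)) (Complex.I) η := by
      simpa using (Complex.ofRealCLM.hasDerivAt (x := η)).const_mul Complex.I
    exact (h2.smul_const (1 : M4)).const_add A
  have h3 := hasFDerivAt_ringInverse (𝕜 := ℝ) u
  rw [hu] at h3
  have h4 := h3.comp_hasDerivAt η h1
  have h5 : matRes A = Ring.inverse ∘ fun η : ℝ => A + (Complex.I * (η : ℂ)) • (1 : M4) := by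
    ext1 η
    simp [matRes, Matrix.nonsing_inv_eq_ringInverse]
  have h6 : ((u⁻¹ : M4ˣ) : M4) = matRes A η := by
    rw [h5, Function.comp_apply, ← hu, Ring.inverse_unit]
  rw [h6, ← h5] at h4
  refine h4.congr_deriv ?_
  simp

theorem IsGapped.continuous_matRes {A : M4} (hA : IsGapped A) : Continuous (matRes A) :=
  continuous_iff_continuousAt.2 fun η => (hA.hasDerivAt_matRes η).continuousAt

theorem IsGapped.tendsto_matRes {A : M4} (hA : IsGapped A) {l : Filter ℝ}
    (hl : Tendsto (fun η : ℝ => η ^ 2) l atTop) : Tendsto (matRes A) l (𝓝 0) := by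
  rw [tendsto_zero_iff_norm_tendsto_zero]
  have h1 : Tendsto (fun η : ℝ => 4 * (1 ^ 2 + η ^ 2)⁻¹) l (𝓝 0) := by
    have := (tendsto_inv_atTop_zero.comp (tendsto_atTop_add_const_left l (1 ^ 2 : ℝ) hl)).const_mul 4
    simpa using this
  have h2 : Tendsto (fun η => ‖matRes A η‖ ^ 2) l (𝓝 0) :=
    squeeze_zero (fun η => by positivity) (fun η => hA.norm_sq_matRes_le η) h1
  have h3 := (Real.continuous_sqrt.tendsto 0).comp h2
  simpa [Function.comp_def] using h3

theorem tendsto_sq_atBot : Tendsto (fun η : ℝ => η ^ 2) atBot atTop := by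
  simpa [sq] using tendsto_id.atBot_mul_atBot₀ (tendsto_id (α := ℝ) (x := atBot))

theorem IsGapped.integrable_mul {A B : M4} (hA : IsGapped A) (hB : IsGapped B) :
    Integrable (fun η => matRes A η * matRes B η) := by
  refine Integrable.mono' ((integrable_inv_sq_add_sq one_pos).const_mul 4)
    (hA.continuous_matRes.mul hB.continuous_matRes).aestronglyMeasurable
    (Eventually.of_forall fun η => ?_)
  exact (norm_mul_le _ _).trans (hA.norm_matRes_mul_le hB η)

theorem IsGapped.integrable_mul_mul {A B C : M4} (hA : IsGapped A) (hB : IsGapped B)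
    (hC : IsGapped C) : Integrable (fun η => matRes A η * matRes B η * matRes C η) := by
  refine Integrable.mono' ((integrable_inv_sq_add_sq one_pos).const_mul 8)
    ((hA.continuous_matRes.mul hB.continuous_matRes).mul hC.continuous_matRes).aestronglyMeasurable
    (Eventually.of_forall fun η => ?_)
  have h1 := hA.norm_matRes_mul_le hB η
  calc _ ≤ ‖matRes A η‖ * ‖matRes B η‖ * ‖matRes C η‖ := norm_mul₃_le
    _ ≤ (4 * (1 ^ 2 + η ^ 2)⁻¹) * 2 := by
        gcongr
        exact hC.norm_matRes_le_two η
    _ = _ := by ring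

/-- The square of the resolvent is a multiple of its η-derivative, and the resolvent vanishes at
both ends. -/
theorem IsGapped.integral_sq {A : M4} (hA : IsGapped A) :
    ∫ η, matRes A η * matRes A η = 0 := by
  have h := integral_of_hasDerivAt_of_tendsto hA.hasDerivAt_matRes
    ((hA.integrable_mul hA).smul Complex.I).neg (hA.tendsto_matRes tendsto_sq_atBot)
    (hA.tendsto_matRes (tendsto_pow_atTop two_ne_zero))
  rw [integral_neg, integral_smul, sub_zero, neg_eq_zero] at h
  exact (smul_eq_zero.1 h).resolve_left Complex.I_ne_zero

theorem IsGapped.integral_cube {A : M4} (hA : IsGapped A) :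
    ∫ η, matRes A η * matRes A η * matRes A η = 0 := by
  have hd : ∀ η, HasDerivAt (fun η => matRes A η * matRes A η)
      (-((2 * Complex.I) • (matRes A η * matRes A η * matRes A η))) η := by
    intro η
    refine ((hA.hasDerivAt_matRes η).mul (hA.hasDerivAt_matRes η)).congr_deriv ?_
    rw [neg_mul, mul_neg, smul_mul_assoc, mul_smul_comm, mul_assoc]
    module
  have ht : ∀ {l : Filter ℝ}, Tendsto (fun η : ℝ => η ^ 2) l atTop →
      Tendsto (fun η => matRes A η * matRes A η) l (𝓝 0) := fun hl => by
    simpa using (hA.tendsto_matRes hl).mul (hA.tendsto_matRes hl)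
  have h := integral_of_hasDerivAt_of_tendsto hd
    ((hA.integrable_mul_mul hA hA).smul (2 * Complex.I)).neg (ht tendsto_sq_atBot)
    (ht (tendsto_pow_atTop two_ne_zero))
  rw [integral_neg, integral_smul, sub_zero, neg_eq_zero] at h
  exact (smul_eq_zero.1 h).resolve_left (by simp)

/-- Subtracting the vanishing integral of the square of `matRes A` leaves a difference of
resolvents, which the resolvent identity makes linear in A - B. -/
theorem IsGapped.norm_integral_mul_le {A B : M4} (hA : IsGapped A) (hB : IsGapped B) :
    ‖∫ η, matRes A η * matRes B η‖ ≤ 8 * Real.pi * ‖A - B‖ := by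
  have h1 : ∫ η, matRes A η * matRes B η =
      ∫ η, (matRes A η * matRes B η - matRes A η * matRes A η) := by
    rw [integral_sub (hA.integrable_mul hB) (hA.integrable_mul hA), hA.integral_sq, sub_zero]
  have h2 : ∀ η, ‖matRes A η * matRes B η - matRes A η * matRes A η‖ ≤
      8 * ‖A - B‖ * (1 ^ 2 + η ^ 2)⁻¹ := by
    intro η
    have bAB := hA.norm_matRes_mul_le hB η
    have bA := hA.norm_matRes_le_two η
    rw [← mul_sub, hB.matRes_sub hA]
    calc _ ≤ ‖matRes A η‖ * ((‖matRes B η‖ * ‖A - B‖) * ‖matRes A η‖) :=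
          (norm_mul_le _ _).trans (mul_le_mul_of_nonneg_left norm_mul₃_le (norm_nonneg _))
      _ = (‖matRes A η‖ * ‖matRes B η‖) * ‖A - B‖ * ‖matRes A η‖ := by ring
      _ ≤ (4 * (1 ^ 2 + η ^ 2)⁻¹) * ‖A - B‖ * 2 := by gcongr
      _ = _ := by ring
  rw [h1]
  refine (norm_integral_le_of_norm_le ((integrable_inv_sq_add_sq one_pos).const_mul _)
    (Eventually.of_forall h2)).trans (le_of_eq ?_)
  rw [integral_const_mul, integral_inv_sq_add_sq one_pos]
  ring

/-- The reference is the cube of the middle resolvent. The differences A - C and C - B then sit on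
the two legs p → r and r → q, each alongside its own potential. -/
theorem IsGapped.norm_integral_mul_mul_le {A B C : M4} (hA : IsGapped A) (hB : IsGapped B)
    (hC : IsGapped C) :
    ‖∫ η, matRes A η * matRes C η * matRes B η‖ ≤
      32 * Real.pi * (‖A - C‖ + ‖C - B‖) := by
  have h1 : ∫ η, matRes A η * matRes C η * matRes B η =
      ∫ η, (matRes A η * matRes C η * matRes B η - matRes C η * matRes C η * matRes C η) := by
    rw [integral_sub (hA.integrable_mul_mul hC hB) (hC.integrable_mul_mul hC hC),
      hC.integral_cube, sub_zero]
  have h2 : ∀ η, ‖matRes A η * matRes C η * matRes B η - matRes C η * matRes C η * matRes C η‖ ≤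
      32 * (‖A - C‖ + ‖C - B‖) * (1 ^ 2 + η ^ 2)⁻¹ := by
    intro η
    have h3 : matRes A η * matRes C η * matRes B η - matRes C η * matRes C η * matRes C η =
        (matRes A η * (C - A) * matRes C η) * matRes C η * matRes B η +
        matRes C η * matRes C η * (matRes B η * (C - B) * matRes C η) := by
      rw [← hA.matRes_sub hC, ← hB.matRes_sub hC]
      noncomm_ring
    have bA := hA.norm_matRes_le_two η
    have bB := hB.norm_matRes_le_two η
    have bC := hC.norm_matRes_le_two η
    have bCB := hC.norm_matRes_mul_le hB η
    have bCC := hC.norm_matRes_mul_le hC η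
    rw [h3]
    calc _ ≤ ‖matRes A η‖ * ‖C - A‖ * ‖matRes C η‖ * ‖matRes C η‖ * ‖matRes B η‖ +
          ‖matRes C η‖ * ‖matRes C η‖ * (‖matRes B η‖ * ‖C - B‖ * ‖matRes C η‖) := by
          refine (norm_add_le _ _).trans (add_le_add ?_ ?_)
          · exact norm_mul₃_le.trans (by gcongr; exact norm_mul₃_le)
          · exact norm_mul₃_le.trans (by gcongr; exact norm_mul₃_le)
      _ = ‖matRes A η‖ * ‖C - A‖ * ‖matRes C η‖ * (‖matRes C η‖ * ‖matRes B η‖) +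
          (‖matRes C η‖ * ‖matRes C η‖) * (‖matRes B η‖ * ‖C - B‖ * ‖matRes C η‖) := by ring
      _ ≤ 2 * ‖C - A‖ * 2 * (4 * (1 ^ 2 + η ^ 2)⁻¹) +
          (4 * (1 ^ 2 + η ^ 2)⁻¹) * (2 * ‖C - B‖ * 2) := by gcongr
      _ ≤ _ := by
          rw [norm_sub_rev C A]
          have : 0 ≤ (1 ^ 2 + η ^ 2)⁻¹ * (‖A - C‖ + ‖C - B‖) := by positivity
          linarith
  rw [h1]
  refine (norm_integral_le_of_norm_le ((integrable_inv_sq_add_sq one_pos).const_mul _)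
    (Eventually.of_forall h2)).trans (le_of_eq ?_)
  rw [integral_const_mul, integral_inv_sq_add_sq one_pos]
  ring

theorem norm_integral_matRes_mul_le {v w : R3} {s t : ℝ} (hv : 0 < ‖v‖ ^ 2 + s ^ 2)
    (hw : 0 < ‖w‖ ^ 2 + t ^ 2) (X : M4) :
    ‖∫ η, matRes (cliff v s) η * X * matRes (cliff w t) η‖ ^ 2 ≤
      16 * Real.pi ^ 2 * ((√(‖v‖ ^ 2 + s ^ 2))⁻¹ * (√(‖w‖ ^ 2 + t ^ 2))⁻¹) * ‖X‖ ^ 2 := by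
  set a := √(‖v‖ ^ 2 + s ^ 2) with ha
  set b := √(‖w‖ ^ 2 + t ^ 2) with hb
  have ha0 : 0 < a := Real.sqrt_pos.2 hv
  have hb0 : 0 < b := Real.sqrt_pos.2 hw
  have ha2 : a ^ 2 = ‖v‖ ^ 2 + s ^ 2 := Real.sq_sqrt hv.le
  have hb2 : b ^ 2 = ‖w‖ ^ 2 + t ^ 2 := Real.sq_sqrt hw.le
  -- This weight in the arithmetic-geometric inequality balances the two integrals: cπ/a and π/(cb)
  -- both equal π/√(ab).
  set c := √(a / b) with hc
  have hc0 : 0 < c := Real.sqrt_pos.2 (by positivity)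
  have hc2 : c ^ 2 = a / b := Real.sq_sqrt (by positivity)
  have h1 : ∀ η, ‖matRes (cliff v s) η * X * matRes (cliff w t) η‖ ≤
      2 * ‖X‖ * (c * (a ^ 2 + η ^ 2)⁻¹ + c⁻¹ * (b ^ 2 + η ^ 2)⁻¹) := by
    intro η
    have e1 := norm_sq_matRes_cliff hv η
    have e2 := norm_sq_matRes_cliff hw η
    rw [← ha2] at e1
    rw [← hb2] at e2
    have h2 : ‖matRes (cliff v s) η‖ * ‖matRes (cliff w t) η‖ ≤
        2 * (c * (a ^ 2 + η ^ 2)⁻¹ + c⁻¹ * (b ^ 2 + η ^ 2)⁻¹) := by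
      have e3 : (a ^ 2 + η ^ 2)⁻¹ = ‖matRes (cliff v s) η‖ ^ 2 / 4 := by rw [e1]; ring
      have e4 : (b ^ 2 + η ^ 2)⁻¹ = ‖matRes (cliff w t) η‖ ^ 2 / 4 := by rw [e2]; ring
      rw [e3, e4]
      have := sq_nonneg (c * ‖matRes (cliff v s) η‖ - ‖matRes (cliff w t) η‖)
      have h5 : 0 ≤ c⁻¹ * (c * ‖matRes (cliff v s) η‖ - ‖matRes (cliff w t) η‖) ^ 2 := by positivity
      have h6 : c⁻¹ * (c * ‖matRes (cliff v s) η‖ - ‖matRes (cliff w t) η‖) ^ 2 =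
          c * ‖matRes (cliff v s) η‖ ^ 2 + c⁻¹ * ‖matRes (cliff w t) η‖ ^ 2 -
          2 * (‖matRes (cliff v s) η‖ * ‖matRes (cliff w t) η‖) := by
        field_simp
        ring
      linarith
    calc _ ≤ ‖matRes (cliff v s) η‖ * ‖X‖ * ‖matRes (cliff w t) η‖ := norm_mul₃_le
      _ = ‖X‖ * (‖matRes (cliff v s) η‖ * ‖matRes (cliff w t) η‖) := by ring
      _ ≤ ‖X‖ * (2 * (c * (a ^ 2 + η ^ 2)⁻¹ + c⁻¹ * (b ^ 2 + η ^ 2)⁻¹)) := by gcongr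
      _ = _ := by ring
  have i1 := (integrable_inv_sq_add_sq ha0).const_mul c
  have i2 := (integrable_inv_sq_add_sq hb0).const_mul c⁻¹
  have h3 := norm_integral_le_of_norm_le ((i1.add i2).const_mul (2 * ‖X‖))
    (Eventually.of_forall h1)
  have h4 : ∫ η, 2 * ‖X‖ * ((fun η : ℝ => c * (a ^ 2 + η ^ 2)⁻¹) + fun η : ℝ =>
      c⁻¹ * (b ^ 2 + η ^ 2)⁻¹) η = 2 * ‖X‖ * (c * (Real.pi / a) + c⁻¹ * (Real.pi / b)) := by
    rw [integral_const_mul, integral_add' i1 i2, integral_const_mul, integral_const_mul,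
      integral_inv_sq_add_sq ha0, integral_inv_sq_add_sq hb0]
  rw [h4] at h3
  refine (pow_le_pow_left₀ (norm_nonneg _) h3 2).trans (le_of_eq ?_)
  have h7 : (c * (Real.pi / a) + c⁻¹ * (Real.pi / b)) ^ 2 = 4 * Real.pi ^ 2 * (a⁻¹ * b⁻¹) := by
    have : c * (Real.pi / a) + c⁻¹ * (Real.pi / b) = 2 * Real.pi * c / a := by
      have hb' : b = a / c ^ 2 := by rw [hc2]; field_simp
      rw [hb']
      field_simp
      ring
    rw [this, div_pow, mul_pow, hc2]
    field_simp
    ring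
  rw [mul_pow, h7]
  ring

/-! ### The dressed Dirac operator -/

section Dressed

variable {α Λ : ℝ} {g₀ g₁ : ℝ → ℝ}

/-- The vector `g₁(|p|) p/|p|`. -/
def dressedVec (g₁ : ℝ → ℝ) (p : R3) : R3 := (g₁ ‖p‖ / ‖p‖) • p

theorem alphaDot_smul (c : ℝ) (p : R3) : alphaDot (c • p) = (c : ℂ) • alphaDot p := by
  simp only [alphaDot, PiLp.smul_apply, smul_eq_mul, Complex.ofReal_mul, mul_smul,
    Finset.smul_sum]

theorem cliff_smul (c : ℝ) (v : R3) (t : ℝ) : cliff (c • v) (c * t) = (c : ℂ) • cliff v t := by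
  rw [cliff, cliff, alphaDot_smul, smul_add, smul_smul, Complex.ofReal_mul]

theorem dirac_eq_cliff (g₀ g₁ : ℝ → ℝ) (p : R3) :
    dirac g₀ g₁ p = cliff (dressedVec g₁ p) (g₀ ‖p‖) := by
  rw [dirac, cliff, dressedVec, alphaDot_smul]

theorem res_eq_matRes (g₀ g₁ : ℝ → ℝ) (η : ℝ) (p : R3) :
    res g₀ g₁ η p = matRes (dirac g₀ g₁ p) η := rfl

/-- The vector part of the symbol of `sgn 𝒟⁰`. -/
def sgnVec (g₀ g₁ : ℝ → ℝ) (q : R3) : R3 := (absDirac g₀ g₁ q)⁻¹ • dressedVec g₁ q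

/-- The scalar part of the symbol of `sgn 𝒟⁰`. -/
def sgnScal (g₀ g₁ : ℝ → ℝ) (q : R3) : ℝ := (absDirac g₀ g₁ q)⁻¹ * g₀ ‖q‖

theorem sgnDirac_eq_cliff (g₀ g₁ : ℝ → ℝ) (q : R3) :
    sgnDirac g₀ g₁ q = cliff (sgnVec g₀ g₁ q) (sgnScal g₀ g₁ q) := by
  rw [sgnDirac, dirac_eq_cliff, sgnVec, sgnScal, cliff_smul]

/-- The map `(v, t) ↦ 𝛂 · v + t β`. -/
def cliffCLM : R3 × ℝ →L[ℝ] M4 :=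
  LinearMap.toContinuousLinearMap
    { toFun := fun x => cliff x.1 x.2
      map_add' := fun x y => by
        simp only [cliff, alphaDot, Prod.fst_add, Prod.snd_add, PiLp.add_apply,
          Complex.ofReal_add, add_smul, Finset.sum_add_distrib]
        abel
      map_smul' := fun c x => by
        simp only [Prod.smul_fst, Prod.smul_snd, smul_eq_mul, cliff_smul, RingHom.id_apply]
        rw [Complex.coe_smul] }

theorem cliffCLM_apply (x : R3 × ℝ) : cliffCLM x = cliff x.1 x.2 := rfl

theorem cliff_injective {v w : R3} {s t : ℝ} (h : cliff v s = cliff w t) : v = w ∧ s = t := by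
  have h0 := norm_sq_cliff (v - w) (s - t)
  rw [← cliff_sub, h, sub_self, norm_zero] at h0
  have h1 : ‖v - w‖ ^ 2 = 0 := by nlinarith [sq_nonneg (s - t), sq_nonneg ‖v - w‖]
  have h2 : (s - t) ^ 2 = 0 := by nlinarith [sq_nonneg (s - t), sq_nonneg ‖v - w‖]
  refine ⟨?_, ?_⟩
  · rwa [sq_eq_zero_iff, norm_eq_zero, sub_eq_zero] at h1
  · rwa [sq_eq_zero_iff, sub_eq_zero] at h2

theorem abs_sgnScal_le (g₀ g₁ : ℝ → ℝ) (q : R3) : |sgnScal g₀ g₁ q| ≤ 1 := by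
  rw [sgnScal, abs_mul, abs_inv, ← div_eq_inv_mul]
  refine div_le_one_of_le₀ ?_ (abs_nonneg _)
  rw [absDirac, abs_of_nonneg (Real.sqrt_nonneg _)]
  exact Real.abs_le_sqrt (by nlinarith [sq_nonneg (g₁ ‖q‖)])

theorem norm_dressedVec_le (g₁ : ℝ → ℝ) (q : R3) : ‖dressedVec g₁ q‖ ≤ |g₁ ‖q‖| := by
  rw [dressedVec, norm_smul, Real.norm_eq_abs, abs_div, abs_norm]
  by_cases hq : ‖q‖ = 0
  · simp [hq]
  · rw [div_mul_cancel₀ _ hq]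

theorem norm_sgnVec_le (g₀ g₁ : ℝ → ℝ) (q : R3) : ‖sgnVec g₀ g₁ q‖ ≤ 1 := by
  rw [sgnVec, norm_smul, norm_inv, ← div_eq_inv_mul]
  refine div_le_one_of_le₀ ((norm_dressedVec_le g₁ q).trans ?_) (norm_nonneg _)
  rw [absDirac, Real.norm_of_nonneg (Real.sqrt_nonneg _)]
  exact Real.abs_le_sqrt (by nlinarith [sq_nonneg (g₀ ‖q‖)])

theorem integrableOn_ball_one_div_norm_sub_sq (p : R3) (Λ : ℝ) :
    IntegrableOn (fun q : R3 => 1 / ‖p - q‖ ^ 2) (Metric.ball 0 Λ) := by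
  have h := (integrableOn_ball_one_div_norm_sq (Λ + ‖p‖)).integrable_indicator measurableSet_ball
  have h2 := (h.comp_sub_left p).integrableOn (s := Metric.ball (0 : R3) Λ)
  refine h2.congr_fun (fun q hq => ?_) measurableSet_ball
  have hq' : ‖q‖ < Λ := by simpa using hq
  have : p - q ∈ Metric.ball (0 : R3) (Λ + ‖p‖) := by
    rw [mem_ball_zero_iff]
    linarith [norm_sub_le p q]
  simp only [indicator_of_mem this]

theorem measurable_dressedVec (h : IsDressedDirac α Λ g₀ g₁) : Measurable (dressedVec g₁) := by
  have h1 := h.measurable₁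
  unfold dressedVec
  fun_prop

theorem measurable_absDirac (h : IsDressedDirac α Λ g₀ g₁) : Measurable (absDirac g₀ g₁) := by
  have h1 := h.measurable₁
  have h0 := h.measurable₀
  unfold absDirac
  fun_prop

theorem measurable_sgnVec (h : IsDressedDirac α Λ g₀ g₁) : Measurable (sgnVec g₀ g₁) := by
  have h1 := measurable_absDirac h
  have h2 := measurable_dressedVec h
  unfold sgnVec
  fun_prop

theorem measurable_sgnScal (h : IsDressedDirac α Λ g₀ g₁) : Measurable (sgnScal g₀ g₁) := by
  have h1 := measurable_absDirac h
  have h2 := h.measurable₀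
  unfold sgnScal
  fun_prop

theorem integrableOn_sgn (h : IsDressedDirac α Λ g₀ g₁) (p : R3) :
    IntegrableOn (fun q => (1 / ‖p - q‖ ^ 2) • (sgnVec g₀ g₁ q, sgnScal g₀ g₁ q))
      (Metric.ball 0 Λ) := by
  have h1 := measurable_sgnVec h
  have h2 := measurable_sgnScal h
  refine Integrable.mono' (integrableOn_ball_one_div_norm_sub_sq p Λ)
    (Measurable.aestronglyMeasurable (by fun_prop)) (Eventually.of_forall fun q => ?_)
  rw [norm_smul, Real.norm_of_nonneg (by positivity)]
  refine mul_le_of_le_one_right (by positivity) ?_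
  rw [Prod.norm_mk]
  exact max_le (norm_sgnVec_le _ _ _) (abs_sgnScal_le _ _ _)

/-- (v,t) ↦ 𝛂·v + tβ is linear and injective, so it commutes with the integral and the matrix
equation splits into a vector and a scalar one. -/
theorem self_consistent_components (h : IsDressedDirac α Λ g₀ g₁) {p : R3}
    (hp : p ∈ Metric.ball (0 : R3) Λ) :
    dressedVec g₁ p = p + (α / 2 * (1 / (2 * Real.pi ^ 2))) •
      ∫ q in Metric.ball (0 : R3) Λ, (1 / ‖p - q‖ ^ 2) • sgnVec g₀ g₁ q ∧
    g₀ ‖p‖ = 1 + (α / 2 * (1 / (2 * Real.pi ^ 2))) *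
      ∫ q in Metric.ball (0 : R3) Λ, (1 / ‖p - q‖ ^ 2) * sgnScal g₀ g₁ q := by
  have hi := integrableOn_sgn h p
  have hs := h.self_consistent p hp
  have h1 : ∀ q, (1 / ‖p - q‖ ^ 2) • sgnDirac g₀ g₁ q =
      cliffCLM ((1 / ‖p - q‖ ^ 2) • (sgnVec g₀ g₁ q, sgnScal g₀ g₁ q)) := fun q => by
    rw [map_smul, cliffCLM_apply, sgnDirac_eq_cliff]
  have h2 : alphaDot p + betaMat = cliffCLM (p, 1) := by
    simp [cliffCLM_apply, cliff]
  simp_rw [h1] at hs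
  rw [cliffCLM.integral_comp_comm hi, h2, ← map_smul, ← map_smul, ← map_add, dirac_eq_cliff,
    cliffCLM_apply] at hs
  obtain ⟨h3, h4⟩ := cliff_injective hs
  rw [Prod.fst_add, Prod.smul_fst, Prod.smul_fst, fst_integral hi, smul_smul] at h3
  rw [Prod.snd_add, Prod.smul_snd, Prod.smul_snd, snd_integral hi, smul_smul] at h4
  exact ⟨h3, h4⟩

/-! ### The dressed operator dominates the free one -/

theorem one_le_of_isDressedDirac (hα : 0 ≤ α) (h : IsDressedDirac α Λ g₀ g₁) {p : R3}
    (hp : p ∈ Metric.ball (0 : R3) Λ) : 1 ≤ g₀ ‖p‖ := by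
  rw [(self_consistent_components h hp).2]
  refine le_add_of_nonneg_right (mul_nonneg (by positivity) ?_)
  refine setIntegral_nonneg measurableSet_ball fun q hq => mul_nonneg (by positivity) ?_
  exact mul_nonneg (inv_nonneg.2 (Real.sqrt_nonneg _))
    (h.nonneg₀ _ (norm_nonneg _) (by simpa using hq))

/-- The vector field is odd and is a nonnegative multiple of q. Pairing q with -q produces (|p-q|⁻²
- |p+q|⁻²) p·q, a positive multiple of (p·q)². -/
theorem integral_inner_sgnVec_nonneg (h : IsDressedDirac α Λ g₀ g₁) (p : R3) :
    0 ≤ ∫ q in Metric.ball (0 : R3) Λ, (1 / ‖p - q‖ ^ 2) * inner ℝ p (sgnVec g₀ g₁ q) := by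
  set F : R3 → ℝ := fun q => (1 / ‖p - q‖ ^ 2) * inner ℝ p (sgnVec g₀ g₁ q) with hF
  have hv : IntegrableOn (fun q => (1 / ‖p - q‖ ^ 2) • sgnVec g₀ g₁ q) (Metric.ball 0 Λ) :=
    (integrableOn_sgn h p).fst
  have hFi : IntegrableOn F (Metric.ball 0 Λ) := by
    have := (innerSL ℝ p).integrable_comp hv
    rw [IntegrableOn]
    simpa [hF, inner_smul_right] using this
  have hFi' := hFi.integrable_indicator measurableSet_ball
  set G := (Metric.ball (0 : R3) Λ).indicator F with hG
  have hGneg : Integrable (fun q => G (-q)) := hFi'.comp_neg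
  have h1 : ∫ q in Metric.ball (0 : R3) Λ, F q = ∫ q, G q :=
    (integral_indicator measurableSet_ball).symm
  have h2 : 2 * ∫ q, G q = ∫ q, (G q + G (-q)) := by
    rw [integral_add hFi' hGneg, integral_neg_eq_self G]
    ring
  have h3 : 0 ≤ ∫ q, (G q + G (-q)) := by
    refine integral_nonneg_of_ae ?_
    have hne : ∀ᵐ q : R3, q ≠ p := by simp [ae_iff, measure_singleton]
    have hne' : ∀ᵐ q : R3, q ≠ -p := by simp [ae_iff, measure_singleton]
    filter_upwards [hne, hne'] with q hq hq'
    by_cases hqB : q ∈ Metric.ball (0 : R3) Λ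
    · have hqB' : -q ∈ Metric.ball (0 : R3) Λ := by simpa using hqB
      have hodd : sgnVec g₀ g₁ (-q) = -sgnVec g₀ g₁ q := by
        simp [sgnVec, dressedVec, absDirac]
      have hs : sgnVec g₀ g₁ q = ((absDirac g₀ g₁ q)⁻¹ * (g₁ ‖q‖ / ‖q‖)) • q := by
        rw [sgnVec, dressedVec, smul_smul]
      have hnn : 0 ≤ (absDirac g₀ g₁ q)⁻¹ * (g₁ ‖q‖ / ‖q‖) :=
        mul_nonneg (inv_nonneg.2 (Real.sqrt_nonneg _)) (div_nonneg
          (h.nonneg₁ _ (norm_nonneg _) (by simpa using hqB)) (norm_nonneg _))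
      simp only [hG, indicator_of_mem hqB, indicator_of_mem hqB', hF, hodd, inner_neg_right,
        sub_neg_eq_add, Pi.zero_apply, hs, inner_smul_right]
      have hm : 0 < ‖p - q‖ ^ 2 := by
        have := norm_pos_iff.2 (sub_ne_zero.2 hq.symm)
        positivity
      have hpl : 0 < ‖p + q‖ ^ 2 := by
        have : p + q ≠ 0 := fun h0 => hq' (eq_neg_of_add_eq_zero_right h0)
        have := norm_pos_iff.2 this
        positivity
      have hdiff : ‖p + q‖ ^ 2 - ‖p - q‖ ^ 2 = 4 * inner ℝ p q := by
        rw [norm_add_sq_real, norm_sub_sq_real]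
        ring
      have key : 1 / ‖p - q‖ ^ 2 * ((absDirac g₀ g₁ q)⁻¹ * (g₁ ‖q‖ / ‖q‖) * inner ℝ p q) +
          1 / ‖p + q‖ ^ 2 * -((absDirac g₀ g₁ q)⁻¹ * (g₁ ‖q‖ / ‖q‖) * inner ℝ p q) =
          ((absDirac g₀ g₁ q)⁻¹ * (g₁ ‖q‖ / ‖q‖)) *
            (4 * inner ℝ p q ^ 2 / (‖p - q‖ ^ 2 * ‖p + q‖ ^ 2)) := by
        have e : 1 / ‖p - q‖ ^ 2 - 1 / ‖p + q‖ ^ 2 =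
            4 * inner ℝ p q / (‖p - q‖ ^ 2 * ‖p + q‖ ^ 2) := by
          rw [← hdiff, div_sub_div _ _ hm.ne' hpl.ne', one_mul, mul_one]
        linear_combination ((absDirac g₀ g₁ q)⁻¹ * (g₁ ‖q‖ / ‖q‖) * inner ℝ p q) * e
      rw [key]
      positivity
    · have hqB' : -q ∉ Metric.ball (0 : R3) Λ := by simpa using hqB
      simp [hG, indicator_of_notMem hqB, indicator_of_notMem hqB']
  rw [h1]
  linarith

/-- Test the vector equation against p: the integral term has a favourable sign, and Cauchy-Schwarz
concludes. -/
theorem norm_le_norm_dressedVec (hα : 0 ≤ α) (h : IsDressedDirac α Λ g₀ g₁) {p : R3}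
    (hp : p ∈ Metric.ball (0 : R3) Λ) : ‖p‖ ≤ ‖dressedVec g₁ p‖ := by
  have hv : IntegrableOn (fun q => (1 / ‖p - q‖ ^ 2) • sgnVec g₀ g₁ q) (Metric.ball 0 Λ) :=
    (integrableOn_sgn h p).fst
  have h1 : ‖p‖ ^ 2 ≤ inner ℝ p (dressedVec g₁ p) := by
    rw [(self_consistent_components h hp).1, inner_add_right, inner_smul_right,
      real_inner_self_eq_norm_sq]
    refine le_add_of_nonneg_right (mul_nonneg (by positivity) ?_)
    have h2 := (innerSL ℝ p).integral_comp_comm hv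
    simp only [innerSL_apply_apply] at h2
    rw [← h2]
    simp only [inner_smul_right]
    exact integral_inner_sgnVec_nonneg h p
  have h3 := real_inner_le_norm p (dressedVec g₁ p)
  by_cases hp0 : ‖p‖ = 0
  · rw [hp0]
    positivity
  · have : 0 < ‖p‖ := lt_of_le_of_ne (norm_nonneg _) (Ne.symm hp0)
    nlinarith

theorem one_add_sq_le_energy (hα : 0 ≤ α) (h : IsDressedDirac α Λ g₀ g₁) {p : R3}
    (hp : p ∈ Metric.ball (0 : R3) Λ) :
    1 + ‖p‖ ^ 2 ≤ ‖dressedVec g₁ p‖ ^ 2 + g₀ ‖p‖ ^ 2 := by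
  have h1 := one_le_of_isDressedDirac hα h hp
  have h2 := norm_le_norm_dressedVec hα h hp
  have h3 := norm_nonneg p
  nlinarith

theorem isGapped_dirac (hα : 0 ≤ α) (h : IsDressedDirac α Λ g₀ g₁) {p : R3}
    (hp : p ∈ Metric.ball (0 : R3) Λ) : IsGapped (dirac g₀ g₁ p) :=
  ⟨_, _, dirac_eq_cliff _ _ _, by nlinarith [one_add_sq_le_energy hα h hp, sq_nonneg ‖p‖]⟩

/-- The vector components of `sgn 𝒟⁰`, cut off to the ball. -/
def sgnVecCut (Λ : ℝ) (g₀ g₁ : ℝ → ℝ) (j : Fin 3) : R3 → ℝ :=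
  (Metric.ball (0 : R3) Λ).indicator fun q => sgnVec g₀ g₁ q j

/-- The scalar component of `sgn 𝒟⁰`, cut off to the ball. -/
def sgnScalCut (Λ : ℝ) (g₀ g₁ : ℝ → ℝ) : R3 → ℝ :=
  (Metric.ball (0 : R3) Λ).indicator (sgnScal g₀ g₁)

theorem exists_shiftEnergy_indicator_le {f : R3 → ℝ} (hf : Measurable f) (hb : ∀ q, |f q| ≤ 1) :
    ∃ C : ℝ≥0∞, C ≠ ∞ ∧ ∀ k, shiftEnergy ((Metric.ball (0 : R3) Λ).indicator f) k ≤
      C * ENNReal.ofReal (‖k‖ ^ 2) := by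
  have hle : ∀ q, ‖f q‖ₑ ≤ 1 := fun q => by
    rw [← ofReal_norm, Real.norm_eq_abs, ← ENNReal.ofReal_one]
    exact ENNReal.ofReal_le_ofReal (hb q)
  refine exists_shiftEnergy_le (M := 1) (hf.indicator measurableSet_ball) ?_ fun q => ?_
  · rw [integrable_indicator_iff measurableSet_ball]
    refine Measure.integrableOn_of_bounded (M := 1) measure_ball_lt_top.ne
      hf.aestronglyMeasurable (Eventually.of_forall hb)
  · exact (enorm_indicator_le_enorm_self _ _).trans (by simpa using hle q)

theorem rieszPot_indicator (f : R3 → ℝ) (p : R3) :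
    rieszPot ((Metric.ball (0 : R3) Λ).indicator f) p =
      ∫ q in Metric.ball (0 : R3) Λ, 1 / ‖p - q‖ ^ 2 * f q := by
  rw [rieszPot, ← integral_indicator measurableSet_ball]
  refine integral_congr_ae (Eventually.of_forall fun q => ?_)
  simp [indicator]

theorem dressedVec_apply (h : IsDressedDirac α Λ g₀ g₁) {p : R3}
    (hp : p ∈ Metric.ball (0 : R3) Λ) (j : Fin 3) :
    dressedVec g₁ p j = p j + (α / 2 * (1 / (2 * Real.pi ^ 2))) *
      rieszPot (sgnVecCut Λ g₀ g₁ j) p := by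
  have hv : IntegrableOn (fun q => (1 / ‖p - q‖ ^ 2) • sgnVec g₀ g₁ q) (Metric.ball 0 Λ) :=
    (integrableOn_sgn h p).fst
  have h2 := (EuclideanSpace.proj (𝕜 := ℝ) j).integral_comp_comm hv
  rw [sgnVecCut, rieszPot_indicator, (self_consistent_components h hp).1, PiLp.add_apply,
    PiLp.smul_apply, smul_eq_mul]
  simp only [EuclideanSpace.coe_proj, PiLp.smul_apply, smul_eq_mul] at h2
  rw [h2]

theorem dressedScal_eq (h : IsDressedDirac α Λ g₀ g₁) {p : R3}
    (hp : p ∈ Metric.ball (0 : R3) Λ) :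
    g₀ ‖p‖ = 1 + (α / 2 * (1 / (2 * Real.pi ^ 2))) * rieszPot (sgnScalCut Λ g₀ g₁) p := by
  rw [sgnScalCut, rieszPot_indicator]
  exact (self_consistent_components h hp).2

/-- The symbol of `𝒟⁰` has one derivative in `L²` of the ball. -/
theorem exists_lintegral_dirac_sub_le (h : IsDressedDirac α Λ g₀ g₁) :
    ∃ C : ℝ≥0∞, C ≠ ∞ ∧ ∀ k : R3, ∫⁻ p in {p : R3 | p ∈ Metric.ball (0 : R3) Λ ∧
      p - k ∈ Metric.ball (0 : R3) Λ}, ‖dirac g₀ g₁ p - dirac g₀ g₁ (p - k)‖ₑ ^ 2 ≤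
        C * ENNReal.ofReal (‖k‖ ^ 2) := by
  set c : ℝ := α / 2 * (1 / (2 * Real.pi ^ 2)) with hc
  have hvm := measurable_sgnVec h
  have hvm' : ∀ j, Measurable fun q => sgnVec g₀ g₁ q j := fun j =>
    (EuclideanSpace.proj (𝕜 := ℝ) j).continuous.measurable.comp hvm
  have hsm := measurable_sgnScal h
  obtain ⟨C₃, hC₃, h₃⟩ := exists_shiftEnergy_indicator_le (Λ := Λ) hsm (abs_sgnScal_le g₀ g₁)
  have hV : ∀ j, ∃ C : ℝ≥0∞, C ≠ ∞ ∧ ∀ k, shiftEnergy (sgnVecCut Λ g₀ g₁ j) k ≤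
      C * ENNReal.ofReal (‖k‖ ^ 2) := fun j =>
    exists_shiftEnergy_indicator_le (hvm' j) fun q =>
      (PiLp.norm_apply_le (sgnVec g₀ g₁ q) j).trans (norm_sgnVec_le g₀ g₁ q)
  choose C hC hCle using hV
  set w : ℝ≥0∞ := volume (Metric.ball (0 : R3) Λ) with hw
  have hwt : w ≠ ∞ := measure_ball_lt_top.ne
  -- 8 = 4 · 2: the Frobenius factor, and the cost of separating the linear part p from the Riesz
  -- potential.
  set κ : ℝ≥0∞ := ENNReal.ofReal (8 * c ^ 2) with hκ
  refine ⟨8 * w + κ * (∑ j, C j + C₃), ?_, fun k => ?_⟩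
  · refine ENNReal.add_ne_top.2 ⟨ENNReal.mul_ne_top (by simp) hwt,
      ENNReal.mul_ne_top ENNReal.ofReal_ne_top (ENNReal.add_ne_top.2 ⟨?_, hC₃⟩)⟩
    exact ENNReal.sum_ne_top.2 fun j _ => hC j
  set u : Fin 3 → R3 → ℝ := fun j => rieszPot (sgnVecCut Λ g₀ g₁ j) with hu
  set u₃ : R3 → ℝ := rieszPot (sgnScalCut Λ g₀ g₁) with hu₃
  have hum : ∀ j, Measurable (u j) := fun j =>
    (stronglyMeasurable_rieszPot ((hvm' j).indicator measurableSet_ball)).measurable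
  have hum₃ : Measurable u₃ :=
    (stronglyMeasurable_rieszPot (hsm.indicator measurableSet_ball)).measurable
  have hpt : ∀ p ∈ {p : R3 | p ∈ Metric.ball (0 : R3) Λ ∧ p - k ∈ Metric.ball (0 : R3) Λ},
      ‖dirac g₀ g₁ p - dirac g₀ g₁ (p - k)‖ₑ ^ 2 ≤ ENNReal.ofReal (8 * ‖k‖ ^ 2) +
        κ * (∑ j, ENNReal.ofReal ((u j p - u j (p - k)) ^ 2) +
          ENNReal.ofReal ((u₃ p - u₃ (p - k)) ^ 2)) := by
    rintro p ⟨hp, hpk⟩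
    have e1 : ‖dirac g₀ g₁ p - dirac g₀ g₁ (p - k)‖ ^ 2 = 4 * (‖dressedVec g₁ p -
        dressedVec g₁ (p - k)‖ ^ 2 + (g₀ ‖p‖ - g₀ ‖p - k‖) ^ 2) := by
      rw [dirac_eq_cliff, dirac_eq_cliff, cliff_sub, norm_sq_cliff]
    have e2 : ∀ j, (dressedVec g₁ p - dressedVec g₁ (p - k)) j =
        k j + c * (u j p - u j (p - k)) := fun j => by
      rw [PiLp.sub_apply, dressedVec_apply h hp, dressedVec_apply h hpk, PiLp.sub_apply]
      ring
    have e3 : g₀ ‖p‖ - g₀ ‖p - k‖ = c * (u₃ p - u₃ (p - k)) := by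
      rw [dressedScal_eq h hp, dressedScal_eq h hpk]
      ring
    have e4 : ‖dirac g₀ g₁ p - dirac g₀ g₁ (p - k)‖ ^ 2 ≤ 8 * ‖k‖ ^ 2 +
        8 * c ^ 2 * (∑ j, (u j p - u j (p - k)) ^ 2 + (u₃ p - u₃ (p - k)) ^ 2) := by
      rw [e1, EuclideanSpace.real_norm_sq_eq, EuclideanSpace.real_norm_sq_eq, e3]
      simp only [e2, Fin.sum_univ_three]
      nlinarith [sq_nonneg (k 0 - c * (u 0 p - u 0 (p - k))),
        sq_nonneg (k 1 - c * (u 1 p - u 1 (p - k))),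
        sq_nonneg (k 2 - c * (u 2 p - u 2 (p - k))), sq_nonneg (c * (u₃ p - u₃ (p - k)))]
    rw [← ofReal_norm, ← ENNReal.ofReal_pow (norm_nonneg _),
      ← ENNReal.ofReal_sum_of_nonneg (fun j _ => sq_nonneg _),
      ← ENNReal.ofReal_add (by positivity) (by positivity), ← ENNReal.ofReal_mul (by positivity),
      ← ENNReal.ofReal_add (by positivity) (by positivity)]
    exact ENNReal.ofReal_le_ofReal e4
  have hms : MeasurableSet {p : R3 | p ∈ Metric.ball (0 : R3) Λ ∧
      p - k ∈ Metric.ball (0 : R3) Λ} :=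
    measurableSet_ball.inter (measurableSet_ball.preimage (by fun_prop))
  refine (setLIntegral_mono' hms hpt).trans ?_
  rw [lintegral_add_left (by fun_prop), setLIntegral_const, lintegral_const_mul _ (by fun_prop)]
  have hle : ∫⁻ p in {p : R3 | p ∈ Metric.ball (0 : R3) Λ ∧ p - k ∈ Metric.ball (0 : R3) Λ},
      (∑ j, ENNReal.ofReal ((u j p - u j (p - k)) ^ 2) +
          ENNReal.ofReal ((u₃ p - u₃ (p - k)) ^ 2)) ≤
      (∑ j, C j + C₃) * ENNReal.ofReal (‖k‖ ^ 2) := by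
    refine (setLIntegral_le_lintegral _ _).trans ?_
    rw [lintegral_add_right _ (by fun_prop), lintegral_finsetSum _ (fun j _ => by fun_prop),
      add_mul, Finset.sum_mul]
    exact add_le_add (Finset.sum_le_sum fun j _ => hCle j k) (h₃ k)
  have hvol : volume {p : R3 | p ∈ Metric.ball (0 : R3) Λ ∧ p - k ∈ Metric.ball (0 : R3) Λ} ≤ w :=
    measure_mono fun p hp => hp.1
  calc _ ≤ ENNReal.ofReal (8 * ‖k‖ ^ 2) * w +
        κ * ((∑ j, C j + C₃) * ENNReal.ofReal (‖k‖ ^ 2)) := by gcongr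
    _ = _ := by
        rw [ENNReal.ofReal_mul (by norm_num), ENNReal.ofReal_ofNat]
        ring

end Dressed

/-! ### Measurability of the resolvent -/

theorem stronglyMeasurable_dirac {α Λ : ℝ} {g₀ g₁ : ℝ → ℝ} (h : IsDressedDirac α Λ g₀ g₁) :
    StronglyMeasurable (dirac g₀ g₁) := by
  have h1 := (measurable_dressedVec h).stronglyMeasurable
  have h2 : StronglyMeasurable fun p : R3 => g₀ ‖p‖ :=
    (h.measurable₀.comp measurable_norm).stronglyMeasurable
  have h3 := cliffCLM.continuous.comp_stronglyMeasurable (h1.prodMk h2)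
  have h4 : dirac g₀ g₁ = fun p => cliffCLM (dressedVec g₁ p, g₀ ‖p‖) := by
    ext1 p
    rw [dirac_eq_cliff, cliffCLM_apply]
  rw [h4]
  exact h3

theorem stronglyMeasurable_matrix_inv {X : Type*} [MeasurableSpace X] {f : X → M4}
    (hf : StronglyMeasurable f) : StronglyMeasurable fun x => (f x)⁻¹ := by
  have h1 : StronglyMeasurable fun x => (f x).det :=
    (Continuous.matrix_det continuous_id : Continuous (Matrix.det : M4 → ℂ)).comp_stronglyMeasurable
      hf
  have h2 : StronglyMeasurable fun x => (f x).adjugate :=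
    (Continuous.matrix_adjugate continuous_id :
      Continuous (Matrix.adjugate : M4 → M4)).comp_stronglyMeasurable hf
  have h3 : StronglyMeasurable fun x => ((f x).det)⁻¹ := h1.measurable.inv.stronglyMeasurable
  simp only [Matrix.inv_def, Ring.inverse_eq_inv']
  exact h3.smul h2

theorem stronglyMeasurable_res {α Λ : ℝ} {g₀ g₁ : ℝ → ℝ} (h : IsDressedDirac α Λ g₀ g₁)
    {X : Type*} [MeasurableSpace X] {e : X → ℝ} {p : X → R3} (he : Measurable e)
    (hp : Measurable p) : StronglyMeasurable fun x => res g₀ g₁ (e x) (p x) := by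
  refine stronglyMeasurable_matrix_inv (((stronglyMeasurable_dirac h).comp_measurable hp).add ?_)
  have h1 : Measurable fun x => Complex.I * ((e x : ℝ) : ℂ) := by fun_prop
  exact h1.stronglyMeasurable.smul_const (1 : M4)

/-! ### Kernels on the ball -/

section Kernels

variable {Λ : ℝ}

theorem ballVol2_eq (Λ : ℝ) : ballVol2 Λ =
    volume.restrict (Metric.ball (0 : R3) Λ ×ˢ Metric.ball (0 : R3) Λ) := by
  rw [ballVol2, ballVol, Measure.prod_restrict, Measure.volume_eq_prod]

theorem measurableSet_ballSq (Λ : ℝ) :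
    MeasurableSet (Metric.ball (0 : R3) Λ ×ˢ Metric.ball (0 : R3) Λ) :=
  measurableSet_ball.prod measurableSet_ball

instance (Λ : ℝ) : IsFiniteMeasure (ballVol Λ) := ⟨by
  rw [ballVol, Measure.restrict_apply_univ]
  exact measure_ball_lt_top⟩

theorem ae_ballVol2_mem (Λ : ℝ) : ∀ᵐ z ∂(ballVol2 Λ),
    z.1 ∈ Metric.ball (0 : R3) Λ ∧ z.2 ∈ Metric.ball (0 : R3) Λ := by
  rw [ballVol2_eq]
  filter_upwards [ae_restrict_mem (measurableSet_ballSq Λ)] with z hz using hz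

/-- A kernel extended by zero outside of `B(0,Λ) × B(0,Λ)`. -/
def Ker.ext (Λ : ℝ) (Q : Ker) : R3 × R3 → M4 :=
  (Metric.ball (0 : R3) Λ ×ˢ Metric.ball (0 : R3) Λ).indicator fun z => Q z.1 z.2

theorem RKer_eq (Q : Ker) (p q : R3) : RKer Λ Q p q =
    (1 / (2 * Real.pi ^ 2)) • ∫ l, (1 / ‖l‖ ^ 2) • Q.ext Λ (p - l, q - l) := by
  rw [RKer, ← integral_indicator]
  · congr 2
    ext1 l
    by_cases hl : p - l ∈ Metric.ball (0 : R3) Λ ∧ q - l ∈ Metric.ball (0 : R3) Λ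
    · rw [indicator_of_mem (by exact hl), Ker.ext, indicator_of_mem (by exact hl)]
    · rw [indicator_of_notMem (by exact hl), Ker.ext, indicator_of_notMem (by exact hl), smul_zero]
  · exact (measurableSet_ball.preimage (by fun_prop)).inter (measurableSet_ball.preimage
      (by fun_prop))

/-- R_Q at a point integrates Q over a three-dimensional diagonal slice, itself a null set. Fubini
and translation invariance show that almost every slice misses a given null set, so R_Q depends only
on the class of Q. -/
theorem ae_ae_sub_diag {P : R3 × R3 → Prop} (h : ∀ᵐ z : R3 × R3, P z) :
    ∀ᵐ z : R3 × R3, ∀ᵐ l : R3, P (z.1 - l, z.2 - l) := by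
  obtain ⟨t, ht, htm, ht0⟩ := exists_measurable_superset_of_null (ae_iff.1 h)
  set χ : R3 × R3 → ℝ≥0∞ := t.indicator 1 with hχ
  have hmi : Measurable χ := measurable_one.indicator htm
  have h1 : ∫⁻ z : R3 × R3, ∫⁻ l : R3, χ (z.1 - l, z.2 - l) = 0 := by
    rw [lintegral_lintegral_swap (by fun_prop)]
    simp_rw [lintegral_prod_sub_diag (F := χ)]
    simp [hχ, lintegral_indicator_one htm, ht0]
  rw [lintegral_eq_zero_iff (Measurable.lintegral_prod_right
    (f := fun (z : R3 × R3) (l : R3) => χ (z.1 - l, z.2 - l)) (by fun_prop))] at h1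
  filter_upwards [h1] with z hz
  simp only [Pi.zero_apply] at hz
  rw [lintegral_eq_zero_iff (by fun_prop)] at hz
  filter_upwards [hz] with l hl
  by_contra hP
  have : (z.1 - l, z.2 - l) ∈ t := ht hP
  simp [hχ, this] at hl

theorem Ker.Eqv.ext_ae {Q Q' : Ker} (h : Q.Eqv Λ Q') : ∀ᵐ z : R3 × R3, Q.ext Λ z = Q'.ext Λ z := by
  rw [Ker.Eqv, ballVol2_eq, ae_restrict_iff' (measurableSet_ballSq Λ)] at h
  filter_upwards [h] with z hz
  by_cases hzB : z ∈ Metric.ball (0 : R3) Λ ×ˢ Metric.ball (0 : R3) Λ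
  · rw [Ker.ext, Ker.ext, indicator_of_mem hzB, indicator_of_mem hzB, hz hzB]
  · rw [Ker.ext, Ker.ext, indicator_of_notMem hzB, indicator_of_notMem hzB]

theorem RKer_congr {Q Q' : Ker} (h : Q.Eqv Λ Q') :
    ∀ᵐ z : R3 × R3, RKer Λ Q z.1 z.2 = RKer Λ Q' z.1 z.2 := by
  filter_upwards [ae_ae_sub_diag h.ext_ae] with z hz
  rw [RKer_eq, RKer_eq]
  congr 1
  refine integral_congr_ae ?_
  filter_upwards [hz] with l hl
  rw [hl]

theorem Ker.Eqv.symm {Q Q' : Ker} (h : Q.Eqv Λ Q') : Q'.Eqv Λ Q := by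
  filter_upwards [h] with z hz using hz.symm

theorem Ker.Eqv.trans {Q Q' Q'' : Ker} (h : Q.Eqv Λ Q') (h' : Q'.Eqv Λ Q'') : Q.Eqv Λ Q'' := by
  filter_upwards [h, h'] with z hz hz' using hz.trans hz'

theorem ae_ballVol2_of_ae {P : R3 × R3 → Prop} (h : ∀ᵐ z : R3 × R3, P z) :
    ∀ᵐ z ∂(ballVol2 Λ), P z := by
  rw [ballVol2_eq]
  exact ae_restrict_of_ae h

/-- A kernel is measurable if it is jointly strongly measurable. -/
def Ker.Meas (Q : Ker) : Prop := StronglyMeasurable fun z : R3 × R3 => Q z.1 z.2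

theorem Ker.Meas.ext {Q : Ker} (h : Q.Meas) : StronglyMeasurable (Q.ext Λ) :=
  StronglyMeasurable.indicator h (measurableSet_ballSq Λ)

theorem MemS2.exists_meas {Q : Ker} (h : MemS2 Λ Q) : ∃ Q' : Ker, Q'.Meas ∧ Q.Eqv Λ Q' :=
  ⟨fun p q => AEStronglyMeasurable.mk _ h.1 (p, q),
    AEStronglyMeasurable.stronglyMeasurable_mk h.1, AEStronglyMeasurable.ae_eq_mk h.1⟩

theorem MemS2.congr {Q Q' : Ker} (h : MemS2 Λ Q) (hQ : Q.Eqv Λ Q') : MemS2 Λ Q' :=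
  MemLp.ae_eq hQ h

theorem RKer_meas {Q : Ker} (h : Q.Meas) : (RKer Λ Q).Meas := by
  have h1 : StronglyMeasurable fun w : (R3 × R3) × R3 => (1 / ‖w.2‖ ^ 2) •
      Q.ext Λ (w.1.1 - w.2, w.1.2 - w.2) :=
    (by fun_prop : Measurable fun w : (R3 × R3) × R3 => 1 / ‖w.2‖ ^ 2).stronglyMeasurable.smul
      (h.ext.comp_measurable (by fun_prop :
        Measurable fun w : (R3 × R3) × R3 => (w.1.1 - w.2, w.1.2 - w.2)))
  have h2 := (StronglyMeasurable.integral_prod_right' (ν := (volume : Measure R3)) h1).const_smul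
    (1 / (2 * Real.pi ^ 2))
  have h3 : (fun z : R3 × R3 => RKer Λ Q z.1 z.2) = fun z => (1 / (2 * Real.pi ^ 2)) •
      ∫ l, (1 / ‖l‖ ^ 2) • Q.ext Λ (z.1 - l, z.2 - l) := by
    ext1 z
    rw [RKer_eq]
  rw [Ker.Meas, h3]
  exact h2

theorem enorm_RKer_le (Q : Ker) (z : R3 × R3) : ‖RKer Λ Q z.1 z.2‖ₑ ≤
    ENNReal.ofReal (1 / (2 * Real.pi ^ 2)) * diagConv (fun z => ‖Q.ext Λ z‖ₑ) z := by
  rw [RKer_eq, enorm_smul, Real.enorm_eq_ofReal (by positivity)]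
  gcongr
  refine (enorm_integral_le_lintegral_enorm _).trans (le_of_eq ?_)
  rw [diagConv]
  refine lintegral_congr fun l => ?_
  rw [enorm_smul, enorm_one_div_norm_sq]

/-! ### The weight of 𝐐₁ and bounds on R_Q -/

theorem quasiMeasurePreserving_fst_R3 :
    Measure.QuasiMeasurePreserving (Prod.fst : R3 × R3 → R3) volume volume :=
  Measure.quasiMeasurePreserving_fst

theorem quasiMeasurePreserving_snd_R3 :
    Measure.QuasiMeasurePreserving (Prod.snd : R3 × R3 → R3) volume volume :=
  Measure.quasiMeasurePreserving_snd

/-- The weight `√(1+|p|²) + √(1+|q|²)`. -/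
def wt (z : R3 × R3) : ℝ := Real.sqrt (1 + ‖z.1‖ ^ 2) + Real.sqrt (1 + ‖z.2‖ ^ 2)

theorem continuous_wt : Continuous wt := by
  unfold wt
  fun_prop

theorem norm_le_sqrt_one_add (p : R3) : ‖p‖ ≤ Real.sqrt (1 + ‖p‖ ^ 2) :=
  Real.le_sqrt_of_sq_le (by linarith)

theorem one_le_sqrt_one_add (p : R3) : 1 ≤ Real.sqrt (1 + ‖p‖ ^ 2) := by
  rw [Real.one_le_sqrt]
  nlinarith [sq_nonneg ‖p‖]

theorem wt_le {z : R3 × R3} (hz : z.1 ∈ Metric.ball (0 : R3) Λ ∧ z.2 ∈ Metric.ball (0 : R3) Λ) :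
    wt z ≤ 2 * Real.sqrt (1 + Λ ^ 2) := by
  have h : ∀ p ∈ Metric.ball (0 : R3) Λ, Real.sqrt (1 + ‖p‖ ^ 2) ≤ Real.sqrt (1 + Λ ^ 2) := by
    intro p hp
    have hp' : ‖p‖ < Λ := by simpa using hp
    gcongr
  rw [wt]
  linarith [h _ hz.1, h _ hz.2]

theorem two_le_wt (z : R3 × R3) : 2 ≤ wt z := by
  rw [wt]
  linarith [one_le_sqrt_one_add z.1, one_le_sqrt_one_add z.2]

/-- The square of the norm of `𝐐₁`. -/
def wNorm (Λ : ℝ) (Q : Ker) : ℝ≥0∞ :=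
  ∫⁻ z, ENNReal.ofReal (wt z) * ‖Q z.1 z.2‖ₑ ^ 2 ∂(ballVol2 Λ)

theorem eLpNorm_two_sq {X : Type*} [MeasurableSpace X] (μ : Measure X) (f : X → M4) :
    eLpNorm f 2 μ ^ 2 = ∫⁻ x, ‖f x‖ₑ ^ 2 ∂μ := by
  have h1 := eLpNorm_nnreal_pow_eq_lintegral (μ := μ) (f := f) (p := 2) two_ne_zero
  simpa only [ENNReal.coe_ofNat, NNReal.coe_ofNat, ENNReal.rpow_ofNat] using h1

theorem lintegral_enorm_sq_lt_top_of_memLp {X : Type*} [MeasurableSpace X] {μ : Measure X}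
    {f : X → M4} (h : MemLp f 2 μ) : ∫⁻ x, ‖f x‖ₑ ^ 2 ∂μ < ∞ := by
  rw [← eLpNorm_two_sq]
  exact ENNReal.pow_lt_top h.2

theorem memLp_two_of_lintegral {X : Type*} [MeasurableSpace X] {μ : Measure X} {f : X → M4}
    (hf : AEStronglyMeasurable f μ) (h : ∫⁻ x, ‖f x‖ₑ ^ 2 ∂μ < ∞) : MemLp f 2 μ := by
  refine ⟨hf, ?_⟩
  rw [← eLpNorm_two_sq] at h
  exact (ENNReal.pow_lt_top_iff (n := 2)).1 h |>.resolve_right (by norm_num)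

theorem lintegral_ext (Q : Ker) (φ : R3 × R3 → ℝ≥0∞) :
    ∫⁻ z, φ z * ‖Q.ext Λ z‖ₑ ^ 2 = ∫⁻ z, φ z * ‖Q z.1 z.2‖ₑ ^ 2 ∂(ballVol2 Λ) := by
  rw [ballVol2_eq, ← lintegral_indicator (measurableSet_ballSq Λ)]
  refine lintegral_congr fun z => ?_
  by_cases hz : z ∈ Metric.ball (0 : R3) Λ ×ˢ Metric.ball (0 : R3) Λ
  · rw [indicator_of_mem hz, Ker.ext, indicator_of_mem hz]
  · rw [indicator_of_notMem hz, Ker.ext, indicator_of_notMem hz]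
    simp

theorem wNorm_lt_top_of_memS2 {Q : Ker} (h : MemS2 Λ Q) : wNorm Λ Q < ∞ := by
  have h1 := lintegral_enorm_sq_lt_top_of_memLp h
  refine lt_of_le_of_lt (b := ENNReal.ofReal (2 * Real.sqrt (1 + Λ ^ 2)) *
    ∫⁻ z, ‖Q z.1 z.2‖ₑ ^ 2 ∂(ballVol2 Λ)) ?_ (ENNReal.mul_lt_top ENNReal.ofReal_lt_top h1)
  rw [← lintegral_const_mul' _ _ ENNReal.ofReal_ne_top, wNorm]
  refine lintegral_mono_ae ?_
  filter_upwards [ae_ballVol2_mem Λ] with z hz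
  gcongr
  exact wt_le hz

theorem lintegral_sq_le_wNorm (Q : Ker) : ∫⁻ z, ‖Q z.1 z.2‖ₑ ^ 2 ∂(ballVol2 Λ) ≤ wNorm Λ Q := by
  refine lintegral_mono fun z => ?_
  refine le_mul_of_one_le_left' ?_
  rw [← ENNReal.ofReal_one]
  exact ENNReal.ofReal_le_ofReal (by linarith [two_le_wt z])

/-- The weight is bounded on the cut-off region, so every membership in 𝐐₁ reduces to a
Hilbert-Schmidt bound. -/
theorem MemS2.memQ1 {Q : Ker} (h : MemS2 Λ Q) : MemQ1 Λ Q := by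
  refine ⟨h, ?_⟩
  have h1 : AEStronglyMeasurable (fun z : R3 × R3 => wt z * ‖Q z.1 z.2‖ ^ 2) (ballVol2 Λ) :=
    continuous_wt.aestronglyMeasurable.mul (h.1.norm.pow 2)
  refine ⟨h1, ?_⟩
  rw [HasFiniteIntegral]
  refine lt_of_le_of_lt (lintegral_mono fun z => ?_) (wNorm_lt_top_of_memS2 h)
  rw [enorm_mul, Real.enorm_eq_ofReal (by positivity), enorm_pow, enorm_norm]
  rfl

theorem measurable_enorm_ext {Q : Ker} (h : Q.Meas) : Measurable fun z => ‖Q.ext Λ z‖ₑ :=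
  h.ext.enorm

/-- The constant in the bound of `R_Q`. -/
def rConst : ℝ := rieszConst * (1 / (2 * Real.pi ^ 2))

theorem rConst_nonneg : 0 ≤ rConst :=
  mul_nonneg rieszConst_nonneg (by positivity)

theorem lintegral_RKer_sq_le_of_meas {φ : R3 × R3 → R3}
    (hφ : Measure.QuasiMeasurePreserving φ volume volume)
    (hsub : ∀ z l, φ (z.1 - l, z.2 - l) = φ z - l) {Q : Ker} (hQ : Q.Meas) :
    ∫⁻ z, ENNReal.ofReal (1 / ‖φ z‖) * ‖RKer Λ Q z.1 z.2‖ₑ ^ 2 ≤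
      ENNReal.ofReal (rConst ^ 2) *
        ∫⁻ z, ENNReal.ofReal ‖φ z‖ * ‖Q z.1 z.2‖ₑ ^ 2 ∂(ballVol2 Λ) := by
  have h1 := lintegral_diagConv_sq_le hφ hsub (measurable_enorm_ext (Λ := Λ) hQ)
  rw [lintegral_ext] at h1
  set c := ENNReal.ofReal (1 / (2 * Real.pi ^ 2)) with hc
  calc _ ≤ ∫⁻ z, c ^ 2 * (ENNReal.ofReal (1 / ‖φ z‖) *
        diagConv (fun z => ‖Q.ext Λ z‖ₑ) z ^ 2) := by
        refine lintegral_mono fun z => ?_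
        calc _ ≤ ENNReal.ofReal (1 / ‖φ z‖) *
              (c * diagConv (fun z => ‖Q.ext Λ z‖ₑ) z) ^ 2 := by
              gcongr
              exact enorm_RKer_le Q z
          _ = _ := by ring
    _ ≤ c ^ 2 * (ENNReal.ofReal (rieszConst ^ 2) *
        ∫⁻ z, ENNReal.ofReal ‖φ z‖ * ‖Q z.1 z.2‖ₑ ^ 2 ∂(ballVol2 Λ)) := by
        rw [lintegral_const_mul' _ _ (ENNReal.pow_ne_top ENNReal.ofReal_ne_top)]
        gcongr
    _ = _ := by
        rw [← mul_assoc, hc, ← ENNReal.ofReal_pow (by positivity),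
          ← ENNReal.ofReal_mul (by positivity), rConst]
        congr 2
        ring

/-- The Schur bound is applied to each coordinate and added; |p| + |q| is below the weight of 𝐐₁.
The constant does not involve Λ. -/
theorem lintegral_RKer_sq_le {Q : Ker} (hQ : MemS2 Λ Q) :
    ∫⁻ z : R3 × R3, (ENNReal.ofReal (1 / ‖z.1‖) + ENNReal.ofReal (1 / ‖z.2‖)) *
      ‖RKer Λ Q z.1 z.2‖ₑ ^ 2 ≤ ENNReal.ofReal (rConst ^ 2) * wNorm Λ Q := by
  obtain ⟨Q', hm, he⟩ := hQ.exists_meas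
  have hmR : Measurable fun z : R3 × R3 => ‖RKer Λ Q' z.1 z.2‖ₑ := (RKer_meas hm).enorm
  have e1 : ∫⁻ z : R3 × R3, (ENNReal.ofReal (1 / ‖z.1‖) + ENNReal.ofReal (1 / ‖z.2‖)) *
      ‖RKer Λ Q z.1 z.2‖ₑ ^ 2 = ∫⁻ z : R3 × R3, (ENNReal.ofReal (1 / ‖z.1‖) *
      ‖RKer Λ Q' z.1 z.2‖ₑ ^ 2 + ENNReal.ofReal (1 / ‖z.2‖) * ‖RKer Λ Q' z.1 z.2‖ₑ ^ 2) := by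
    refine lintegral_congr_ae ?_
    filter_upwards [RKer_congr he] with z hz
    rw [hz, add_mul]
  have e2 : wNorm Λ Q = wNorm Λ Q' := by
    refine lintegral_congr_ae ?_
    filter_upwards [he] with z hz
    rw [hz]
  rw [e1, e2, lintegral_add_left (by fun_prop)]
  have h1 := lintegral_RKer_sq_le_of_meas (Λ := Λ) quasiMeasurePreserving_fst_R3
    (fun z l => rfl) hm
  have h2 := lintegral_RKer_sq_le_of_meas (Λ := Λ) quasiMeasurePreserving_snd_R3
    (fun z l => rfl) hm
  have hmQ : Measurable fun z : R3 × R3 => ‖Q' z.1 z.2‖ₑ := StronglyMeasurable.enorm hm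
  refine (add_le_add h1 h2).trans ?_
  rw [← mul_add, ← lintegral_add_left (by fun_prop)]
  gcongr
  refine lintegral_mono fun z => ?_
  simp only
  rw [← add_mul, ← ENNReal.ofReal_add (norm_nonneg _) (norm_nonneg _)]
  gcongr
  exact add_le_add (norm_le_sqrt_one_add _) (norm_le_sqrt_one_add _)

theorem MemS2.RKer {Q : Ker} (hQ : MemS2 Λ Q) : MemS2 Λ (RKer Λ Q) := by
  obtain ⟨Q', hm, he⟩ := hQ.exists_meas
  have hae : AEStronglyMeasurable (fun z : R3 × R3 => BDF.RKer Λ Q z.1 z.2) (ballVol2 Λ) :=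
    ⟨fun z => BDF.RKer Λ Q' z.1 z.2, RKer_meas hm, ae_ballVol2_of_ae (RKer_congr he)⟩
  refine memLp_two_of_lintegral hae ?_
  have h1 : ∫⁻ z, ‖BDF.RKer Λ Q z.1 z.2‖ₑ ^ 2 ∂(ballVol2 Λ) ≤ ENNReal.ofReal Λ *
      ∫⁻ z : R3 × R3, (ENNReal.ofReal (1 / ‖z.1‖) + ENNReal.ofReal (1 / ‖z.2‖)) *
      ‖BDF.RKer Λ Q z.1 z.2‖ₑ ^ 2 := by
    rw [← lintegral_const_mul' _ _ ENNReal.ofReal_ne_top]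
    calc _ ≤ ∫⁻ z, ENNReal.ofReal Λ * ((ENNReal.ofReal (1 / ‖z.1‖) + ENNReal.ofReal (1 / ‖z.2‖)) *
          ‖BDF.RKer Λ Q z.1 z.2‖ₑ ^ 2) ∂(ballVol2 Λ) := by
          refine lintegral_mono_ae ?_
          filter_upwards [ae_ballVol2_mem Λ, ae_ballVol2_of_ae
            (ae_map_ne_zero quasiMeasurePreserving_fst_R3)] with z hz hz0
          rw [← mul_assoc]
          refine le_mul_of_one_le_left' ?_
          have hz' : ‖z.1‖ < Λ := by simpa using hz.1
          have hz0' : 0 < ‖z.1‖ := norm_pos_iff.2 hz0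
          calc (1 : ℝ≥0∞) = ENNReal.ofReal 1 := ENNReal.ofReal_one.symm
            _ ≤ ENNReal.ofReal (Λ * (1 / ‖z.1‖)) := by
                refine ENNReal.ofReal_le_ofReal ?_
                rw [mul_one_div, one_le_div hz0']
                exact hz'.le
            _ = ENNReal.ofReal Λ * ENNReal.ofReal (1 / ‖z.1‖) :=
                ENNReal.ofReal_mul (hz0'.le.trans hz'.le)
            _ ≤ _ := by
                gcongr
                exact le_self_add
      _ ≤ _ := by
          rw [ballVol2_eq]
          exact setLIntegral_le_lintegral _ _
  refine h1.trans_lt (ENNReal.mul_lt_top ENNReal.ofReal_lt_top ?_)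
  exact (lintegral_RKer_sq_le hQ).trans_lt (ENNReal.mul_lt_top ENNReal.ofReal_lt_top
    (wNorm_lt_top_of_memS2 hQ))

/-- The weighted L² bound forces the integral of norms to be finite almost everywhere. Additivity of
Q ↦ R_Q needs this. -/
theorem ae_integrable_RKer {Q : Ker} (hQ : MemS2 Λ Q) :
    ∀ᵐ z : R3 × R3, Integrable fun l => (1 / ‖l‖ ^ 2) • Q.ext Λ (z.1 - l, z.2 - l) := by
  obtain ⟨Q', hm, he⟩ := hQ.exists_meas
  have hQ' : MemS2 Λ Q' := hQ.congr he
  have hF := measurable_enorm_ext (Λ := Λ) hm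
  have h1 := lintegral_diagConv_sq_le quasiMeasurePreserving_fst_R3 (fun z l => rfl) hF
  have hfin : ∫⁻ z : R3 × R3, ENNReal.ofReal ‖z.1‖ * ‖Q'.ext Λ z‖ₑ ^ 2 < ∞ := by
    rw [lintegral_ext]
    refine lt_of_le_of_lt (lintegral_mono fun z => ?_) (wNorm_lt_top_of_memS2 hQ')
    gcongr
    exact (norm_le_sqrt_one_add z.1).trans (le_add_of_nonneg_right (Real.sqrt_nonneg _))
  have h2 := h1.trans_lt (ENNReal.mul_lt_top ENNReal.ofReal_lt_top hfin)
  have hdm := measurable_diagConv hF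
  have h3 := ae_lt_top (by fun_prop) h2.ne
  filter_upwards [h3, ae_map_ne_zero quasiMeasurePreserving_fst_R3, ae_ae_sub_diag he.ext_ae]
    with z hz hz0 hzl
  have h4 : diagConv (fun z => ‖Q'.ext Λ z‖ₑ) z < ∞ := by
    by_contra hc
    rw [not_lt, top_le_iff] at hc
    rw [hc, ENNReal.top_pow two_ne_zero, ENNReal.mul_top] at hz
    · exact lt_irrefl _ hz
    · have := norm_pos_iff.2 hz0
      simpa using hz0
  have h5 : Integrable fun l => (1 / ‖l‖ ^ 2) • Q'.ext Λ (z.1 - l, z.2 - l) := by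
    refine ⟨StronglyMeasurable.aestronglyMeasurable
      ((by fun_prop : Measurable fun l : R3 => 1 / ‖l‖ ^ 2).stronglyMeasurable.smul
        (hm.ext.comp_measurable (by fun_prop : Measurable fun l : R3 => (z.1 - l, z.2 - l)))), ?_⟩
    rw [HasFiniteIntegral]
    simpa only [enorm_smul, enorm_one_div_norm_sq, diagConv] using h4
  refine h5.congr ?_
  filter_upwards [hzl] with l hl
  rw [hl]

theorem RKer_sub {Q Q' : Ker} (hQ : MemS2 Λ Q) (hQ' : MemS2 Λ Q') :
    ∀ᵐ z : R3 × R3, RKer Λ (Q - Q') z.1 z.2 = RKer Λ Q z.1 z.2 - RKer Λ Q' z.1 z.2 := by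
  filter_upwards [ae_integrable_RKer hQ, ae_integrable_RKer hQ'] with z h1 h2
  rw [RKer_eq, RKer_eq, RKer_eq, ← smul_sub, ← integral_sub h1 h2]
  congr 2
  ext1 l
  rw [← smul_sub]
  congr 1
  exact congrFun (indicator_sub _ (fun z : R3 × R3 => Q z.1 z.2) fun z => Q' z.1 z.2) _

end Kernels

section LinearTerm

variable {α Λ : ℝ} {g₀ g₁ : ℝ → ℝ}

/-! ### The operator `F_{1,0}` on `𝐐₁` -/

theorem cauchy1_meas (h : IsDressedDirac α Λ g₀ g₁) {A : Ker} (hA : A.Meas) :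
    (cauchy1 g₀ g₁ A).Meas := by
  have h1 : StronglyMeasurable fun w : (R3 × R3) × ℝ =>
      res g₀ g₁ w.2 w.1.1 * A w.1.1 w.1.2 * res g₀ g₁ w.2 w.1.2 :=
    ((stronglyMeasurable_res h (by fun_prop) (by fun_prop)).mul
      (StronglyMeasurable.comp_measurable hA measurable_fst)).mul
      (stronglyMeasurable_res h (by fun_prop) (by fun_prop))
  exact (StronglyMeasurable.integral_prod_right' (ν := (volume : Measure ℝ)) h1).const_smul
    (1 / (2 * Real.pi))

theorem cauchy1_congr {A A' : Ker} {p q : R3} (h : A p q = A' p q) :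
    cauchy1 g₀ g₁ A p q = cauchy1 g₀ g₁ A' p q := by
  simp only [cauchy1, h]

theorem norm_sq_cauchy1_le (hα : 0 ≤ α) (h : IsDressedDirac α Λ g₀ g₁) (A : Ker) {p q : R3}
    (hp : p ∈ Metric.ball (0 : R3) Λ) (hq : q ∈ Metric.ball (0 : R3) Λ) :
    ‖cauchy1 g₀ g₁ A p q‖ ^ 2 ≤
      4 * ((√(1 + ‖p‖ ^ 2))⁻¹ * (√(1 + ‖q‖ ^ 2))⁻¹) * ‖A p q‖ ^ 2 := by
  have ep := one_add_sq_le_energy hα h hp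
  have eq := one_add_sq_le_energy hα h hq
  have p1 : 0 < 1 + ‖p‖ ^ 2 := by positivity
  have q1 : 0 < 1 + ‖q‖ ^ 2 := by positivity
  have h1 := norm_integral_matRes_mul_le (p1.trans_le ep) (q1.trans_le eq) (A p q)
  simp only [← dirac_eq_cliff, ← res_eq_matRes] at h1
  rw [cauchy1, norm_smul, mul_pow, Real.norm_of_nonneg (by positivity)]
  calc _ ≤ (1 / (2 * Real.pi)) ^ 2 * (16 * Real.pi ^ 2 * ((√(1 + ‖p‖ ^ 2))⁻¹ *
        (√(1 + ‖q‖ ^ 2))⁻¹) * ‖A p q‖ ^ 2) := by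
        refine mul_le_mul_of_nonneg_left (h1.trans ?_) (by positivity)
        gcongr
    _ = _ := by
        field_simp
        ring

theorem Q10_ae_meas (h : IsDressedDirac α Λ g₀ g₁) {Q : Ker} (hQ : MemS2 Λ Q) :
    AEStronglyMeasurable (fun z : R3 × R3 => Q10 Λ g₀ g₁ Q z.1 z.2) (ballVol2 Λ) := by
  obtain ⟨Q', hm, he⟩ := hQ.exists_meas
  have hm' : (-RKer Λ Q').Meas := (RKer_meas hm).neg
  refine ⟨fun z => Q10 Λ g₀ g₁ Q' z.1 z.2, cauchy1_meas h hm', ?_⟩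
  filter_upwards [ae_ballVol2_of_ae (RKer_congr he)] with z hz
  exact cauchy1_congr (by simp [hz])

theorem Q10_congr {Q Q' : Ker} (he : Q.Eqv Λ Q') : (Q10 Λ g₀ g₁ Q).Eqv Λ (Q10 Λ g₀ g₁ Q') := by
  filter_upwards [ae_ballVol2_of_ae (RKer_congr he)] with z hz
  exact cauchy1_congr (by simp [hz])

/-- With a = √(1+|p|²) and b = √(1+|q|²), the weight a + b times the gain 1/(ab) is 1/a + 1/b ≤
1/|p| + 1/|q|, precisely the weight in which R_Q is controlled. -/
theorem wNorm_Q10_le (hα : 0 ≤ α) (h : IsDressedDirac α Λ g₀ g₁) {Q : Ker} (hQ : MemS2 Λ Q) :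
    wNorm Λ (Q10 Λ g₀ g₁ Q) ≤ ENNReal.ofReal ((2 * rConst) ^ 2) * wNorm Λ Q := by
  have h1 : wNorm Λ (Q10 Λ g₀ g₁ Q) ≤ ∫⁻ z, 4 * ((ENNReal.ofReal (1 / ‖z.1‖) +
      ENNReal.ofReal (1 / ‖z.2‖)) * ‖RKer Λ Q z.1 z.2‖ₑ ^ 2) ∂(ballVol2 Λ) := by
    refine lintegral_mono_ae ?_
    filter_upwards [ae_ballVol2_mem Λ, ae_ballVol2_of_ae (ae_map_ne_zero
      quasiMeasurePreserving_fst_R3), ae_ballVol2_of_ae (ae_map_ne_zero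
      quasiMeasurePreserving_snd_R3)] with z hz hz1 hz2
    have n1 : 0 < ‖z.1‖ := norm_pos_iff.2 hz1
    have n2 : 0 < ‖z.2‖ := norm_pos_iff.2 hz2
    have h2 := norm_sq_cauchy1_le hα h (-RKer Λ Q) hz.1 hz.2
    rw [Pi.neg_apply, Pi.neg_apply, norm_neg] at h2
    have s1 := one_le_sqrt_one_add z.1
    have s2 := one_le_sqrt_one_add z.2
    have l1 := norm_le_sqrt_one_add z.1
    have l2 := norm_le_sqrt_one_add z.2
    have h3 : wt z * ‖Q10 Λ g₀ g₁ Q z.1 z.2‖ ^ 2 ≤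
        4 * ((1 / ‖z.1‖ + 1 / ‖z.2‖) * ‖RKer Λ Q z.1 z.2‖ ^ 2) := by
      rw [Q10, wt]
      set a := √(1 + ‖z.1‖ ^ 2) with ha
      set b := √(1 + ‖z.2‖ ^ 2) with hb
      calc _ ≤ (a + b) * (4 * (a⁻¹ * b⁻¹) * ‖RKer Λ Q z.1 z.2‖ ^ 2) := by gcongr
        _ = 4 * ((1 / a + 1 / b) * ‖RKer Λ Q z.1 z.2‖ ^ 2) := by
            have : a ≠ 0 := by positivity
            have : b ≠ 0 := by positivity
            field_simp
            ring
        _ ≤ _ := by gcongr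
    have h4 := ENNReal.ofReal_le_ofReal h3
    rw [ENNReal.ofReal_mul (by linarith [two_le_wt z]), ENNReal.ofReal_mul (by norm_num),
      ENNReal.ofReal_mul (by positivity), ENNReal.ofReal_add (by positivity) (by positivity),
      ENNReal.ofReal_pow (norm_nonneg _), ENNReal.ofReal_pow (norm_nonneg _), ofReal_norm,
      ofReal_norm, ENNReal.ofReal_ofNat] at h4
    exact h4
  refine h1.trans ?_
  rw [lintegral_const_mul' _ _ (by simp)]
  calc _ ≤ 4 * ∫⁻ z : R3 × R3, (ENNReal.ofReal (1 / ‖z.1‖) + ENNReal.ofReal (1 / ‖z.2‖)) *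
        ‖RKer Λ Q z.1 z.2‖ₑ ^ 2 := by
        gcongr
        rw [ballVol2_eq]
        exact Measure.restrict_le_self
    _ ≤ 4 * (ENNReal.ofReal (rConst ^ 2) * wNorm Λ Q) := by
        gcongr
        exact lintegral_RKer_sq_le hQ
    _ = _ := by
        rw [mul_pow, ENNReal.ofReal_mul (by norm_num), mul_assoc]
        norm_num

theorem memS2_of_wNorm {Q : Ker}
    (hm : AEStronglyMeasurable (fun z : R3 × R3 => Q z.1 z.2) (ballVol2 Λ))
    (h : wNorm Λ Q < ∞) : MemS2 Λ Q :=
  memLp_two_of_lintegral hm ((lintegral_sq_le_wNorm Q).trans_lt h)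

theorem MemS2.Q10 (hα : 0 ≤ α) (h : IsDressedDirac α Λ g₀ g₁) {Q : Ker} (hQ : MemS2 Λ Q) :
    MemS2 Λ (Q10 Λ g₀ g₁ Q) :=
  memS2_of_wNorm (Q10_ae_meas h hQ) ((wNorm_Q10_le hα h hQ).trans_lt
    (ENNReal.mul_lt_top ENNReal.ofReal_lt_top (wNorm_lt_top_of_memS2 hQ)))

theorem IsGapped.integrable_mul_const_mul {A B : M4} (hA : IsGapped A) (hB : IsGapped B) (X : M4) :
    Integrable (fun η => matRes A η * X * matRes B η) := by
  refine Integrable.mono' ((integrable_inv_sq_add_sq one_pos).const_mul (4 * ‖X‖))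
    ((hA.continuous_matRes.mul continuous_const).mul hB.continuous_matRes).aestronglyMeasurable
    (Eventually.of_forall fun η => ?_)
  have h1 := hA.norm_matRes_mul_le hB η
  calc _ ≤ ‖matRes A η‖ * ‖X‖ * ‖matRes B η‖ := norm_mul₃_le
    _ = ‖X‖ * (‖matRes A η‖ * ‖matRes B η‖) := by ring
    _ ≤ ‖X‖ * (4 * (1 ^ 2 + η ^ 2)⁻¹) := by gcongr
    _ = _ := by ring

theorem Q10_sub (hα : 0 ≤ α) (h : IsDressedDirac α Λ g₀ g₁) {Q Q' : Ker} (hQ : MemS2 Λ Q)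
    (hQ' : MemS2 Λ Q') :
    (Q10 Λ g₀ g₁ (Q - Q')).Eqv Λ (Q10 Λ g₀ g₁ Q - Q10 Λ g₀ g₁ Q') := by
  filter_upwards [ae_ballVol2_mem Λ, ae_ballVol2_of_ae (RKer_sub hQ hQ')] with z hz hR
  have gp := isGapped_dirac hα h hz.1
  have gq := isGapped_dirac hα h hz.2
  simp only [Q10, cauchy1, Pi.sub_apply, Pi.neg_apply, hR, res_eq_matRes]
  rw [← smul_sub, ← integral_sub (gp.integrable_mul_const_mul gq _)
    (gp.integrable_mul_const_mul gq _)]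
  congr 2
  ext1 η
  noncomm_ring

/-! ### The weighted Hilbert space -/

/-- The measure `(√(1+|p|²) + √(1+|q|²)) dp dq` on `B(0,Λ) × B(0,Λ)`. -/
def wMeas (Λ : ℝ) : Measure (R3 × R3) := (ballVol2 Λ).withDensity fun z => ENNReal.ofReal (wt z)

theorem measurable_ofReal_wt : Measurable fun z => ENNReal.ofReal (wt z) :=
  continuous_wt.measurable.ennreal_ofReal

theorem wMeas_ac : wMeas Λ ≪ ballVol2 Λ := withDensity_absolutelyContinuous _ _

theorem ballVol2_ac : ballVol2 Λ ≪ wMeas Λ := by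
  refine withDensity_absolutelyContinuous' measurable_ofReal_wt.aemeasurable
    (Eventually.of_forall fun z => ?_)
  have := two_le_wt z
  simp only [ne_eq, ENNReal.ofReal_eq_zero, not_le]
  linarith

theorem eLpNorm_wMeas_sq (Q : Ker) :
    eLpNorm (fun z : R3 × R3 => Q z.1 z.2) 2 (wMeas Λ) ^ 2 = wNorm Λ Q := by
  rw [eLpNorm_two_sq, wMeas, lintegral_withDensity_eq_lintegral_mul_non_measurable _
    measurable_ofReal_wt (Eventually.of_forall fun z => ENNReal.ofReal_lt_top)]
  rfl

theorem memLp_wMeas_iff {Q : Ker} :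
    MemLp (fun z : R3 × R3 => Q z.1 z.2) 2 (wMeas Λ) ↔ MemS2 Λ Q := by
  constructor
  · intro h
    refine memS2_of_wNorm (h.1.mono_ac ballVol2_ac) ?_
    rw [← eLpNorm_wMeas_sq]
    exact ENNReal.pow_lt_top h.2
  · intro h
    refine ⟨AEStronglyMeasurable.mono_ac wMeas_ac h.1, ?_⟩
    have := wNorm_lt_top_of_memS2 h
    rw [← eLpNorm_wMeas_sq] at this
    exact (ENNReal.pow_lt_top_iff (n := 2)).1 this |>.resolve_right (by norm_num)

/-- The kernel of an element of the weighted Hilbert space. -/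
def lpKer (X : Lp M4 2 (wMeas Λ)) : Ker := fun p q => X (p, q)

theorem memS2_lpKer (X : Lp M4 2 (wMeas Λ)) : MemS2 Λ (lpKer X) :=
  memLp_wMeas_iff.1 (Lp.memLp X)

theorem memS2_iff {Q : Ker} :
    MemS2 Λ Q ↔ MemLp (fun z : R3 × R3 => Q z.1 z.2) 2 (ballVol2 Λ) := Iff.rfl

theorem MemS2.add {Q Q' : Ker} (hQ : MemS2 Λ Q) (hQ' : MemS2 Λ Q') : MemS2 Λ (Q + Q') :=
  memS2_iff.2 ((memS2_iff.1 hQ).add (memS2_iff.1 hQ'))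

theorem MemS2.sub {Q Q' : Ker} (hQ : MemS2 Λ Q) (hQ' : MemS2 Λ Q') : MemS2 Λ (Q - Q') :=
  memS2_iff.2 ((memS2_iff.1 hQ).sub (memS2_iff.1 hQ'))

theorem MemS2.neg {Q : Ker} (hQ : MemS2 Λ Q) : MemS2 Λ (-Q) :=
  memS2_iff.2 (memS2_iff.1 hQ).neg

theorem MemS2.const_smul {Q : Ker} (hQ : MemS2 Λ Q) (c : ℝ) : MemS2 Λ (c • Q) :=
  memS2_iff.2 ((memS2_iff.1 hQ).const_smul c)

theorem eLpNorm_wMeas_le_of_wNorm {Q Q' : Ker} {c : ℝ≥0}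
    (h : wNorm Λ Q ≤ (c : ℝ≥0∞) ^ 2 * wNorm Λ Q') :
    eLpNorm (fun z : R3 × R3 => Q z.1 z.2) 2 (wMeas Λ) ≤
      c * eLpNorm (fun z : R3 × R3 => Q' z.1 z.2) 2 (wMeas Λ) := by
  rw [← eLpNorm_wMeas_sq, ← eLpNorm_wMeas_sq, ← mul_pow] at h
  exact (ENNReal.pow_le_pow_left_iff two_ne_zero).1 h

/-- The map `X ↦ Q + α F_{1,0}(X)` on the weighted Hilbert space. -/
def neumannMap (hα : 0 ≤ α) (h : IsDressedDirac α Λ g₀ g₁) {Q : Ker} (hQ : MemS2 Λ Q)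
    (X : Lp M4 2 (wMeas Λ)) : Lp M4 2 (wMeas Λ) :=
  MemLp.toLp (fun z : R3 × R3 => (Q + α • Q10 Λ g₀ g₁ (lpKer X)) z.1 z.2)
    (memLp_wMeas_iff.2 (hQ.add (((memS2_lpKer X).Q10 hα h).const_smul α)))

theorem lipschitzWith_neumannMap (hα : 0 ≤ α) (h : IsDressedDirac α Λ g₀ g₁) {Q : Ker}
    (hQ : MemS2 Λ Q) :
    LipschitzWith (α * (2 * rConst)).toNNReal (neumannMap hα h hQ) := by
  intro X Y
  rw [neumannMap, neumannMap, Lp.edist_toLp_toLp, Lp.edist_def]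
  have hX := memS2_lpKer X
  have hY := memS2_lpKer Y
  have e1 : eLpNorm ((fun z : R3 × R3 => (Q + α • Q10 Λ g₀ g₁ (lpKer X)) z.1 z.2) -
      fun z : R3 × R3 => (Q + α • Q10 Λ g₀ g₁ (lpKer Y)) z.1 z.2) 2 (wMeas Λ) =
      eLpNorm (fun z : R3 × R3 => (α • Q10 Λ g₀ g₁ (lpKer X - lpKer Y)) z.1 z.2) 2 (wMeas Λ) := by
    refine eLpNorm_congr_ae ?_
    filter_upwards [wMeas_ac.ae_le (Q10_sub hα h hX hY)] with z hz
    simp only [Pi.sub_apply, Pi.add_apply, Pi.smul_apply] at hz ⊢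
    rw [hz, smul_sub]
    abel
  rw [e1]
  have hXY : MemS2 Λ (lpKer X - lpKer Y) := hX.sub hY
  refine eLpNorm_wMeas_le_of_wNorm (Q' := lpKer X - lpKer Y) ?_
  have e2 : wNorm Λ (α • Q10 Λ g₀ g₁ (lpKer X - lpKer Y)) =
      ENNReal.ofReal (α ^ 2) * wNorm Λ (Q10 Λ g₀ g₁ (lpKer X - lpKer Y)) := by
    rw [wNorm, wNorm, ← lintegral_const_mul' _ _ ENNReal.ofReal_ne_top]
    refine lintegral_congr fun z => ?_
    rw [Pi.smul_apply, Pi.smul_apply, enorm_smul, mul_pow, Real.enorm_eq_ofReal hα,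
      ENNReal.ofReal_pow hα]
    ring
  rw [e2]
  calc _ ≤ ENNReal.ofReal (α ^ 2) * (ENNReal.ofReal ((2 * rConst) ^ 2) *
        wNorm Λ (lpKer X - lpKer Y)) := by
        gcongr
        exact wNorm_Q10_le hα h hXY
    _ = _ := by
        have hr := rConst_nonneg
        rw [← mul_assoc, ← ENNReal.ofReal_mul (by positivity), ← mul_pow,
          ENNReal.ofReal_pow (by positivity)]
        rfl

theorem isFixedPt_neumannMap_iff (hα : 0 ≤ α) (h : IsDressedDirac α Λ g₀ g₁) {Q Y : Ker}
    (hQ : MemS2 Λ Q) (hY : MemS2 Λ Y) :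
    Function.IsFixedPt (neumannMap hα h hQ) (MemLp.toLp (fun z : R3 × R3 => Y z.1 z.2)
      (memLp_wMeas_iff.2 hY)) ↔ (Y - α • Q10 Λ g₀ g₁ Y).Eqv Λ Q := by
  set X := MemLp.toLp (fun z : R3 × R3 => Y z.1 z.2) (memLp_wMeas_iff.2 hY) with hX
  have hXY : (lpKer X).Eqv Λ Y := ballVol2_ac.ae_le (MemLp.coeFn_toLp (memLp_wMeas_iff.2 hY))
  have hc := Q10_congr (g₀ := g₀) (g₁ := g₁) hXY
  rw [Function.IsFixedPt, neumannMap, hX, MemLp.toLp_eq_toLp_iff]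
  constructor
  · intro hf
    filter_upwards [ballVol2_ac.ae_le hf, hc] with z hz hz'
    simp only [Pi.add_apply, Pi.smul_apply, Pi.sub_apply] at hz ⊢
    rw [← hX] at hz
    rw [← hz, hz']
    abel
  · intro hf
    refine wMeas_ac.ae_le ?_
    filter_upwards [hf, hc] with z hz hz'
    simp only [Pi.add_apply, Pi.smul_apply, Pi.sub_apply] at hz ⊢
    rw [← hX, hz', ← hz]
    abel

/-- Banach's fixed point theorem for X ↦ Q + αF_{1,0}(X) in the complete weighted L² space,
transferred back to kernels modulo null sets. -/
theorem tWellDefined_of_small (hα : 0 ≤ α) (h : IsDressedDirac α Λ g₀ g₁)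
    (hsmall : α * (2 * rConst) < 1) : TWellDefined α Λ g₀ g₁ := by
  refine ⟨fun Q hQ => (hQ.1.Q10 hα h).memQ1, fun Q hQ => ?_⟩
  have hcw : ContractingWith (α * (2 * rConst)).toNNReal (neumannMap hα h hQ.1) :=
    ⟨by rwa [Real.toNNReal_lt_one], lipschitzWith_neumannMap hα h hQ.1⟩
  set X := ContractingWith.fixedPoint _ hcw with hX
  have hXfix := ContractingWith.fixedPoint_isFixedPt hcw
  rw [← hX] at hXfix
  have hS := memS2_lpKer X
  have hXeq : MemLp.toLp (fun z : R3 × R3 => lpKer X z.1 z.2) (memLp_wMeas_iff.2 hS) = X :=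
    Lp.toLp_coeFn X (Lp.memLp X)
  refine ⟨lpKer X, ⟨hS.memQ1, ?_⟩, fun Y hY => ?_⟩
  · rw [← isFixedPt_neumannMap_iff hα h hQ.1 hS, hXeq]
    exact hXfix
  · have h1 := (isFixedPt_neumannMap_iff hα h hQ.1 hY.1.1).2 hY.2
    have h2 := hcw.fixedPoint_unique h1
    rw [← hX, ← hXeq, MemLp.toLp_eq_toLp_iff] at h2
    exact ballVol2_ac.ae_le h2

end LinearTerm

section Memberships

variable {α Λ : ℝ} {g₀ g₁ : ℝ → ℝ}

/-! ### Coulomb potentials -/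

/-- The function `(2π)^{-3/2} v̂_ρ`. -/
def vHat (ρ : TemperedDistribution R3 ℂ) (k : R3) : ℂ :=
  (((2 * Real.pi) ^ (-(3 / 2) : ℝ) * (4 * Real.pi / ‖k‖ ^ 2) : ℝ) : ℂ) * rhoHat ρ k

theorem VKer_eq (ρ : TemperedDistribution R3 ℂ) (p q : R3) :
    VKer ρ p q = vHat ρ (p - q) • (1 : M4) := rfl

variable {ρ : TemperedDistribution R3 ℂ}

theorem IsCoulomb.rhoHat_spec (h : IsCoulomb ρ) :
    Measurable (rhoHat ρ) ∧ Integrable (fun k => ‖rhoHat ρ k‖ ^ 2 / ‖k‖ ^ 2) := by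
  rw [rhoHat, dif_pos h]
  exact ⟨h.choose_spec.1, h.choose_spec.2.1⟩

theorem measurable_vHat (h : IsCoulomb ρ) : Measurable (vHat ρ) := by
  have := h.rhoHat_spec.1
  unfold vHat
  fun_prop

theorem lintegral_vHat_lt_top (h : IsCoulomb ρ) :
    ∫⁻ k, ENNReal.ofReal (‖k‖ ^ 2) * ‖vHat ρ k‖ₑ ^ 2 < ∞ := by
  set c : ℝ := (2 * Real.pi) ^ (-(3 / 2) : ℝ) * (4 * Real.pi) with hc
  have h1 := (h.rhoHat_spec.2.const_mul (c ^ 2)).lintegral_lt_top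
  refine lt_of_le_of_lt (le_of_eq (lintegral_congr fun k => ?_)) h1
  rw [← ofReal_norm, ← ENNReal.ofReal_pow (norm_nonneg _), ← ENNReal.ofReal_mul (by positivity)]
  congr 1
  rw [vHat, norm_mul, Complex.norm_real, Real.norm_of_nonneg (by positivity)]
  by_cases hk : ‖k‖ = 0
  · simp [hk]
  · field_simp
    rw [hc]
    ring

/-- Cauchy-Schwarz between |k||v̂(k)| in L² and |k|⁻¹, which is locally square integrable in
dimension three. By Schur's test the compressed potential is then bounded. -/
theorem lintegral_ball_vHat_lt_top (h : IsCoulomb ρ) (r : ℝ) :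
    ∫⁻ k in Metric.ball 0 r, ‖vHat ρ k‖ₑ < ∞ := by
  have hv := measurable_vHat h
  have hK := measurable_invSq
  have h1 : (∫⁻ k in Metric.ball 0 r, ‖vHat ρ k‖ₑ) ^ 2 ≤ (∫⁻ k in Metric.ball 0 r, invSq k) *
      ∫⁻ k in Metric.ball 0 r, ENNReal.ofReal (‖k‖ ^ 2) * ‖vHat ρ k‖ₑ ^ 2 := by
    refine sq_lintegral_le (by fun_prop) (by fun_prop) (ae_restrict_of_ae ?_)
    filter_upwards [ae_ne_zero_R3] with k hk
    have hk' : ‖k‖ ^ 2 ≠ 0 := by simpa using hk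
    rw [← mul_assoc, invSq, ← ENNReal.ofReal_mul (by positivity), one_div_mul_cancel hk',
      ENNReal.ofReal_one, one_mul]
  have h2 := h1.trans_lt (ENNReal.mul_lt_top (lintegral_ball_invSq_lt_top r)
    ((setLIntegral_le_lintegral _ _).trans_lt (lintegral_vHat_lt_top h)))
  exact (ENNReal.pow_lt_top_iff (n := 2)).1 h2 |>.resolve_right (by norm_num)

theorem lintegral_vHat_sub_left_le (q : R3) (hq : q ∈ Metric.ball (0 : R3) Λ) :
    ∫⁻ p, ‖vHat ρ (p - q)‖ₑ ∂(ballVol Λ) ≤ ∫⁻ k in Metric.ball 0 (2 * Λ), ‖vHat ρ k‖ₑ := by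
  rw [ballVol, ← lintegral_indicator measurableSet_ball, ← lintegral_indicator measurableSet_ball,
    ← lintegral_sub_right_eq_self ((Metric.ball (0 : R3) (2 * Λ)).indicator _) q]
  refine lintegral_mono fun p => ?_
  by_cases hp : p ∈ Metric.ball (0 : R3) Λ
  · have : p - q ∈ Metric.ball (0 : R3) (2 * Λ) := by
      rw [mem_ball_zero_iff] at *
      linarith [norm_sub_le p q]
    rw [indicator_of_mem hp, indicator_of_mem this]
  · rw [indicator_of_notMem hp]
    exact zero_le

theorem lintegral_vHat_sub_right_le (p : R3) (hp : p ∈ Metric.ball (0 : R3) Λ) :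
    ∫⁻ q, ‖vHat ρ (p - q)‖ₑ ∂(ballVol Λ) ≤ ∫⁻ k in Metric.ball 0 (2 * Λ), ‖vHat ρ k‖ₑ := by
  rw [ballVol, ← lintegral_indicator measurableSet_ball, ← lintegral_indicator measurableSet_ball,
    ← lintegral_sub_left_eq_self ((Metric.ball (0 : R3) (2 * Λ)).indicator _) p]
  refine lintegral_mono fun q => ?_
  by_cases hq : q ∈ Metric.ball (0 : R3) Λ
  · have : p - q ∈ Metric.ball (0 : R3) (2 * Λ) := by
      rw [mem_ball_zero_iff] at *
      linarith [norm_sub_le p q]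
    rw [indicator_of_mem hq, indicator_of_mem this]
  · rw [indicator_of_notMem hq]
    exact zero_le

/-! ### Composition of a Hilbert-Schmidt kernel with a bounded one -/

/-- Schur's test for W, made quantitative: composing with a kernel whose row and column integrals
are at most M multiplies the Hilbert-Schmidt norm by at most M. -/
theorem lintegral_comp_sq_le {X : Type*} [MeasurableSpace X] {μ : Measure X} [SFinite μ]
    {A W : X → X → ℝ≥0∞} (hA : Measurable (Function.uncurry A)) (hW : Measurable (Function.uncurry W))
    {M : ℝ≥0∞} (h1 : ∀ᵐ q ∂μ, ∫⁻ r, W r q ∂μ ≤ M) (h2 : ∀ᵐ r ∂μ, ∫⁻ q, W r q ∂μ ≤ M) :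
    ∫⁻ p, ∫⁻ q, (∫⁻ r, A p r * W r q ∂μ) ^ 2 ∂μ ∂μ ≤
      M ^ 2 * ∫⁻ p, ∫⁻ r, A p r ^ 2 ∂μ ∂μ := by
  have hA1 : ∀ p, Measurable (A p) := fun p => hA.of_uncurry_left
  have hW1 : ∀ q, Measurable fun r => W r q := fun q => hW.of_uncurry_right
  have hW2 : ∀ r, Measurable (W r) := fun r => hW.of_uncurry_left
  have key : ∀ p, ∫⁻ q, (∫⁻ r, A p r * W r q ∂μ) ^ 2 ∂μ ≤ M ^ 2 * ∫⁻ r, A p r ^ 2 ∂μ := by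
    intro p
    have hAp := hA1 p
    have hm : Measurable (Function.uncurry fun q r => A p r ^ 2 * W r q) := by
      have : Measurable fun w : X × X => W w.2 w.1 := hW.comp measurable_swap
      unfold Function.uncurry
      fun_prop
    calc _ ≤ ∫⁻ q, M * ∫⁻ r, A p r ^ 2 * W r q ∂μ ∂μ := by
          refine lintegral_mono_ae ?_
          filter_upwards [h1] with q hq
          have hWq := hW1 q
          refine (sq_lintegral_le (a := fun r => W r q) (b := fun r => A p r ^ 2 * W r q)
            (by fun_prop) (by fun_prop) (Eventually.of_forall fun r => le_of_eq (by ring))).trans ?_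
          gcongr
      _ = M * ∫⁻ r, ∫⁻ q, A p r ^ 2 * W r q ∂μ ∂μ := by
          rw [lintegral_const_mul _ hm.lintegral_prod_right, lintegral_lintegral_swap hm.aemeasurable]
      _ ≤ M * ∫⁻ r, A p r ^ 2 * M ∂μ := by
          refine mul_le_mul' le_rfl (lintegral_mono_ae ?_)
          filter_upwards [h2] with r hr
          rw [lintegral_const_mul _ (hW2 r)]
          gcongr
      _ = _ := by
          rw [lintegral_mul_const _ (by fun_prop)]
          ring
  calc _ ≤ ∫⁻ p, M ^ 2 * ∫⁻ r, A p r ^ 2 ∂μ ∂μ := lintegral_mono key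
    _ = _ := by
        refine lintegral_const_mul _ ?_
        exact Measurable.lintegral_prod_right (f := fun p r => A p r ^ 2) (hA.pow_const 2)

theorem lintegral_comp_sq_le' {X : Type*} [MeasurableSpace X] {μ : Measure X} [SFinite μ]
    {A W : X → X → ℝ≥0∞} (hA : Measurable (Function.uncurry A)) (hW : Measurable (Function.uncurry W))
    {M : ℝ≥0∞} (h1 : ∀ᵐ q ∂μ, ∫⁻ r, W r q ∂μ ≤ M) (h2 : ∀ᵐ r ∂μ, ∫⁻ q, W r q ∂μ ≤ M) :
    ∫⁻ p, ∫⁻ q, (∫⁻ r, W p r * A r q ∂μ) ^ 2 ∂μ ∂μ ≤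
      M ^ 2 * ∫⁻ p, ∫⁻ r, A p r ^ 2 ∂μ ∂μ := by
  have h := lintegral_comp_sq_le (μ := μ) (A := fun p r => A r p) (W := fun r q => W q r)
    (hA.comp measurable_swap) (hW.comp measurable_swap) h2 h1
  rw [lintegral_lintegral_swap (f := fun p r => A r p ^ 2)
    ((hA.comp measurable_swap).pow_const 2).aemeasurable] at h
  refine le_trans (le_of_eq ?_) h
  rw [lintegral_lintegral_swap]
  · simp only [mul_comm]
  · have : Measurable fun w : (X × X) × X => W w.1.1 w.2 * A w.2 w.1.2 :=
      (hW.comp (by fun_prop : Measurable fun w : (X × X) × X => (w.1.1, w.2))).mul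
        (hA.comp (by fun_prop : Measurable fun w : (X × X) × X => (w.2, w.1.2)))
    exact (this.lintegral_prod_right'.pow_const 2).aemeasurable

/-! ### The second order terms -/

theorem cauchy2_meas (h : IsDressedDirac α Λ g₀ g₁) {A B : Ker} (hA : A.Meas) (hB : B.Meas) :
    (cauchy2 Λ g₀ g₁ A B).Meas := by
  have h1 : StronglyMeasurable fun w : ((R3 × R3) × ℝ) × R3 =>
      res g₀ g₁ w.1.2 w.1.1.1 * A w.1.1.1 w.2 * res g₀ g₁ w.1.2 w.2 * B w.2 w.1.1.2 *
        res g₀ g₁ w.1.2 w.1.1.2 :=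
    ((((stronglyMeasurable_res h (by fun_prop) (by fun_prop)).mul
      (StronglyMeasurable.comp_measurable hA (by fun_prop :
        Measurable fun w : ((R3 × R3) × ℝ) × R3 => (w.1.1.1, w.2)))).mul
      (stronglyMeasurable_res h (by fun_prop) (by fun_prop))).mul
      (StronglyMeasurable.comp_measurable hB (by fun_prop :
        Measurable fun w : ((R3 × R3) × ℝ) × R3 => (w.2, w.1.1.2)))).mul
      (stronglyMeasurable_res h (by fun_prop) (by fun_prop))
  have h2 := StronglyMeasurable.integral_prod_right' (ν := ballVol Λ) h1
  exact (StronglyMeasurable.integral_prod_right' (ν := (volume : Measure ℝ)) h2).const_smul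
    (-(1 / (2 * Real.pi)))

theorem Ker.Eqv.ae_left {Q Q' : Ker} (h : Q.Eqv Λ Q') :
    ∀ᵐ z ∂(ballVol2 Λ), ∀ᵐ r ∂(ballVol Λ), Q z.1 r = Q' z.1 r :=
  Measure.quasiMeasurePreserving_fst.ae (Measure.ae_ae_of_ae_prod h)

theorem Ker.Eqv.ae_right {Q Q' : Ker} (h : Q.Eqv Λ Q') :
    ∀ᵐ z ∂(ballVol2 Λ), ∀ᵐ r ∂(ballVol Λ), Q r z.2 = Q' r z.2 := by
  have h1 : ∀ᵐ w ∂((ballVol Λ).prod (ballVol Λ)), Q w.2 w.1 = Q' w.2 w.1 :=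
    Measure.measurePreserving_swap.quasiMeasurePreserving.ae h
  exact Measure.quasiMeasurePreserving_snd.ae (Measure.ae_ae_of_ae_prod h1)

theorem cauchy2_congr {A A' B B' : Ker} (hA : A.Eqv Λ A') (hB : B.Eqv Λ B') :
    (cauchy2 Λ g₀ g₁ A B).Eqv Λ (cauchy2 Λ g₀ g₁ A' B') := by
  filter_upwards [hA.ae_left, hB.ae_right] with z h1 h2
  rw [cauchy2, cauchy2]
  congr 2
  ext1 η
  refine integral_congr_ae ?_
  filter_upwards [h1, h2] with r hr1 hr2
  rw [hr1, hr2]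

/-- The two outer resolvents supply the decay 4/(1+η²) and the middle one is at most 2; integrating
gives 8π/(2π) = 4. -/
theorem enorm_cauchy2_le (hα : 0 ≤ α) (h : IsDressedDirac α Λ g₀ g₁) (A B : Ker) {p q : R3}
    (hp : p ∈ Metric.ball (0 : R3) Λ) (hq : q ∈ Metric.ball (0 : R3) Λ) :
    ‖cauchy2 Λ g₀ g₁ A B p q‖ₑ ≤ 4 * ∫⁻ r, ‖A p r‖ₑ * ‖B r q‖ₑ ∂(ballVol Λ) := by
  have gp := isGapped_dirac hα h hp
  have gq := isGapped_dirac hα h hq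
  set I := ∫⁻ r, ‖A p r‖ₑ * ‖B r q‖ₑ ∂(ballVol Λ) with hI
  have h1 : ∀ η : ℝ, ‖∫ r in Metric.ball (0 : R3) Λ, res g₀ g₁ η p * A p r * res g₀ g₁ η r * B r q *
      res g₀ g₁ η q‖ₑ ≤ ENNReal.ofReal (8 * (1 ^ 2 + η ^ 2)⁻¹) * I := by
    intro η
    refine (enorm_integral_le_lintegral_enorm _).trans ?_
    rw [hI, ← lintegral_const_mul' _ _ ENNReal.ofReal_ne_top, ballVol]
    refine setLIntegral_mono' measurableSet_ball fun r hr => ?_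
    have gr := isGapped_dirac hα h hr
    have b1 := gp.norm_matRes_mul_le gq η
    have b2 := gr.norm_matRes_le_two η
    simp only [res_eq_matRes]
    rw [← ofReal_norm, ← ofReal_norm, ← ofReal_norm, ← ENNReal.ofReal_mul (norm_nonneg _),
      ← ENNReal.ofReal_mul (by positivity)]
    refine ENNReal.ofReal_le_ofReal ?_
    set P := matRes (dirac g₀ g₁ p) η
    set R := matRes (dirac g₀ g₁ r) η
    set S := matRes (dirac g₀ g₁ q) η
    calc ‖P * A p r * R * B r q * S‖ ≤ ‖P‖ * ‖A p r‖ * ‖R‖ * ‖B r q‖ * ‖S‖ := by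
          refine norm_mul₃_le.trans ?_
          gcongr
          exact norm_mul₃_le
      _ = (‖P‖ * ‖S‖) * ‖R‖ * (‖A p r‖ * ‖B r q‖) := by ring
      _ ≤ (4 * (1 ^ 2 + η ^ 2)⁻¹) * 2 * (‖A p r‖ * ‖B r q‖) := by gcongr
      _ = _ := by ring
  rw [cauchy2, enorm_smul]
  calc _ ≤ ENNReal.ofReal (1 / (2 * Real.pi)) *
        ∫⁻ η : ℝ, ENNReal.ofReal (8 * (1 ^ 2 + η ^ 2)⁻¹) * I := by
        rw [enorm_neg, Real.enorm_eq_ofReal (by positivity)]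
        gcongr
        exact (enorm_integral_le_lintegral_enorm _).trans (lintegral_mono h1)
    _ = ENNReal.ofReal (1 / (2 * Real.pi)) * (ENNReal.ofReal (8 * Real.pi) * I) := by
        rw [lintegral_mul_const _ (by fun_prop)]
        congr 2
        simp_rw [ENNReal.ofReal_mul (by norm_num : (0 : ℝ) ≤ 8)]
        rw [lintegral_const_mul _ (by fun_prop), lintegral_inv_sq_add_sq one_pos, div_one]
    _ = _ := by
        rw [← mul_assoc, ← ENNReal.ofReal_mul (by positivity)]
        congr 1
        rw [show 1 / (2 * Real.pi) * (8 * Real.pi) = 4 by field_simp; norm_num]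
        simp

theorem VKer_meas (hρ : IsCoulomb ρ) : (VKer ρ).Meas := by
  have h1 : Measurable fun z : R3 × R3 => vHat ρ (z.1 - z.2) :=
    (measurable_vHat hρ).comp (by fun_prop)
  exact h1.stronglyMeasurable.smul_const (1 : M4)

theorem enorm_VKer (p q : R3) : ‖VKer ρ p q‖ₑ = ‖vHat ρ (p - q)‖ₑ * ‖(1 : M4)‖ₑ := by
  rw [VKer_eq, enorm_smul]

theorem ae_ballVol_mem (Λ : ℝ) : ∀ᵐ p ∂(ballVol Λ), p ∈ Metric.ball (0 : R3) Λ :=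
  ae_restrict_mem measurableSet_ball

theorem exists_lintegral_enorm_VKer_le (hρ : IsCoulomb ρ) (Λ : ℝ) : ∃ M : ℝ≥0∞, M ≠ ∞ ∧
    (∀ᵐ q ∂(ballVol Λ), ∫⁻ r, ‖VKer ρ r q‖ₑ ∂(ballVol Λ) ≤ M) ∧
    ∀ᵐ r ∂(ballVol Λ), ∫⁻ q, ‖VKer ρ r q‖ₑ ∂(ballVol Λ) ≤ M := by
  refine ⟨(∫⁻ k in Metric.ball 0 (2 * Λ), ‖vHat ρ k‖ₑ) * ‖(1 : M4)‖ₑ,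
    ENNReal.mul_ne_top (lintegral_ball_vHat_lt_top hρ _).ne enorm_ne_top, ?_, ?_⟩
  · filter_upwards [ae_ballVol_mem Λ] with q hq
    simp_rw [enorm_VKer]
    rw [lintegral_mul_const' _ _ enorm_ne_top]
    exact mul_le_mul' (lintegral_vHat_sub_left_le q hq) le_rfl
  · filter_upwards [ae_ballVol_mem Λ] with p hp
    simp_rw [enorm_VKer]
    rw [lintegral_mul_const' _ _ enorm_ne_top]
    exact mul_le_mul' (lintegral_vHat_sub_right_le p hp) le_rfl

theorem lintegral_ballVol2 {f : R3 × R3 → ℝ≥0∞} (hf : Measurable f) :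
    ∫⁻ z, f z ∂(ballVol2 Λ) = ∫⁻ p, ∫⁻ q, f (p, q) ∂(ballVol Λ) ∂(ballVol Λ) := by
  rw [ballVol2, lintegral_prod _ hf.aemeasurable]

theorem lintegral_enorm_sq_lt_top {A : Ker} (hA : A.Meas) (h : MemS2 Λ A) :
    ∫⁻ p, ∫⁻ q, ‖A p q‖ₑ ^ 2 ∂(ballVol Λ) ∂(ballVol Λ) < ∞ := by
  have h1 := lintegral_enorm_sq_lt_top_of_memLp h
  rwa [lintegral_ballVol2 ((StronglyMeasurable.enorm hA).pow_const 2)] at h1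

theorem memS2_of_enorm_le {Q : Ker} (hQ : Q.Meas) {c : ℝ≥0∞} (hc : c ≠ ∞)
    {F : R3 × R3 → ℝ≥0∞} (hF : Measurable F) (hle : ∀ᵐ z ∂(ballVol2 Λ), ‖Q z.1 z.2‖ₑ ≤ c * F z)
    (hfin : ∫⁻ p, ∫⁻ q, F (p, q) ^ 2 ∂(ballVol Λ) ∂(ballVol Λ) < ∞) : MemS2 Λ Q := by
  refine memLp_two_of_lintegral (StronglyMeasurable.aestronglyMeasurable hQ) ?_
  rw [← lintegral_ballVol2 (f := fun z => F z ^ 2) (hF.pow_const 2)] at hfin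
  refine lt_of_le_of_lt (b := c ^ 2 * ∫⁻ z, F z ^ 2 ∂(ballVol2 Λ)) ?_
    (ENNReal.mul_lt_top (ENNReal.pow_lt_top hc.lt_top) hfin)
  rw [← lintegral_const_mul' _ _ (ENNReal.pow_ne_top hc)]
  refine lintegral_mono_ae ?_
  filter_upwards [hle] with z hz
  rw [← mul_pow]
  gcongr

theorem measurable_mul_comp {a b : R3 → R3 → ℝ≥0∞} (ha : Measurable (Function.uncurry a))
    (hb : Measurable (Function.uncurry b)) :
    Measurable fun w : (R3 × R3) × R3 => a w.1.1 w.2 * b w.2 w.1.2 :=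
  (ha.comp (by fun_prop : Measurable fun w : (R3 × R3) × R3 => (w.1.1, w.2))).mul
    (hb.comp (by fun_prop : Measurable fun w : (R3 × R3) × R3 => (w.2, w.1.2)))

theorem lintegral_mul_comp_add {a b : R3 → R3 → ℝ≥0∞} (ha : Measurable (Function.uncurry a))
    (hb : Measurable (Function.uncurry b)) (f : R3 → ℝ≥0∞) (z : R3 × R3) :
    ∫⁻ r, (a z.1 r * b r z.2 + f r) ∂(ballVol Λ) =
      ∫⁻ r, a z.1 r * b r z.2 ∂(ballVol Λ) + ∫⁻ r, f r ∂(ballVol Λ) :=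
  lintegral_add_left
    ((measurable_mul_comp ha hb).comp (by fun_prop : Measurable fun r : R3 => (z, r))) _

theorem measurable_lintegral_comp {a b : R3 → R3 → ℝ≥0∞} (ha : Measurable (Function.uncurry a))
    (hb : Measurable (Function.uncurry b)) :
    Measurable fun z : R3 × R3 => ∫⁻ r, a z.1 r * b r z.2 ∂(ballVol Λ) :=
  (measurable_mul_comp ha hb).lintegral_prod_right'

theorem MemS2.cauchy2_VKer (hα : 0 ≤ α) (h : IsDressedDirac α Λ g₀ g₁) {A : Ker}
    (hA : MemS2 Λ A) (hρ : IsCoulomb ρ) :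
    MemS2 Λ (cauchy2 Λ g₀ g₁ A (VKer ρ)) ∧ MemS2 Λ (cauchy2 Λ g₀ g₁ (VKer ρ) A) := by
  obtain ⟨A', hm, he⟩ := hA.exists_meas
  have hA' : MemS2 Λ A' := hA.congr he
  have hV := VKer_meas hρ
  have hV0 : (VKer ρ).Eqv Λ (VKer ρ) := Eventually.of_forall fun _ => rfl
  obtain ⟨M, hM, hM1, hM2⟩ := exists_lintegral_enorm_VKer_le hρ Λ
  have hfin := ENNReal.mul_lt_top (ENNReal.pow_lt_top (n := 2) hM.lt_top)
    (lintegral_enorm_sq_lt_top hm hA')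
  have hmA : Measurable (Function.uncurry fun p q => ‖A' p q‖ₑ) := StronglyMeasurable.enorm hm
  have hmV : Measurable (Function.uncurry fun p q => ‖VKer ρ p q‖ₑ) := StronglyMeasurable.enorm hV
  constructor
  · refine MemS2.congr ?_ (cauchy2_congr he hV0).symm
    refine memS2_of_enorm_le (cauchy2_meas h hm hV) (c := 4) (by simp)
      (measurable_lintegral_comp hmA hmV) ?_
      ((lintegral_comp_sq_le hmA hmV hM1 hM2).trans_lt hfin)
    filter_upwards [ae_ballVol2_mem Λ] with z hz using enorm_cauchy2_le hα h _ _ hz.1 hz.2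
  · refine MemS2.congr ?_ (cauchy2_congr hV0 he).symm
    refine memS2_of_enorm_le (cauchy2_meas h hV hm) (c := 4) (by simp)
      (measurable_lintegral_comp hmV hmA) ?_
      ((lintegral_comp_sq_le' hmA hmV hM1 hM2).trans_lt hfin)
    filter_upwards [ae_ballVol2_mem Λ] with z hz using enorm_cauchy2_le hα h _ _ hz.1 hz.2

theorem MemS2.Q11 (hα : 0 ≤ α) (h : IsDressedDirac α Λ g₀ g₁) {Q : Ker} (hQ : MemS2 Λ Q)
    (hρ : IsCoulomb ρ) : MemS2 Λ (Q11 Λ g₀ g₁ Q ρ) := by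
  have h1 := hQ.RKer.neg.cauchy2_VKer hα h hρ
  exact h1.1.add h1.2

/-! ### Commutators with the symbol of `𝒟⁰` -/

/-- The kernel of modulus `|v̂_ρ(p-q)| |𝒟⁰(p) - 𝒟⁰(q)|`. -/
def commKer (g₀ g₁ : ℝ → ℝ) (ρ : TemperedDistribution R3 ℂ) : Ker := fun p q =>
  vHat ρ (p - q) • (dirac g₀ g₁ p - dirac g₀ g₁ q)

theorem commKer_meas (h : IsDressedDirac α Λ g₀ g₁) (hρ : IsCoulomb ρ) :
    (commKer g₀ g₁ ρ).Meas := by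
  have h1 : Measurable fun z : R3 × R3 => vHat ρ (z.1 - z.2) :=
    (measurable_vHat hρ).comp (by fun_prop)
  have h2 := stronglyMeasurable_dirac h
  exact h1.stronglyMeasurable.smul ((h2.comp_measurable measurable_fst).sub
    (h2.comp_measurable measurable_snd))

/-- With k = p - q, integrating over p first yields at most C|k|²|v̂(k)|², and this is integrable
because the Coulomb energy is finite. -/
theorem lintegral_commKer_lt_top (h : IsDressedDirac α Λ g₀ g₁) (hρ : IsCoulomb ρ) :
    ∫⁻ p, ∫⁻ q, ‖commKer g₀ g₁ ρ p q‖ₑ ^ 2 ∂(ballVol Λ) ∂(ballVol Λ) < ∞ := by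
  obtain ⟨C, hC, hCle⟩ := exists_lintegral_dirac_sub_le h
  have hv := measurable_vHat hρ
  set B := Metric.ball (0 : R3) Λ with hB
  set F : R3 × R3 → ℝ≥0∞ := (B ×ˢ B).indicator fun z => ‖commKer g₀ g₁ ρ z.1 z.2‖ₑ ^ 2 with hF
  have hm : Measurable fun z : R3 × R3 => ‖commKer g₀ g₁ ρ z.1 z.2‖ₑ ^ 2 :=
    (StronglyMeasurable.enorm (commKer_meas h hρ)).pow_const 2
  have hFm : Measurable F := hm.indicator (measurableSet_ballSq Λ)
  rw [← lintegral_ballVol2 hm, ballVol2_eq, ← lintegral_indicator (measurableSet_ballSq Λ),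
    ← hB, ← hF, Measure.volume_eq_prod, lintegral_prod _ hFm.aemeasurable]
  have h1 : ∀ p, ∫⁻ q, F (p, q) = ∫⁻ k, F (p, p - k) := fun p =>
    (lintegral_sub_left_eq_self (fun q => F (p, q)) p).symm
  simp_rw [h1]
  rw [lintegral_lintegral_swap (by fun_prop)]
  have h2 : ∀ k, ∫⁻ p, F (p, p - k) ≤ C * (ENNReal.ofReal (‖k‖ ^ 2) * ‖vHat ρ k‖ₑ ^ 2) := by
    intro k
    have hms : MeasurableSet {p : R3 | p ∈ B ∧ p - k ∈ B} :=
      measurableSet_ball.inter (measurableSet_ball.preimage (by fun_prop))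
    have h3 : ∫⁻ p, F (p, p - k) = ‖vHat ρ k‖ₑ ^ 2 * ∫⁻ p in {p : R3 | p ∈ B ∧ p - k ∈ B},
        ‖dirac g₀ g₁ p - dirac g₀ g₁ (p - k)‖ₑ ^ 2 := by
      rw [← lintegral_const_mul' _ _ (ENNReal.pow_ne_top enorm_ne_top), ← lintegral_indicator hms]
      refine lintegral_congr fun p => ?_
      by_cases hp : p ∈ B ∧ p - k ∈ B
      · rw [indicator_of_mem (by exact hp), hF, indicator_of_mem (by exact hp), commKer,
          enorm_smul, mul_pow, sub_sub_cancel]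
      · rw [indicator_of_notMem (by exact hp), hF, indicator_of_notMem (by exact hp)]
    rw [h3]
    calc _ ≤ ‖vHat ρ k‖ₑ ^ 2 * (C * ENNReal.ofReal (‖k‖ ^ 2)) := by
          gcongr
          exact hCle k
      _ = _ := by ring
  refine (lintegral_mono h2).trans_lt ?_
  rw [lintegral_const_mul' _ _ hC]
  exact ENNReal.mul_lt_top hC.lt_top (lintegral_vHat_lt_top hρ)

/-- The potential is scalar, so it leaves the product and the cancellation in
`IsGapped.norm_integral_mul_le` applies. -/
theorem enorm_Q01_le (hα : 0 ≤ α) (h : IsDressedDirac α Λ g₀ g₁) {p q : R3}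
    (hp : p ∈ Metric.ball (0 : R3) Λ) (hq : q ∈ Metric.ball (0 : R3) Λ) :
    ‖Q01 g₀ g₁ ρ p q‖ₑ ≤ 4 * ‖commKer g₀ g₁ ρ p q‖ₑ := by
  have gp := isGapped_dirac hα h hp
  have gq := isGapped_dirac hα h hq
  have h1 : Q01 g₀ g₁ ρ p q = (1 / (2 * Real.pi)) • vHat ρ (p - q) •
      ∫ η, matRes (dirac g₀ g₁ p) η * matRes (dirac g₀ g₁ q) η := by
    simp only [Q01, cauchy1, VKer_eq, res_eq_matRes, mul_smul_comm, mul_one, smul_mul_assoc]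
    congr 1
    exact integral_smul _ _
  have h2 : ‖Q01 g₀ g₁ ρ p q‖ ≤ 4 * ‖commKer g₀ g₁ ρ p q‖ := by
    rw [h1, norm_smul, norm_smul, commKer, norm_smul, Real.norm_of_nonneg (by positivity)]
    calc _ ≤ 1 / (2 * Real.pi) * (‖vHat ρ (p - q)‖ * (8 * Real.pi *
          ‖dirac g₀ g₁ p - dirac g₀ g₁ q‖)) := by
          gcongr
          exact gp.norm_integral_mul_le gq
      _ = _ := by
          field_simp
          ring
  have h3 := ENNReal.ofReal_le_ofReal h2
  rwa [ENNReal.ofReal_mul (by norm_num), ofReal_norm, ofReal_norm, ENNReal.ofReal_ofNat] at h3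

theorem memS2_Q01 (hα : 0 ≤ α) (h : IsDressedDirac α Λ g₀ g₁) (hρ : IsCoulomb ρ) :
    MemS2 Λ (Q01 g₀ g₁ ρ) := by
  refine memS2_of_enorm_le (cauchy1_meas h (VKer_meas hρ)) (c := 4) (by simp)
    (StronglyMeasurable.enorm (commKer_meas h hρ)) ?_ (lintegral_commKer_lt_top h hρ)
  filter_upwards [ae_ballVol2_mem Λ] with z hz using enorm_Q01_le hα h hz.1 hz.2

/-- The cancellation occurs in the η-integral, which must therefore be taken before the one over r;
`hfin` provides the absolute convergence for this exchange. -/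
theorem enorm_Q02_le (hα : 0 ≤ α) (h : IsDressedDirac α Λ g₀ g₁) (hρ : IsCoulomb ρ) {p q : R3}
    (hp : p ∈ Metric.ball (0 : R3) Λ) (hq : q ∈ Metric.ball (0 : R3) Λ)
    (hfin : ∫⁻ r, ‖vHat ρ (p - r)‖ₑ * ‖vHat ρ (r - q)‖ₑ ∂(ballVol Λ) < ∞) :
    ‖Q02 Λ g₀ g₁ ρ p q‖ₑ ≤ 16 * ∫⁻ r, (‖commKer g₀ g₁ ρ p r‖ₑ * ‖vHat ρ (r - q)‖ₑ +
      ‖vHat ρ (p - r)‖ₑ * ‖commKer g₀ g₁ ρ r q‖ₑ) ∂(ballVol Λ) := by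
  have gp := isGapped_dirac hα h hp
  have gq := isGapped_dirac hα h hq
  have hv := measurable_vHat hρ
  have hI : Integrable (Function.uncurry fun (η : ℝ) (r : R3) =>
      (vHat ρ (p - r) * vHat ρ (r - q)) • (matRes (dirac g₀ g₁ p) η *
        matRes (dirac g₀ g₁ r) η * matRes (dirac g₀ g₁ q) η)) (volume.prod (ballVol Λ)) := by
    have hb : Integrable (fun w : ℝ × R3 => (1 ^ 2 + w.1 ^ 2)⁻¹ *
        (8 * (‖vHat ρ (p - w.2)‖ * ‖vHat ρ (w.2 - q)‖))) (volume.prod (ballVol Λ)) := by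
      refine Integrable.mul_prod (f := fun η : ℝ => (1 ^ 2 + η ^ 2)⁻¹)
        (g := fun r => 8 * (‖vHat ρ (p - r)‖ * ‖vHat ρ (r - q)‖)) (integrable_inv_sq_add_sq one_pos)
        (Integrable.const_mul ⟨by fun_prop, ?_⟩ 8)
      rw [HasFiniteIntegral]
      simpa only [enorm_mul, enorm_norm] using hfin
    refine hb.mono' ?_ ?_
    · have m1 : StronglyMeasurable fun w : ℝ × R3 => vHat ρ (p - w.2) * vHat ρ (w.2 - q) :=
        Measurable.stronglyMeasurable (by fun_prop)
      have m2 : StronglyMeasurable fun w : ℝ × R3 => res g₀ g₁ w.1 p * res g₀ g₁ w.1 w.2 *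
          res g₀ g₁ w.1 q :=
        ((stronglyMeasurable_res h (by fun_prop) (by fun_prop)).mul
          (stronglyMeasurable_res h (by fun_prop) (by fun_prop))).mul
          (stronglyMeasurable_res h (by fun_prop) (by fun_prop))
      exact (m1.smul m2).aestronglyMeasurable
    · have hmem : ∀ᵐ w : ℝ × R3 ∂(volume.prod (ballVol Λ)), w.2 ∈ Metric.ball (0 : R3) Λ :=
        Measure.quasiMeasurePreserving_snd.ae (ae_ballVol_mem Λ)
      filter_upwards [hmem] with w hw
      have gr := isGapped_dirac hα h hw
      have b1 := gp.norm_matRes_mul_le gq w.1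
      have b2 := gr.norm_matRes_le_two w.1
      simp only [Function.uncurry]
      rw [norm_smul, norm_mul]
      set P := matRes (dirac g₀ g₁ p) w.1
      set R := matRes (dirac g₀ g₁ w.2) w.1
      set S := matRes (dirac g₀ g₁ q) w.1
      calc _ ≤ ‖vHat ρ (p - w.2)‖ * ‖vHat ρ (w.2 - q)‖ * (‖P‖ * ‖R‖ * ‖S‖) := by
            gcongr
            exact norm_mul₃_le
        _ = ‖vHat ρ (p - w.2)‖ * ‖vHat ρ (w.2 - q)‖ * ((‖P‖ * ‖S‖) * ‖R‖) := by ring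
        _ ≤ ‖vHat ρ (p - w.2)‖ * ‖vHat ρ (w.2 - q)‖ * ((4 * (1 ^ 2 + w.1 ^ 2)⁻¹) * 2) := by gcongr
        _ = _ := by ring
  have h1 : Q02 Λ g₀ g₁ ρ p q = -(1 / (2 * Real.pi)) • ∫ r, (vHat ρ (p - r) * vHat ρ (r - q)) •
      (∫ η, matRes (dirac g₀ g₁ p) η * matRes (dirac g₀ g₁ r) η * matRes (dirac g₀ g₁ q) η)
        ∂(ballVol Λ) := by
    have hs : ∀ r, (vHat ρ (p - r) * vHat ρ (r - q)) • (∫ η, matRes (dirac g₀ g₁ p) η *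
        matRes (dirac g₀ g₁ r) η * matRes (dirac g₀ g₁ q) η) =
        ∫ η, (vHat ρ (p - r) * vHat ρ (r - q)) • (matRes (dirac g₀ g₁ p) η *
          matRes (dirac g₀ g₁ r) η * matRes (dirac g₀ g₁ q) η) := fun r => (integral_smul _ _).symm
    rw [integral_congr_ae (Eventually.of_forall hs), Q02, cauchy2, ← integral_integral_swap hI]
    congr 2
    ext1 η
    rw [ballVol]
    congr 1
    ext1 r
    simp only [VKer_eq, res_eq_matRes, mul_smul_comm, mul_one, smul_mul_assoc, smul_smul]
    rw [mul_comm]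
  rw [h1, enorm_smul, enorm_neg, Real.enorm_eq_ofReal (by positivity)]
  calc _ ≤ ENNReal.ofReal (1 / (2 * Real.pi)) * ∫⁻ r, ENNReal.ofReal (32 * Real.pi) *
        (‖commKer g₀ g₁ ρ p r‖ₑ * ‖vHat ρ (r - q)‖ₑ +
          ‖vHat ρ (p - r)‖ₑ * ‖commKer g₀ g₁ ρ r q‖ₑ) ∂(ballVol Λ) := by
        gcongr
        refine (enorm_integral_le_lintegral_enorm _).trans (lintegral_mono_ae ?_)
        filter_upwards [ae_ballVol_mem Λ] with r hr
        have gr := isGapped_dirac hα h hr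
        have h2 := gp.norm_integral_mul_mul_le gq gr
        have h3 : ‖(vHat ρ (p - r) * vHat ρ (r - q)) • ∫ η, matRes (dirac g₀ g₁ p) η *
            matRes (dirac g₀ g₁ r) η * matRes (dirac g₀ g₁ q) η‖ ≤ 32 * Real.pi *
            (‖commKer g₀ g₁ ρ p r‖ * ‖vHat ρ (r - q)‖ +
              ‖vHat ρ (p - r)‖ * ‖commKer g₀ g₁ ρ r q‖) := by
          rw [norm_smul, norm_mul, commKer, commKer, norm_smul, norm_smul]
          calc _ ≤ ‖vHat ρ (p - r)‖ * ‖vHat ρ (r - q)‖ * (32 * Real.pi *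
                (‖dirac g₀ g₁ p - dirac g₀ g₁ r‖ + ‖dirac g₀ g₁ r - dirac g₀ g₁ q‖)) := by gcongr
            _ = _ := by ring
        have h4 := ENNReal.ofReal_le_ofReal h3
        rwa [ENNReal.ofReal_mul (by positivity), ENNReal.ofReal_add (by positivity) (by positivity),
          ENNReal.ofReal_mul (norm_nonneg _), ENNReal.ofReal_mul (norm_nonneg _), ofReal_norm,
          ofReal_norm, ofReal_norm, ofReal_norm, ofReal_norm] at h4
    _ = _ := by
        rw [lintegral_const_mul' _ _ ENNReal.ofReal_ne_top, ← mul_assoc,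
          ← ENNReal.ofReal_mul (by positivity),
          show 1 / (2 * Real.pi) * (32 * Real.pi) = 16 by field_simp; norm_num]
        simp

theorem add_sq_le_four_mul (a b : ℝ≥0∞) : (a + b) ^ 2 ≤ 4 * a ^ 2 + 4 * b ^ 2 := by
  rcases le_total a b with hab | hab
  · calc (a + b) ^ 2 ≤ (b + b) ^ 2 := by gcongr
      _ = 4 * b ^ 2 := by ring
      _ ≤ _ := le_add_self
  · calc (a + b) ^ 2 ≤ (a + a) ^ 2 := by gcongr
      _ = 4 * a ^ 2 := by ring
      _ ≤ _ := le_self_add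

theorem lintegral_add_sq_lt_top {F G : R3 × R3 → ℝ≥0∞} (hF : Measurable F) (hG : Measurable G)
    (hF' : ∫⁻ p, ∫⁻ q, F (p, q) ^ 2 ∂(ballVol Λ) ∂(ballVol Λ) < ∞)
    (hG' : ∫⁻ p, ∫⁻ q, G (p, q) ^ 2 ∂(ballVol Λ) ∂(ballVol Λ) < ∞) :
    ∫⁻ p, ∫⁻ q, (F (p, q) + G (p, q)) ^ 2 ∂(ballVol Λ) ∂(ballVol Λ) < ∞ := by
  rw [← lintegral_ballVol2 (f := fun z => F z ^ 2) (hF.pow_const 2)] at hF'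
  rw [← lintegral_ballVol2 (f := fun z => G z ^ 2) (hG.pow_const 2)] at hG'
  rw [← lintegral_ballVol2 (f := fun z => (F z + G z) ^ 2) ((hF.add hG).pow_const 2)]
  refine (lintegral_mono fun z => add_sq_le_four_mul (F z) (G z)).trans_lt ?_
  rw [lintegral_add_left (by fun_prop), lintegral_const_mul _ (by fun_prop),
    lintegral_const_mul _ (by fun_prop)]
  exact ENNReal.add_lt_top.2 ⟨ENNReal.mul_lt_top (by simp) hF', ENNReal.mul_lt_top (by simp) hG'⟩

theorem ae_lintegral_vHat_lt_top (hρ : IsCoulomb ρ) : ∀ᵐ z ∂(ballVol2 Λ),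
    ∫⁻ r, ‖vHat ρ (z.1 - r)‖ₑ * ‖vHat ρ (r - z.2)‖ₑ ∂(ballVol Λ) < ∞ := by
  have hv := measurable_vHat hρ
  set M := ∫⁻ k in Metric.ball 0 (2 * Λ), ‖vHat ρ k‖ₑ with hM
  have hMt : M ≠ ∞ := (lintegral_ball_vHat_lt_top hρ _).ne
  have hM2 : ∀ᵐ r ∂(ballVol Λ), ∫⁻ q, ‖vHat ρ (r - q)‖ₑ ∂(ballVol Λ) ≤ M := by
    filter_upwards [ae_ballVol_mem Λ] with p hp using lintegral_vHat_sub_right_le p hp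
  have hm : Measurable fun z : R3 × R3 =>
      ∫⁻ r, ‖vHat ρ (z.1 - r)‖ₑ * ‖vHat ρ (r - z.2)‖ₑ ∂(ballVol Λ) :=
    Measurable.lintegral_prod_right (f := fun (z : R3 × R3) (r : R3) =>
      ‖vHat ρ (z.1 - r)‖ₑ * ‖vHat ρ (r - z.2)‖ₑ) (by fun_prop)
  refine ae_lt_top hm (ne_of_lt ?_)
  rw [lintegral_ballVol2 hm]
  have hle : ∀ᵐ p ∂(ballVol Λ), ∫⁻ q, ∫⁻ r, ‖vHat ρ (p - r)‖ₑ * ‖vHat ρ (r - q)‖ₑ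
      ∂(ballVol Λ) ∂(ballVol Λ) ≤ M * M := by
    filter_upwards [hM2] with p hp
    rw [lintegral_lintegral_swap (by fun_prop)]
    calc _ ≤ ∫⁻ r, ‖vHat ρ (p - r)‖ₑ * M ∂(ballVol Λ) := by
          refine lintegral_mono_ae ?_
          filter_upwards [hM2] with r hr
          rw [lintegral_const_mul _ (by fun_prop)]
          gcongr
      _ ≤ _ := by
          rw [lintegral_mul_const _ (by fun_prop)]
          gcongr
  refine (lintegral_mono_ae hle).trans_lt ?_
  rw [lintegral_const]
  exact ENNReal.mul_lt_top (ENNReal.mul_lt_top hMt.lt_top hMt.lt_top) (measure_lt_top _ _)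

/-- v_ρ itself need not be Hilbert-Schmidt. Each term of the bound composes the Hilbert-Schmidt
commutator kernel with |v̂|, which is bounded by Schur's test. -/
theorem memS2_Q02 (hα : 0 ≤ α) (h : IsDressedDirac α Λ g₀ g₁) (hρ : IsCoulomb ρ) :
    MemS2 Λ (Q02 Λ g₀ g₁ ρ) := by
  have hv := measurable_vHat hρ
  set M := ∫⁻ k in Metric.ball 0 (2 * Λ), ‖vHat ρ k‖ₑ with hM
  have hMt : M ≠ ∞ := (lintegral_ball_vHat_lt_top hρ _).ne
  have hM1 : ∀ᵐ q ∂(ballVol Λ), ∫⁻ r, ‖vHat ρ (r - q)‖ₑ ∂(ballVol Λ) ≤ M := by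
    filter_upwards [ae_ballVol_mem Λ] with q hq using lintegral_vHat_sub_left_le q hq
  have hM2 : ∀ᵐ r ∂(ballVol Λ), ∫⁻ q, ‖vHat ρ (r - q)‖ₑ ∂(ballVol Λ) ≤ M := by
    filter_upwards [ae_ballVol_mem Λ] with p hp using lintegral_vHat_sub_right_le p hp
  have hmW : Measurable (Function.uncurry fun p q => ‖vHat ρ (p - q)‖ₑ) := by
    unfold Function.uncurry
    fun_prop
  have hmC : Measurable (Function.uncurry fun p q => ‖commKer g₀ g₁ ρ p q‖ₑ) :=
    StronglyMeasurable.enorm (commKer_meas h hρ)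
  have hC := lintegral_commKer_lt_top h hρ
  set F₁ : R3 × R3 → ℝ≥0∞ := fun z =>
    ∫⁻ r, ‖commKer g₀ g₁ ρ z.1 r‖ₑ * ‖vHat ρ (r - z.2)‖ₑ ∂(ballVol Λ) with hF₁
  set F₂ : R3 × R3 → ℝ≥0∞ := fun z =>
    ∫⁻ r, ‖vHat ρ (z.1 - r)‖ₑ * ‖commKer g₀ g₁ ρ r z.2‖ₑ ∂(ballVol Λ) with hF₂
  have m1 : Measurable F₁ := measurable_lintegral_comp hmC hmW
  have m2 : Measurable F₂ := measurable_lintegral_comp hmW hmC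
  have hfin := ENNReal.mul_lt_top (ENNReal.pow_lt_top (n := 2) hMt.lt_top) hC
  have f1 : ∫⁻ p, ∫⁻ q, F₁ (p, q) ^ 2 ∂(ballVol Λ) ∂(ballVol Λ) < ∞ :=
    (lintegral_comp_sq_le hmC hmW hM1 hM2).trans_lt hfin
  have f2 : ∫⁻ p, ∫⁻ q, F₂ (p, q) ^ 2 ∂(ballVol Λ) ∂(ballVol Λ) < ∞ :=
    (lintegral_comp_sq_le' hmC hmW hM1 hM2).trans_lt hfin
  have hV := VKer_meas hρ
  refine memS2_of_enorm_le (cauchy2_meas h hV hV) (c := 16) (by simp) (F := fun z => F₁ z + F₂ z)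
    (m1.add m2) ?_ ?_
  · filter_upwards [ae_ballVol2_mem Λ, ae_lintegral_vHat_lt_top hρ] with z hz hz'
    refine (enorm_Q02_le hα h hρ hz.1 hz.2 hz').trans (le_of_eq ?_)
    exact congrArg (16 * ·) (lintegral_mul_comp_add hmC hmW _ z)
  · exact lintegral_add_sq_lt_top m1 m2 f1 f2

end Memberships

section ChargeConjugation

variable {α Λ : ℝ} {g₀ g₁ : ℝ → ℝ} {ρ : TemperedDistribution R3 ℂ}

/-! ### Charge conjugation composed with transposition -/

/-- The matrix `β α₂`. -/
def conjMat : M4 :=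
  !![0, 0, 0, -Complex.I; 0, 0, Complex.I, 0; 0, Complex.I, 0, 0; -Complex.I, 0, 0, 0]

theorem conjMat_mul_self : conjMat * conjMat = -1 := by
  ext i j
  fin_cases i <;> fin_cases j <;> simp [conjMat, Matrix.mul_apply, Fin.sum_univ_four]

theorem conjMat_transpose : conjMat.transpose = conjMat := by
  ext i j
  fin_cases i <;> fin_cases j <;> simp [conjMat]

/-- The involutive anti-automorphism `M ↦ U Mᵀ U⁻¹` with `U = β α₂`, `U⁻¹ = -U`. -/
def matConj (M : M4) : M4 := -conjMat * M.transpose * conjMat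

theorem matConj_mul (A B : M4) : matConj (A * B) = matConj B * matConj A := by
  have : matConj B * matConj A =
      conjMat * B.transpose * (conjMat * conjMat) * A.transpose * conjMat := by
    simp only [matConj, neg_mul, mul_neg, neg_neg, mul_assoc]
  rw [this, conjMat_mul_self, matConj, Matrix.transpose_mul]
  simp only [neg_mul, mul_neg, mul_one, mul_assoc]

theorem matConj_one : matConj 1 = 1 := by
  rw [matConj, Matrix.transpose_one, mul_one, neg_mul, conjMat_mul_self, neg_neg]

theorem matConj_add (A B : M4) : matConj (A + B) = matConj A + matConj B := by
  simp only [matConj, Matrix.transpose_add, mul_add, add_mul]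

theorem matConj_smul (c : ℂ) (A : M4) : matConj (c • A) = c • matConj A := by
  simp only [matConj, Matrix.transpose_smul, mul_smul_comm, smul_mul_assoc]

theorem matConj_matConj (A : M4) : matConj (matConj A) = A := by
  have : matConj (matConj A) = (conjMat * conjMat) * A * (conjMat * conjMat) := by
    simp only [matConj, Matrix.transpose_mul, Matrix.transpose_neg, Matrix.transpose_transpose,
      conjMat_transpose, neg_mul, mul_neg, neg_neg, mul_assoc]
  rw [this, conjMat_mul_self]
  simp

theorem matConj_inv (A : M4) : matConj A⁻¹ = (matConj A)⁻¹ := by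
  have h1 : conjMat⁻¹ = -conjMat :=
    Matrix.inv_eq_right_inv (by rw [mul_neg, conjMat_mul_self, neg_neg])
  have h2 : (-conjMat)⁻¹ = conjMat :=
    Matrix.inv_eq_right_inv (by rw [neg_mul, conjMat_mul_self, neg_neg])
  rw [matConj, matConj, Matrix.mul_inv_rev, Matrix.mul_inv_rev, h1, h2, Matrix.transpose_nonsing_inv,
    mul_assoc]

/-- Each α_j is fixed and β changes sign, as the matrix entries show. -/
theorem matConj_cliff (v : R3) (t : ℝ) : matConj (cliff v t) = cliff v (-t) := by
  have hI := Complex.I_sq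
  have hI3 := Complex.I_pow_three
  rw [matConj, cliff_eq, cliff_eq, conjMat]
  ext i j
  fin_cases i <;> fin_cases j <;>
    simp [Matrix.mul_apply, Matrix.vecMul, dotProduct, Fin.sum_univ_four] <;>
    ring_nf <;> simp only [hI, hI3] <;> ring_nf

theorem trace_matConj (A : M4) : (matConj A).trace = A.trace := by
  rw [matConj, Matrix.trace_mul_comm, ← mul_assoc, mul_neg, conjMat_mul_self, neg_neg, one_mul,
    Matrix.trace_transpose]

/-- `matConj` as a continuous linear equivalence. -/
def matConjEquiv : M4 ≃L[ℂ] M4 :=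
  LinearEquiv.toContinuousLinearEquiv
    { toFun := matConj
      map_add' := matConj_add
      map_smul' := matConj_smul
      invFun := matConj
      left_inv := matConj_matConj
      right_inv := matConj_matConj }

/-- An equivalence commutes with the Bochner integral even where that takes its default value, so
the symmetry identities below need no integrability. -/
theorem matConj_integral {X : Type*} [MeasurableSpace X] (μ : Measure X) (f : X → M4) :
    matConj (∫ x, f x ∂μ) = ∫ x, matConj (f x) ∂μ :=
  (matConjEquiv.integral_comp_comm f).symm

theorem matConj_real_smul (c : ℝ) (A : M4) : matConj (c • A) = c • matConj A := by
  rw [← Complex.coe_smul, matConj_smul, Complex.coe_smul]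

theorem matConj_neg (A : M4) : matConj (-A) = -matConj A := map_neg matConjEquiv A

theorem matConj_zero : matConj 0 = 0 := map_zero matConjEquiv

theorem matrix_neg_inv (A : M4) : (-A)⁻¹ = -A⁻¹ := by
  have h1 : (-1 : M4)⁻¹ = -1 := Matrix.inv_eq_right_inv (by simp)
  rw [← neg_one_mul, Matrix.mul_inv_rev, h1, mul_neg_one]

/-- Flipping β is the same as negating the whole symbol and reversing its vector part; that part is
odd in p and the profiles are radial. -/
theorem matConj_dirac (p : R3) : matConj (dirac g₀ g₁ p) = -dirac g₀ g₁ (-p) := by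
  have h : ∀ v t, cliff v (-t) = -cliff (-v) t := fun v t => by
    have := cliff_sub 0 (-v) 0 t
    have h0 : cliff 0 0 = 0 := by simpa using (cliff_sub 0 0 0 0).symm
    rw [h0, zero_sub, zero_sub, zero_sub, neg_neg] at this
    exact this.symm
  rw [dirac_eq_cliff, dirac_eq_cliff, matConj_cliff, h, norm_neg]
  congr 2
  simp [dressedVec]

theorem matConj_res (η : ℝ) (p : R3) : matConj (res g₀ g₁ η p) = -res g₀ g₁ (-η) (-p) := by
  rw [res, res, matConj_inv, matConj_add, matConj_smul, matConj_one, matConj_dirac,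
    ← matrix_neg_inv]
  congr 1
  push_cast
  rw [mul_neg, neg_smul, neg_add, neg_neg]

/-- The kernel of `U Qᵀ U⁻¹`, where `Qᵀ` is the transpose of `Q` in position space. -/
def Ker.conj (Q : Ker) : Ker := fun p q => matConj (Q (-q) (-p))

theorem Ker.conj_VKer : (VKer ρ).conj = VKer ρ := by
  ext1 p
  ext1 q
  rw [Ker.conj, VKer_eq, VKer_eq, matConj_smul, matConj_one, neg_sub_neg]

theorem Ker.conj_neg (Q : Ker) : (-Q).conj = -Q.conj := by
  ext1 p
  ext1 q
  exact matConj_neg _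

theorem Ker.ext_conj (Q : Ker) (p q : R3) :
    Q.conj.ext Λ (p, q) = matConj (Q.ext Λ (-q, -p)) := by
  have hiff : ((p, q) ∈ Metric.ball (0 : R3) Λ ×ˢ Metric.ball (0 : R3) Λ) ↔
      ((-q, -p) ∈ Metric.ball (0 : R3) Λ ×ˢ Metric.ball (0 : R3) Λ) := by
    simp [and_comm]
  by_cases h : (p, q) ∈ Metric.ball (0 : R3) Λ ×ˢ Metric.ball (0 : R3) Λ
  · rw [Ker.ext, Ker.ext, indicator_of_mem h, indicator_of_mem (hiff.1 h)]
    rfl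
  · rw [Ker.ext, Ker.ext, indicator_of_notMem h, indicator_of_notMem (fun h' => h (hiff.2 h')),
      matConj_zero]

/-- Substitute l ↦ -l; the weight |l|⁻² is even and the cut-off region is symmetric. -/
theorem Ker.conj_RKer (Q : Ker) : (RKer Λ Q).conj = RKer Λ Q.conj := by
  ext1 p
  ext1 q
  rw [Ker.conj, RKer_eq, RKer_eq, matConj_real_smul, matConj_integral]
  congr 1
  rw [← integral_neg_eq_self]
  congr 1
  ext1 l
  rw [matConj_real_smul, Ker.ext_conj, norm_neg]
  congr 4 <;> abel

/-- The signs of the two resolvents cancel, and η ↦ -η restores the integrand. -/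
theorem Ker.conj_cauchy1 (A : Ker) : (cauchy1 g₀ g₁ A).conj = cauchy1 g₀ g₁ A.conj := by
  ext1 p
  ext1 q
  rw [Ker.conj, cauchy1, cauchy1, matConj_real_smul, matConj_integral]
  congr 1
  rw [← integral_neg_eq_self]
  congr 1
  ext1 η
  rw [matConj_mul, matConj_mul, matConj_res, matConj_res, neg_neg, neg_neg, neg_neg]
  simp only [neg_mul, mul_neg, neg_neg, mul_assoc]
  rfl

theorem measurePreserving_neg_ballVol (Λ : ℝ) :
    MeasurePreserving (Neg.neg : R3 → R3) (ballVol Λ) (ballVol Λ) := by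
  have h := (Measure.measurePreserving_neg (volume : Measure R3)).restrict_preimage
    (measurableSet_ball (x := (0 : R3)) (ε := Λ))
  have hs : (Neg.neg : R3 → R3) ⁻¹' Metric.ball 0 Λ = Metric.ball 0 Λ := by
    ext x
    simp
  rwa [hs] at h

theorem integral_neg_ballVol (f : R3 → M4) :
    ∫ r, f (-r) ∂(ballVol Λ) = ∫ r, f r ∂(ballVol Λ) :=
  (measurePreserving_neg_ballVol Λ).integral_comp (MeasurableEquiv.neg R3).measurableEmbedding f

/-- Three resolvents leave one sign, the source of the theorem; the anti-automorphism also exchanges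
A and B. -/
theorem Ker.conj_cauchy2 (A B : Ker) :
    (cauchy2 Λ g₀ g₁ A B).conj = -cauchy2 Λ g₀ g₁ B.conj A.conj := by
  ext1 p
  ext1 q
  change matConj (cauchy2 Λ g₀ g₁ A B (-q) (-p)) = -cauchy2 Λ g₀ g₁ B.conj A.conj p q
  rw [cauchy2, cauchy2, matConj_real_smul, matConj_integral, ← smul_neg, ← integral_neg]
  congr 1
  rw [← integral_neg_eq_self]
  congr 1
  ext1 η
  rw [matConj_integral, ← integral_neg]
  refine (integral_neg_ballVol _).symm.trans ?_
  rw [ballVol]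
  congr 1
  ext1 r
  simp only [matConj_mul, matConj_res, neg_neg, neg_mul, mul_neg, mul_assoc, Ker.conj]

/-- The map `(p, q) ↦ (-q, -p)`. -/
def swapNeg (z : R3 × R3) : R3 × R3 := (-z.2, -z.1)

theorem measurePreserving_swapNeg (Λ : ℝ) :
    MeasurePreserving swapNeg (ballVol2 Λ) (ballVol2 Λ) :=
  ((measurePreserving_neg_ballVol Λ).prod (measurePreserving_neg_ballVol Λ)).comp
    Measure.measurePreserving_swap

theorem measurableEmbedding_swapNeg : MeasurableEmbedding swapNeg :=
  ((MeasurableEquiv.neg R3).prodCongr (MeasurableEquiv.neg R3)).measurableEmbedding.comp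
    MeasurableEquiv.prodComm.measurableEmbedding

theorem Ker.Eqv.conj {Q Q' : Ker} (h : Q.Eqv Λ Q') : Q.conj.Eqv Λ Q'.conj := by
  filter_upwards [(measurePreserving_swapNeg Λ).quasiMeasurePreserving.ae h] with z hz
  exact congrArg matConj hz

theorem MemS2.conj {Q : Ker} (h : MemS2 Λ Q) : MemS2 Λ Q.conj :=
  memS2_iff.2 (matConjEquiv.toContinuousLinearMap.comp_memLp'
    ((memS2_iff.1 h).comp_measurePreserving (measurePreserving_swapNeg Λ)))

/-! ### Densities -/

/-- On the diagonal the phase (p-q)·x is invariant under (p,q) ↦ (-q,-p), and the trace is invariant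
under `matConj`. -/
theorem density_conj (Q : Ker) (x : R3) : density Λ Q.conj x = density Λ Q x := by
  have h : posKernel Λ Q.conj x x = matConj (posKernel Λ Q x x) := by
    rw [posKernel, posKernel, matConj_real_smul, matConj_integral]
    congr 1
    rw [← (measurePreserving_swapNeg Λ).integral_comp measurableEmbedding_swapNeg]
    congr 1
    ext1 z
    rw [matConj_smul]
    simp only [swapNeg, Ker.conj, inner_neg_left, neg_neg]
    congr 4
    ring
  rw [density, density, h, trace_matConj]

theorem density_congr {Q Q' : Ker} (h : Q.Eqv Λ Q') (x : R3) : density Λ Q x = density Λ Q' x := by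
  rw [density, density, posKernel, posKernel]
  congr 2
  refine integral_congr_ae ?_
  filter_upwards [h] with z hz
  rw [hz]

theorem density_neg (Q : Ker) (x : R3) : density Λ (-Q) x = -density Λ Q x := by
  have h : posKernel Λ (-Q) x x = -posKernel Λ Q x x := by
    rw [posKernel, posKernel, ← smul_neg, ← integral_neg]
    simp only [Pi.neg_apply, smul_neg]
  rw [density, density, h, Matrix.trace_neg]

theorem density_eq_zero_of_conj {Q : Ker} (h : Q.conj.Eqv Λ (-Q)) (x : R3) :
    density Λ Q x = 0 := by
  have h1 := density_congr h x
  rw [density_conj, density_neg] at h1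
  exact self_eq_neg.1 h1

/-! ### Symmetry of the Cauchy expansion and of `𝐓` -/

theorem RKer_neg (Q : Ker) : RKer Λ (-Q) = -RKer Λ Q := by
  ext1 p
  ext1 q
  simp only [RKer, Pi.neg_apply, smul_neg, integral_neg]

theorem cauchy1_neg (A : Ker) : cauchy1 g₀ g₁ (-A) = -cauchy1 g₀ g₁ A := by
  ext1 p
  ext1 q
  simp only [cauchy1, Pi.neg_apply, mul_neg, neg_mul, integral_neg, smul_neg]

theorem Q10_neg (Q : Ker) : Q10 Λ g₀ g₁ (-Q) = -Q10 Λ g₀ g₁ Q := by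
  rw [Q10, Q10, RKer_neg, cauchy1_neg]

theorem Q10_conj (Q : Ker) : (Q10 Λ g₀ g₁ Q).conj = Q10 Λ g₀ g₁ Q.conj := by
  rw [Q10, Q10, Ker.conj_cauchy1, Ker.conj_neg, Ker.conj_RKer]

theorem Q01_conj : (Q01 g₀ g₁ ρ).conj = Q01 g₀ g₁ ρ := by
  rw [Q01, Ker.conj_cauchy1, Ker.conj_VKer]

theorem Q02_conj : (Q02 Λ g₀ g₁ ρ).conj = -Q02 Λ g₀ g₁ ρ := by
  rw [Q02, Ker.conj_cauchy2, Ker.conj_VKer]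

/-- The reversal of factors exchanges the two orderings of R_Q and v_ρ, so only their sum is odd
when Q is even. -/
theorem Q11_conj (Q : Ker) : (Q11 Λ g₀ g₁ Q ρ).conj = -Q11 Λ g₀ g₁ Q.conj ρ := by
  have h : ∀ A B : Ker, (A + B).conj = A.conj + B.conj := fun A B => by
    ext1 p
    ext1 q
    exact matConj_add _ _
  rw [Q11, Q11, h, Ker.conj_cauchy2, Ker.conj_cauchy2, Ker.conj_VKer, Ker.conj_neg,
    Ker.conj_RKer, neg_add, add_comm]

theorem Q11_congr {Q Q' : Ker} (h : Q.Eqv Λ Q') :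
    (Q11 Λ g₀ g₁ Q ρ).Eqv Λ (Q11 Λ g₀ g₁ Q' ρ) := by
  have hR : (-RKer Λ Q).Eqv Λ (-RKer Λ Q') := by
    filter_upwards [ae_ballVol2_of_ae (RKer_congr h)] with z hz using congrArg Neg.neg hz
  have hV : (VKer ρ).Eqv Λ (VKer ρ) := Eventually.of_forall fun _ => rfl
  filter_upwards [cauchy2_congr (g₀ := g₀) (g₁ := g₁) hR hV,
    cauchy2_congr (g₀ := g₀) (g₁ := g₁) hV hR] with z h1 h2
  exact congrArg₂ (· + ·) h1 h2

theorem Ker.Eqv.neg {Q Q' : Ker} (h : Q.Eqv Λ Q') : (-Q).Eqv Λ (-Q') := by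
  filter_upwards [h] with z hz using congrArg Neg.neg hz

theorem IsTImage.conj {Q X : Ker} (h : IsTImage α Λ g₀ g₁ Q X) :
    IsTImage α Λ g₀ g₁ Q.conj X.conj := by
  refine ⟨h.1.1.conj.memQ1, ?_⟩
  have h1 : (X - α • Q10 Λ g₀ g₁ X).conj = X.conj - α • Q10 Λ g₀ g₁ X.conj := by
    rw [← Q10_conj]
    ext1 p
    ext1 q
    change matConj (_ - _) = _
    rw [sub_eq_add_neg, matConj_add, matConj_neg, ← sub_eq_add_neg]
    exact congrArg _ (matConj_real_smul _ _)
  rw [← h1]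
  exact h.2.conj

theorem IsTImage.neg {Q X : Ker} (h : IsTImage α Λ g₀ g₁ Q X) :
    IsTImage α Λ g₀ g₁ (-Q) (-X) := by
  refine ⟨h.1.1.neg.memQ1, ?_⟩
  rw [Q10_neg, smul_neg, ← neg_sub']
  exact h.2.neg

theorem IsTImage.congr {Q Q' X : Ker} (h : IsTImage α Λ g₀ g₁ Q X) (he : Q.Eqv Λ Q') :
    IsTImage α Λ g₀ g₁ Q' X :=
  ⟨h.1, h.2.trans he⟩

theorem TWellDefined.isTImage_T (hT : TWellDefined α Λ g₀ g₁) {Q : Ker} (hQ : MemQ1 Λ Q) :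
    IsTImage α Λ g₀ g₁ Q (T α Λ g₀ g₁ Q) := by
  obtain ⟨X, hX, -⟩ := hT.2 Q hQ
  have h : ∃ X, IsTImage α Λ g₀ g₁ Q X := ⟨X, hX⟩
  rw [T, dif_pos h]
  exact h.choose_spec

theorem TWellDefined.eqv (hT : TWellDefined α Λ g₀ g₁) {Q X Y : Ker} (hQ : MemQ1 Λ Q)
    (hX : IsTImage α Λ g₀ g₁ Q X) (hY : IsTImage α Λ g₀ g₁ Q Y) : X.Eqv Λ Y := by
  obtain ⟨Z, -, hZ⟩ := hT.2 Q hQ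
  exact (hZ X hX).trans (hZ Y hY).symm

theorem TWellDefined.conj_T (hT : TWellDefined α Λ g₀ g₁) {Q : Ker} (hQ : MemQ1 Λ Q)
    (h : Q.conj.Eqv Λ Q) : (T α Λ g₀ g₁ Q).conj.Eqv Λ (T α Λ g₀ g₁ Q) :=
  hT.eqv hQ ((hT.isTImage_T hQ).conj.congr h) (hT.isTImage_T hQ)

/-- The conjugate and the negative of 𝐓(Q) both solve the equation with right-hand side -Q, so
uniqueness makes 𝐓(Q) odd. -/
theorem TWellDefined.density_T_eq_zero (hT : TWellDefined α Λ g₀ g₁) {Q : Ker} (hQ : MemQ1 Λ Q)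
    (h : Q.conj.Eqv Λ (-Q)) (x : R3) : density Λ (T α Λ g₀ g₁ Q) x = 0 :=
  density_eq_zero_of_conj (hT.eqv hQ.1.neg.memQ1 ((hT.isTImage_T hQ).conj.congr h)
    (hT.isTImage_T hQ).neg) x

end ChargeConjugation

end BDF

end

/-! ### Conclusion: smallness of α, memberships and parity -/

theorem theorem1 :
    ∃ α₀ > (0 : ℝ), ∃ K > (0 : ℝ),
      ∀ α Λ : ℝ, 0 < α → α ≤ α₀ → 1 ≤ Λ → α * Real.sqrt (Real.log Λ) ≤ K →
      ∀ g₀ g₁ : ℝ → ℝ, BDF.IsDressedDirac α Λ g₀ g₁ →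
        BDF.TWellDefined α Λ g₀ g₁ ∧
        ∀ ρ₀ ρ₁ : TemperedDistribution BDF.R3 ℂ, BDF.IsCoulomb ρ₀ → BDF.IsCoulomb ρ₁ →
          (BDF.MemQ1 Λ (BDF.Q02 Λ g₀ g₁ ρ₀) ∧
            ∀ x, BDF.density Λ (BDF.T α Λ g₀ g₁ (BDF.Q02 Λ g₀ g₁ ρ₀)) x = 0) ∧
          (BDF.MemQ1 Λ (BDF.Q01 g₀ g₁ ρ₁) ∧
            BDF.MemQ1 Λ
              (BDF.Q11 Λ g₀ g₁ (BDF.T α Λ g₀ g₁ (BDF.Q01 g₀ g₁ ρ₁)) ρ₀) ∧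
            ∀ x, BDF.density Λ (BDF.T α Λ g₀ g₁
              (BDF.Q11 Λ g₀ g₁ (BDF.T α Λ g₀ g₁ (BDF.Q01 g₀ g₁ ρ₁)) ρ₀)) x = 0) := by
  have hr := BDF.rConst_nonneg
  -- The bound on α makes the Lipschitz constant 2α · `rConst` of the fixed point map less than 1
  -- for every Λ.
  refine ⟨1 / (2 * BDF.rConst + 1), by positivity, 1, one_pos, ?_⟩
  intro α Λ hα hα₀ _ _ g₀ g₁ h
  have hsmall : α * (2 * BDF.rConst) < 1 := by
    rw [le_div_iff₀ (by positivity)] at hα₀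
    linarith
  have hT := BDF.tWellDefined_of_small hα.le h hsmall
  refine ⟨hT, fun ρ₀ ρ₁ hρ₀ hρ₁ => ?_⟩
  have h02 := (BDF.memS2_Q02 hα.le h hρ₀).memQ1
  have h01 := (BDF.memS2_Q01 hα.le h hρ₁).memQ1
  have h11 := ((hT.isTImage_T h01).1.1.Q11 hα.le h hρ₀).memQ1
  refine ⟨⟨h02, hT.density_T_eq_zero h02 ?_⟩, h01, h11, hT.density_T_eq_zero h11 ?_⟩
  · rw [BDF.Q02_conj]
    exact Filter.Eventually.of_forall fun _ => rfl
  · rw [BDF.Q11_conj]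
    -- Q_{0,1}(ρ₁) is even, hence so is its image under 𝐓, and the Q_{1,1} term built from it is
    -- odd.
    refine (BDF.Q11_congr (hT.conj_T h01 ?_)).neg
    rw [BDF.Q01_conj]
    exact Filter.Eventually.of_forall fun _ => rfl
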